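/- Let $a:[0,1]\to[0,\infty)$ degenerate at a point $x_0\in(0,1)$: $a(x_0)=0$, $a>0$ on $[0,1]\setminus\{x_0\}$, and assume that one of the following holds: * (weak degeneracy) $a\in W^{1,1}(0,1)$ and there is $K\in(0,1)$ with $(x-x_0)a'\le Ka$ a.e. in $[0,1]$; * (strong degeneracy) $a\in W^{1,\infty}(0,1)$ and there is $K\in[1,2)$ with $(x-x_0)a'\le Ka$ a.e. in $[0,1]$. Assume moreover that $\dfrac{(x-x_0)a'(x)}{a(x)}\in W^{1,\infty}(0,1)$ and that, if $K\ge \tfrac12$, there is a constant $\vartheta\in(0,K]$ such that $x\mapsto a(x)/|x-x_0|^{\vartheta}$ is nonincreasing on the left of $x_0$ and nondecreasing on the right of $x_0$. Let $T>0$, $Q_T=(0,T)\times(0,1)$, $R>0$, $d_1>0$, $$d_2>\max\left\{\frac{(1-x_0)^2e^{R(1-x_0)^2}}{(2-K)a(1)},\ \frac{x_0^2e^{Rx_0^2}}{(2-K)a(0)}\right\},$$ and put $$\Theta(t)=\frac1{[t(T-t)]^4},\qquad \psi(x)=d_1\left(\int_{x_0}^x\frac{y-x_0}{a(y)}e^{R(y-x_0)^2}\,dy-d_2\right),\qquad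 \varphi(t,x)=\Theta(t)\psi(x).$$ Let $L^2_{1/a}(0,1)=\{u\in L^2(0,1):\int_0^1u^2/a\,dx<\infty\}$ with norm $\|u\|_{L^2_{1/a}}^2=\int_0^1u^2/a\,dx$; let $\mathcal H^1_{1/a}(0,1)=L^2_{1/a}(0,1)\cap H^1_0(0,1)$ with norm $\|u\|^2_{\mathcal H^1_{1/a}}=\|u\|_{L^2_{1/a}}^2+\|u'\|_{L^2}^2$; and let $\mathcal H^2_{1/a}(0,1)=\{u\in\mathcal H^1_{1/a}(0,1):u'\in H^1(0,1)\}$ with norm $\|u\|^2_{\mathcal H^2_{1/a}}=\|u\|^2_{\mathcal H^1_{1/a}}+\|au''\|_{L^2_{1/a}}^2$. Then there exist two positive constants $C$ and $s_0$ such that, for every function $h$ and every $$v\in\mathcal S_2:=H^1\big(0,T;\mathcal H^1_{1/a}(0,1)\big)\cap L^2\big(0,T;\mathcal H^2_{1/a}(0,1)\big)$$ that solves $$v_t+av_{xx}=h\ \text{ a.e. in } Q_T,\qquad v(t,0)=v(t,1)=0\ \text{ for } t\in(0,T),$$ and for every $s\ge s_0$, all the integrals below are finite and $$\int_{Q_T}\left(s\Theta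 v_x^2+s^3\Theta^3\left(\frac{x-x_0}{a}\right)^2v^2\right)e^{2s\varphi}\,dx\,dt\le C\left(\int_{Q_T}h^2\,\frac{e^{2s\varphi}}{a}\,dx\,dt+s\,d_1\int_0^T\Big[\Theta e^{2s\varphi}(x-x_0)v_x^2\Big]_{x=0}^{x=1}dt\right).$$ -/

import Mathlib

open MeasureTheory Set
open scoped ENNReal

noncomputable section

namespace InteriorDegeneracy

/-! ### Sobolev spaces in one variable

A function of `W^{1,p}` of a bounded interval is identified with its absolutely continuous
representative; its derivative is carried as a second function, determined almost everywhere. -/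

/-- `u` is absolutely continuous on `[α, β]` and its derivative is `u'` almost everywhere. -/
def IsACWithDeriv (α β : ℝ) (u u' : ℝ → ℝ) : Prop :=
  AbsolutelyContinuousOnInterval u α β ∧
    ∀ᵐ x ∂(volume.restrict (Ioo α β)), HasDerivAt u (u' x) x

/-- `u ∈ W^{1,p}(0,1)` with derivative `u'`. (That `u` itself is in `L^p(0,1)` is automatic, an
absolutely continuous function being bounded on `[0, 1]`.) -/
def MemW1 (p : ℝ≥0∞) (u u' : ℝ → ℝ) : Prop :=
  IsACWithDeriv 0 1 u u' ∧ MemLp u' p (volume.restrict (Ioo 0 1))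

/-- `u ∈ H¹₀(0,1)` with derivative `u'`. -/
def MemH10 (u u' : ℝ → ℝ) : Prop :=
  MemW1 2 u u' ∧ u 0 = 0 ∧ u 1 = 0

/-- `u ∈ L²_{1/a}(0,1)`: `u ∈ L²(0,1)` and `∫ u² / a < ∞`. -/
def MemL2Inv (a u : ℝ → ℝ) : Prop :=
  MemLp u 2 (volume.restrict (Ioo 0 1)) ∧ IntegrableOn (fun x => u x ^ 2 / a x) (Ioo 0 1)

/-- `u ∈ 𝓗¹_{1/a}(0,1) = L²_{1/a}(0,1) ∩ H¹₀(0,1)` with derivative `u'`. -/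
def MemH1Inv (a u u' : ℝ → ℝ) : Prop :=
  MemL2Inv a u ∧ MemH10 u u'

/-- `u ∈ 𝓗²_{1/a}(0,1)`: `u ∈ 𝓗¹_{1/a}(0,1)` and `u' ∈ H¹(0,1)`, with derivatives `u'`
(the continuous representative on `[0, 1]`) and `u''`. -/
def MemH2Inv (a u u' u'' : ℝ → ℝ) : Prop :=
  MemH1Inv a u u' ∧ MemW1 2 u' u''

/-! ### The degenerate coefficient -/

/-- Weak degeneracy of `a` at `x₀` with constant `K`. -/
structure WeaklyDegenerate (a : ℝ → ℝ) (x₀ K : ℝ) : Prop where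
  mem_x₀ : x₀ ∈ Ioo (0 : ℝ) 1
  zero : a x₀ = 0
  pos : ∀ x ∈ Icc (0 : ℝ) 1, x ≠ x₀ → 0 < a x
  sobolev : MemW1 1 a (deriv a)
  mem_K : K ∈ Ioo (0 : ℝ) 1
  le : ∀ᵐ x ∂(volume.restrict (Icc (0 : ℝ) 1)), (x - x₀) * deriv a x ≤ K * a x

/-- Strong degeneracy of `a` at `x₀` with constant `K`. -/
structure StronglyDegenerate (a : ℝ → ℝ) (x₀ K : ℝ) : Prop where
  mem_x₀ : x₀ ∈ Ioo (0 : ℝ) 1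
  zero : a x₀ = 0
  pos : ∀ x ∈ Icc (0 : ℝ) 1, x ≠ x₀ → 0 < a x
  sobolev : MemW1 ∞ a (deriv a)
  mem_K : K ∈ Ico (1 : ℝ) 2
  le : ∀ᵐ x ∂(volume.restrict (Icc (0 : ℝ) 1)), (x - x₀) * deriv a x ≤ K * a x

/-- The map `x ↦ (x - x₀) a'(x) / a(x)` belongs to `W^{1,∞}(0,1)`, i.e. it agrees almost everywhere
with some `m ∈ W^{1,∞}(0,1)`. -/
def LogDerivRegular (a : ℝ → ℝ) (x₀ : ℝ) : Prop :=
  ∃ m m' : ℝ → ℝ, MemW1 ∞ m m' ∧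
    ∀ᵐ x ∂(volume.restrict (Ioo (0 : ℝ) 1)), (x - x₀) * deriv a x / a x = m x

/-- For some `ϑ ∈ (0, K]`, the map `x ↦ a(x) / |x - x₀|^ϑ` is nonincreasing on the left of `x₀` and
nondecreasing on the right of `x₀`. -/
def PowerMonotone (a : ℝ → ℝ) (x₀ K : ℝ) : Prop :=
  ∃ ϑ ∈ Ioc (0 : ℝ) K,
    AntitoneOn (fun x => a x / |x - x₀| ^ ϑ) (Ico 0 x₀) ∧
    MonotoneOn (fun x => a x / |x - x₀| ^ ϑ) (Ioc x₀ 1)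

/-- The standing assumption on the coefficient in the Carleman estimate in non divergence form. -/
structure CoefficientHypothesis (a : ℝ → ℝ) (x₀ K : ℝ) : Prop where
  degenerate : WeaklyDegenerate a x₀ K ∨ StronglyDegenerate a x₀ K
  regular : LogDerivRegular a x₀
  monotone : 1 / 2 ≤ K → PowerMonotone a x₀ K

/-! ### The weights -/

/-- `Θ(t) = 1 / [t (T - t)]⁴`. -/
def Theta (T t : ℝ) : ℝ := 1 / (t * (T - t)) ^ 4

/-- `ψ(x) = d₁ (∫_{x₀}^x (y - x₀) / a(y) e^{R (y - x₀)²} dy - d₂)`. -/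
def psi (a : ℝ → ℝ) (x₀ R d₁ d₂ x : ℝ) : ℝ :=
  d₁ * ((∫ y in x₀..x, (y - x₀) / a y * Real.exp (R * (y - x₀) ^ 2)) - d₂)

/-- `φ(t, x) = Θ(t) ψ(x)`. -/
def phi (a : ℝ → ℝ) (x₀ T R d₁ d₂ t x : ℝ) : ℝ :=
  Theta T t * psi a x₀ R d₁ d₂ x

/-! ### Function spaces on `Q_T = (0, T) × (0, 1)`

A function of `(t, x)` is written `v : ℝ → ℝ → ℝ`, so that `v t` is the function `v(t, ·)`.
The space `L²(0,T; L²_w(0,1))` is the weighted space `L²_w(Q_T)`. -/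

/-- Lebesgue measure on `Q_T = (0, T) × (0, 1)`. -/
def volQ (T : ℝ) : Measure (ℝ × ℝ) :=
  volume.restrict (Ioo 0 T ×ˢ Ioo 0 1)

/-- `f ∈ L²(0,T; L²(0,1)) = L²(Q_T)`. -/
def MemL2L2 (T : ℝ) (f : ℝ → ℝ → ℝ) : Prop :=
  MemLp (fun p : ℝ × ℝ => f p.1 p.2) 2 (volQ T)

/-- `f ∈ L²(0,T; L²_{1/a}(0,1)) = L²_{1/a}(Q_T)`. -/
def MemL2L2Inv (a : ℝ → ℝ) (T : ℝ) (f : ℝ → ℝ → ℝ) : Prop :=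
  MemL2L2 T f ∧ Integrable (fun p : ℝ × ℝ => f p.1 p.2 ^ 2 / a p.2) (volQ T)

/-- `v ∈ L²(0,T; 𝓗¹_{1/a}(0,1))` with space derivative `vx`; the norm of `𝓗¹_{1/a}(0,1)` is
`(‖u‖²_{L²_{1/a}} + ‖u'‖²_{L²})^{1/2}`. -/
def MemL2H1Inv (a : ℝ → ℝ) (T : ℝ) (v vx : ℝ → ℝ → ℝ) : Prop :=
  (∀ᵐ t ∂(volume.restrict (Ioo 0 T)), MemH1Inv a (v t) (vx t)) ∧
    MemL2L2Inv a T v ∧ MemL2L2 T vx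

/-- `v ∈ L²(0,T; 𝓗²_{1/a}(0,1))` with space derivatives `vx`, `vxx`; the norm of `𝓗²_{1/a}(0,1)` is
`(‖u‖²_{𝓗¹_{1/a}} + ‖a u''‖²_{L²_{1/a}})^{1/2}`. -/
def MemL2H2Inv (a : ℝ → ℝ) (T : ℝ) (v vx vxx : ℝ → ℝ → ℝ) : Prop :=
  (∀ᵐ t ∂(volume.restrict (Ioo 0 T)), MemH2Inv a (v t) (vx t) (vxx t)) ∧
    MemL2H1Inv a T v vx ∧ MemL2L2Inv a T (fun t x => a x * vxx t x)

/-- `v ∈ H¹(0,T; 𝓗¹_{1/a}(0,1))` with space derivative `vx`, time derivative `vt` and mixed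
derivative `vtx`: both `v` and `vt` are in `L²(0,T; 𝓗¹_{1/a}(0,1))`, and `v` (its representative
that is continuous in time) is a primitive in time of `vt`. -/
def MemH1H1Inv (a : ℝ → ℝ) (T : ℝ) (v vx vt vtx : ℝ → ℝ → ℝ) : Prop :=
  MemL2H1Inv a T v vx ∧ MemL2H1Inv a T vt vtx ∧
    ∀ x ∈ Icc (0 : ℝ) 1, IsACWithDeriv 0 T (fun t => v t x) (fun t => vt t x)

/-- `v ∈ 𝓢₂ = H¹(0,T; 𝓗¹_{1/a}(0,1)) ∩ L²(0,T; 𝓗²_{1/a}(0,1))`, with derivatives `vx`, `vxx`, `vt`,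
`vtx`. -/
def MemS2 (a : ℝ → ℝ) (T : ℝ) (v vx vxx vt vtx : ℝ → ℝ → ℝ) : Prop :=
  MemH1H1Inv a T v vx vt vtx ∧ MemL2H2Inv a T v vx vxx

/-- `v_t + a v_xx = h` in `Q_T` and `v(t, 0) = v(t, 1) = 0` for `t ∈ (0, T)`. -/
def SolvesAdjoint (a : ℝ → ℝ) (T : ℝ) (v vxx vt h : ℝ → ℝ → ℝ) : Prop :=
  (∀ᵐ p ∂(volQ T), vt p.1 p.2 + a p.2 * vxx p.1 p.2 = h p.1 p.2) ∧
    ∀ t ∈ Ioo 0 T, v t 0 = 0 ∧ v t 1 = 0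

/-! ### The integrands of the estimate -/

/-- `(s Θ v_x² + s³ Θ³ ((x - x₀) / a)² v²) e^{2 s φ}`. -/
def carlemanLHS (a : ℝ → ℝ) (x₀ T R d₁ d₂ s : ℝ) (v vx : ℝ → ℝ → ℝ) (p : ℝ × ℝ) : ℝ :=
  (s * Theta T p.1 * vx p.1 p.2 ^ 2 +
      s ^ 3 * Theta T p.1 ^ 3 * ((p.2 - x₀) / a p.2) ^ 2 * v p.1 p.2 ^ 2) *
    Real.exp (2 * s * phi a x₀ T R d₁ d₂ p.1 p.2)

/-- `h² e^{2 s φ} / a`. -/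
def carlemanSource (a : ℝ → ℝ) (x₀ T R d₁ d₂ s : ℝ) (h : ℝ → ℝ → ℝ) (p : ℝ × ℝ) : ℝ :=
  h p.1 p.2 ^ 2 * (Real.exp (2 * s * phi a x₀ T R d₁ d₂ p.1 p.2) / a p.2)

/-- `Θ e^{2 s φ} (x - x₀) v_x²` at the point `(t, x)`. -/
def carlemanFlux (a : ℝ → ℝ) (x₀ T R d₁ d₂ s : ℝ) (vx : ℝ → ℝ → ℝ) (x t : ℝ) : ℝ :=
  Theta T t * Real.exp (2 * s * phi a x₀ T R d₁ d₂ t x) * (x - x₀) * vx t x ^ 2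

/-- The boundary integrand `[Θ e^{2 s φ} (x - x₀) v_x²]_{x=0}^{x=1}` at time `t`. -/
def carlemanBoundary (a : ℝ → ℝ) (x₀ T R d₁ d₂ s : ℝ) (vx : ℝ → ℝ → ℝ) (t : ℝ) : ℝ :=
  carlemanFlux a x₀ T R d₁ d₂ s vx 1 t - carlemanFlux a x₀ T R d₁ d₂ s vx 0 t

end InteriorDegeneracy

end

noncomputable section

namespace InteriorDegeneracy

open Filter Topology

section

/-! ### Locally absolutely continuous functions -/

/-! The estimate is obtained by conjugation. With `k = sΘ` and `w = e^{kψ} v`, the function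
`e^{kψ}(v_t + a v_xx)` equals `A + B`, where `A = a w_xx - k'ψ w + k² a ψ'² w` is the symmetric part
and `B = w_t - 2k aψ' w_x - k aψ'' w` the skew part for the measure `dx dt / a`. Since `2AB ≤ (A +
B)²`, the source bounds `2∫ AB/a`. Pointwise, `AB/a` is an `x`-derivative plus a `t`-derivative plus
a bulk term (`crossTerm_eq`).

The `t`-derivative integrates to zero, because `ψ ≤ -c < 0` makes `e^{sΘψ}` beat every power of `Θ`
at `t = 0` and `t = T` (`integral_timeFluxDeriv`). The `x`-derivative leaves only the lateral
boundary term (`integral_spaceFluxDeriv`): the flux is singular at `x₀`, but its two one-sided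
limits agree because `ψ' v → 0` there. Under weak degeneracy `(x - x₀)/a → 0`; under strong
degeneracy integrability of `v²/a` forces `v(x₀) = 0`, and the `𝓗²` regularity then gives `v = O(x -
x₀)`.

In the bulk term the leading coefficient is `(aψ')' + aψ'' ≥ d₁(2 - K) > 0`; it controls `k w_x² +
k³ ψ'² w²`. The remaining terms either carry a spare power of `s` or are bounded by `sΘ² w²/a`. The
latter are absorbed by `weighted_interpolation`: `∫ w²/a ≤ C(l ∫ w_x² + l⁻¹ ∫ ((x - x₀)/a)² w²)` for
every `l > 0`, used with `l` proportional to `1/Θ`. This is `exists_bulkTerm_coercive`.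

Two technical points take most of the length. All integrals must be finite: the quantities `w/√a`,
`w_x`, `w_t/√a`, `√a w_xx`, `w_tx` are square integrable against any power of `Θ`, and `aψ'/√a` is
bounded since `K < 2`. And `v_x` must be integrated by parts in time although its slices are only
determined almost everywhere; `exists_time_primitive` supplies a version absolutely continuous in
time. -/

/-- `f` is absolutely continuous on the compact subintervals of `(α, β)`, with derivative `f'`
almost everywhere. -/
def LocAC (α β : ℝ) (f f' : ℝ → ℝ) : Prop :=
  (∀ c d, α < c → c ≤ d → d < β → AbsolutelyContinuousOnInterval f c d) ∧
    ∀ᵐ x ∂(volume.restrict (Ioo α β)), HasDerivAt f (f' x) x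

/-- Total variation sums of `g` are dominated by those of `f`. This serves for reciprocals, for
primitives shifted by a constant, and for functions rewritten by a pointwise identity. -/
lemma absolutelyContinuous_of_dist_le {f g : ℝ → ℝ} {c d C : ℝ}
    (hf : AbsolutelyContinuousOnInterval f c d)
    (h : ∀ x ∈ uIcc c d, ∀ y ∈ uIcc c d, dist (g x) (g y) ≤ C * dist (f x) (f y)) :
    AbsolutelyContinuousOnInterval g c d := by
  unfold AbsolutelyContinuousOnInterval at hf ⊢
  have h0 := hf.const_mul C
  rw [mul_zero] at h0
  refine squeeze_zero' (Eventually.of_forall fun E => Finset.sum_nonneg fun i _ => dist_nonneg)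
    ?_ h0
  refine Filter.Eventually.filter_mono inf_le_right ?_
  rw [eventually_principal]
  intro E hE
  rw [Finset.mul_sum]
  exact Finset.sum_le_sum fun i hi => h _ (hE.1 i hi).1 _ (hE.1 i hi).2

lemma IsACWithDeriv.mono {α β c d : ℝ} {f f' : ℝ → ℝ} (h : IsACWithDeriv α β f f')
    (hc : α ≤ c) (hcd : c ≤ d) (hd : d ≤ β) : IsACWithDeriv c d f f' := by
  refine ⟨h.1.mono ?_, ae_restrict_of_ae_restrict_of_subset (Ioo_subset_Ioo hc hd) h.2⟩
  rw [uIcc_of_le hcd, uIcc_of_le (hc.trans (hcd.trans hd))]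
  exact Icc_subset_Icc hc hd

lemma IsACWithDeriv.locAC {α β : ℝ} {f f' : ℝ → ℝ} (h : IsACWithDeriv α β f f') :
    LocAC α β f f' :=
  ⟨fun _ _ hc hcd hd => (h.mono hc.le hcd hd.le).1, h.2⟩

lemma LocAC.isAC {α β c d : ℝ} {f f' : ℝ → ℝ} (h : LocAC α β f f')
    (hc : α < c) (hcd : c ≤ d) (hd : d < β) : IsACWithDeriv c d f f' :=
  ⟨h.1 c d hc hcd hd, ae_restrict_of_ae_restrict_of_subset (Ioo_subset_Ioo hc.le hd.le) h.2⟩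

lemma LocAC.mono {α β c d : ℝ} {f f' : ℝ → ℝ} (h : LocAC α β f f')
    (hc : α ≤ c) (hd : d ≤ β) : LocAC c d f f' :=
  ⟨fun _ _ h1 h2 h3 => h.1 _ _ (hc.trans_lt h1) h2 (h3.trans_le hd),
    ae_restrict_of_ae_restrict_of_subset (Ioo_subset_Ioo hc hd) h.2⟩

lemma IsACWithDeriv.continuousOn {α β : ℝ} {f f' : ℝ → ℝ} (hαβ : α ≤ β)
    (h : IsACWithDeriv α β f f') : ContinuousOn f (Icc α β) := by
  have := h.1.continuousOn
  rwa [uIcc_of_le hαβ] at this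

lemma IsACWithDeriv.deriv_ae_eq {α β : ℝ} {f f' : ℝ → ℝ} (h : IsACWithDeriv α β f f') :
    deriv f =ᵐ[volume.restrict (Ioo α β)] f' := by
  filter_upwards [h.2] with x hx using hx.deriv

lemma IsACWithDeriv.integrableOn {α β : ℝ} {f f' : ℝ → ℝ} (hαβ : α ≤ β)
    (h : IsACWithDeriv α β f f') : IntegrableOn f' (Ioo α β) := by
  have h1 := h.1.intervalIntegrable_deriv
  rw [intervalIntegrable_iff_integrableOn_Ioo_of_le hαβ] at h1
  exact h1.congr_fun_ae h.deriv_ae_eq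

lemma IsACWithDeriv.integral_eq {α β : ℝ} {f f' : ℝ → ℝ} (hαβ : α ≤ β)
    (h : IsACWithDeriv α β f f') : ∫ x in Ioo α β, f' x = f β - f α := by
  rw [← h.1.integral_deriv_eq_sub, intervalIntegral.integral_of_le hαβ,
    integral_Ioc_eq_integral_Ioo]
  exact (integral_congr_ae h.deriv_ae_eq).symm

lemma IsACWithDeriv.le_of_nonneg {α β : ℝ} {f f' : ℝ → ℝ} (hαβ : α ≤ β)
    (h : IsACWithDeriv α β f f') (h0 : ∀ᵐ x ∂(volume.restrict (Ioo α β)), 0 ≤ f' x) :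
    f α ≤ f β := by
  have := h.integral_eq hαβ
  have h2 := integral_nonneg_of_ae h0
  linarith

lemma LocAC.add {α β : ℝ} {f f' g g' : ℝ → ℝ} (hf : LocAC α β f f') (hg : LocAC α β g g') :
    LocAC α β (fun x => f x + g x) (fun x => f' x + g' x) :=
  ⟨fun c d h1 h2 h3 => (hf.1 c d h1 h2 h3).add (hg.1 c d h1 h2 h3), by
    filter_upwards [hf.2, hg.2] with x h1 h2 using h1.add h2⟩

lemma LocAC.sub {α β : ℝ} {f f' g g' : ℝ → ℝ} (hf : LocAC α β f f') (hg : LocAC α β g g') :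
    LocAC α β (fun x => f x - g x) (fun x => f' x - g' x) :=
  ⟨fun c d h1 h2 h3 => (hf.1 c d h1 h2 h3).sub (hg.1 c d h1 h2 h3), by
    filter_upwards [hf.2, hg.2] with x h1 h2 using h1.sub h2⟩

lemma LocAC.mul {α β : ℝ} {f f' g g' : ℝ → ℝ} (hf : LocAC α β f f') (hg : LocAC α β g g') :
    LocAC α β (fun x => f x * g x) (fun x => f' x * g x + f x * g' x) :=
  ⟨fun c d h1 h2 h3 => (hf.1 c d h1 h2 h3).mul (hg.1 c d h1 h2 h3), by
    filter_upwards [hf.2, hg.2] with x h1 h2 using h1.mul h2⟩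

lemma LocAC.const_mul {α β : ℝ} {f f' : ℝ → ℝ} (k : ℝ) (hf : LocAC α β f f') :
    LocAC α β (fun x => k * f x) (fun x => k * f' x) :=
  ⟨fun c d h1 h2 h3 => (hf.1 c d h1 h2 h3).const_mul k, by
    filter_upwards [hf.2] with x h1 using h1.const_mul k⟩

lemma LocAC.sq {α β : ℝ} {f f' : ℝ → ℝ} (hf : LocAC α β f f') :
    LocAC α β (fun x => f x ^ 2) (fun x => 2 * f x * f' x) := by
  have h := hf.mul hf
  refine ⟨fun c d h1 h2 h3 => ?_, ?_⟩
  · simpa only [pow_two] using h.1 c d h1 h2 h3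
  · filter_upwards [hf.2] with x h1
    simpa using h1.fun_pow 2

lemma LocAC.congr_deriv {α β : ℝ} {f f' g' : ℝ → ℝ} (hf : LocAC α β f f')
    (h : ∀ᵐ x ∂(volume.restrict (Ioo α β)), f' x = g' x) : LocAC α β f g' :=
  ⟨hf.1, by filter_upwards [hf.2, h] with x h1 h2 using h2 ▸ h1⟩

lemma LocAC.continuousOn {α β : ℝ} {f f' : ℝ → ℝ} (hf : LocAC α β f f') :
    ContinuousOn f (Ioo α β) := by
  intro x hx
  obtain ⟨c, hc1, hc2⟩ := exists_between hx.1
  obtain ⟨d, hd1, hd2⟩ := exists_between hx.2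
  have := (hf.isAC hc1 (hc2.trans hd1).le hd2).continuousOn (hc2.trans hd1).le
  exact (this.continuousAt (Icc_mem_nhds hc2 hd1)).continuousWithinAt

lemma LocAC.of_hasDerivAt {α β : ℝ} {f f' : ℝ → ℝ} (h : ∀ x ∈ Ioo α β, HasDerivAt f (f' x) x)
    (hf' : ContinuousOn f' (Ioo α β)) : LocAC α β f f' := by
  refine ⟨fun c d hc hcd hd => ?_, (ae_restrict_iff' measurableSet_Ioo).2
    (Eventually.of_forall h)⟩
  have hsub : Icc c d ⊆ Ioo α β := Icc_subset_Ioo hc hd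
  obtain ⟨C, hC⟩ := isCompact_Icc.exists_bound_of_continuousOn (hf'.mono hsub)
  have hL : LipschitzOnWith (Real.toNNReal C) f (uIcc c d) := by
    rw [uIcc_of_le hcd]
    refine (convex_Icc c d).lipschitzOnWith_of_nnnorm_hasDerivWithin_le
      (fun x hx => (h x (hsub hx)).hasDerivWithinAt) fun x hx => ?_
    rw [← NNReal.coe_le_coe, coe_nnnorm]
    exact (hC x hx).trans (Real.le_coe_toNNReal C)
  exact hL.absolutelyContinuousOnInterval

lemma LocAC.inv {α β : ℝ} {f f' : ℝ → ℝ} (hf : LocAC α β f f') (h0 : ∀ x ∈ Ioo α β, f x ≠ 0) :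
    LocAC α β (fun x => (f x)⁻¹) (fun x => -f' x / f x ^ 2) := by
  refine ⟨fun c d hc hcd hd => ?_, ?_⟩
  · have hsub : Icc c d ⊆ Ioo α β := Icc_subset_Ioo hc hd
    have hcont : ContinuousOn (fun x => (f x)⁻¹) (Icc c d) :=
      (hf.continuousOn.mono hsub).inv₀ fun x hx => h0 x (hsub hx)
    obtain ⟨C, hC⟩ := isCompact_Icc.exists_bound_of_continuousOn hcont
    refine absolutelyContinuous_of_dist_le (C := C * C) (hf.1 c d hc hcd hd) ?_
    rw [uIcc_of_le hcd]
    intro x hx y hy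
    have hx0 := h0 x (hsub hx)
    have hy0 := h0 y (hsub hy)
    have e : (f x)⁻¹ - (f y)⁻¹ = (f x)⁻¹ * (f y)⁻¹ * (f y - f x) := by field_simp
    rw [Real.dist_eq, Real.dist_eq, e, abs_mul, abs_mul, abs_sub_comm (f y)]
    have h1 := hC x hx
    have h2 := hC y hy
    rw [Real.norm_eq_abs] at h1 h2
    gcongr
    exact (abs_nonneg _).trans h1
  · filter_upwards [hf.2, ae_restrict_mem measurableSet_Ioo] with x h1 hx using h1.inv (h0 x hx)

/-- Integrability of `f'` makes its primitive continuous up to both ends, so only the one-sided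
limits of `f` matter, not its values there. This form suits fluxes that are singular at `x₀`, `t =
0` or `t = T`. -/
lemma LocAC.integral_eq {α β A B : ℝ} {f f' : ℝ → ℝ} (hαβ : α < β) (hf : LocAC α β f f')
    (hint : IntegrableOn f' (Ioo α β)) (hA : Tendsto f (𝓝[>] α) (𝓝 A))
    (hB : Tendsto f (𝓝[<] β) (𝓝 B)) : ∫ x in Ioo α β, f' x = B - A := by
  set γ := (α + β) / 2 with hγ
  have h1 : α < γ := by rw [hγ]; linarith
  have h2 : γ < β := by rw [hγ]; linarith
  have hII : IntervalIntegrable f' volume α β :=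
    (intervalIntegrable_iff_integrableOn_Ioo_of_le hαβ.le).2 hint
  have hcont : ContinuousOn (fun x => ∫ u in γ..x, f' u) (uIcc α β) := by
    refine intervalIntegral.continuousOn_primitive_interval' hII ?_
    rw [uIcc_of_le hαβ.le]; exact ⟨h1.le, h2.le⟩
  rw [uIcc_of_le hαβ.le] at hcont
  have key : ∀ x ∈ Ioo α β, ∫ u in γ..x, f' u = f x - f γ := by
    intro x hx
    rcases le_total γ x with h | h
    · rw [intervalIntegral.integral_of_le h, integral_Ioc_eq_integral_Ioo]
      exact (hf.isAC h1 h hx.2).integral_eq h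
    · rw [intervalIntegral.integral_of_ge h, integral_Ioc_eq_integral_Ioo,
        (hf.isAC hx.1 h h2).integral_eq h]
      ring
  have hlimA : ∫ u in γ..α, f' u = A - f γ := by
    have t1 : Tendsto (fun x => ∫ u in γ..x, f' u) (𝓝[>] α) (𝓝 (∫ u in γ..α, f' u)) :=
      ((hcont α (left_mem_Icc.2 hαβ.le)).mono_left (by
        rw [← nhdsWithin_Ioo_eq_nhdsGT hαβ]; exact nhdsWithin_mono _ Ioo_subset_Icc_self))
    refine tendsto_nhds_unique t1 ((hA.sub_const (f γ)).congr' ?_)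
    filter_upwards [Ioo_mem_nhdsGT hαβ] with x hx using (key x hx).symm
  have hlimB : ∫ u in γ..β, f' u = B - f γ := by
    have t1 : Tendsto (fun x => ∫ u in γ..x, f' u) (𝓝[<] β) (𝓝 (∫ u in γ..β, f' u)) :=
      ((hcont β (right_mem_Icc.2 hαβ.le)).mono_left (by
        rw [← nhdsWithin_Ioo_eq_nhdsLT hαβ]; exact nhdsWithin_mono _ Ioo_subset_Icc_self))
    refine tendsto_nhds_unique t1 ((hB.sub_const (f γ)).congr' ?_)
    filter_upwards [Ioo_mem_nhdsLT hαβ] with x hx using (key x hx).symm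
  rw [← integral_Ioc_eq_integral_Ioo, ← intervalIntegral.integral_of_le hαβ.le,
    ← intervalIntegral.integral_add_adjacent_intervals (b := γ), hlimB,
    intervalIntegral.integral_symm, hlimA]
  · ring
  · exact hII.mono_set (by rw [uIcc_of_le h1.le, uIcc_of_le hαβ.le]; exact Icc_subset_Icc_right h2.le)
  · exact hII.mono_set (by rw [uIcc_of_le h2.le, uIcc_of_le hαβ.le]; exact Icc_subset_Icc_left h1.le)

end

section

/-! ### The degenerate coefficient -/

/-- The consequences of `CoefficientHypothesis` on which the estimate rests; `m` is the
`W^{1,∞}` representative of `(x - x₀) a' / a`. -/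
structure DegenerateCoefficient (a m m' : ℝ → ℝ) (x₀ K : ℝ) : Prop where
  mem : x₀ ∈ Ioo (0 : ℝ) 1
  zero : a x₀ = 0
  pos : ∀ x ∈ Icc (0 : ℝ) 1, x ≠ x₀ → 0 < a x
  ac : IsACWithDeriv 0 1 a (deriv a)
  K_pos : 0 < K
  K_lt : K < 2
  le : ∀ᵐ x ∂(volume.restrict (Ioo (0 : ℝ) 1)), (x - x₀) * deriv a x ≤ K * a x
  reg : IsACWithDeriv 0 1 m m'
  reg_bound : ∃ N, ∀ᵐ x ∂(volume.restrict (Ioo (0 : ℝ) 1)), |m' x| ≤ N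
  reg_eq : ∀ᵐ x ∂(volume.restrict (Ioo (0 : ℝ) 1)), (x - x₀) * deriv a x / a x = m x
  alt : K < 1 ∨ ∃ L, ∀ x ∈ Icc (0 : ℝ) 1, a x ≤ L * |x - x₀|

lemma MemLp.ae_abs_le {μ : Measure ℝ} {f : ℝ → ℝ} (h : MemLp f ∞ μ) :
    ∃ N, ∀ᵐ x ∂μ, |f x| ≤ N := by
  refine ⟨(eLpNorm f ∞ μ).toReal, ?_⟩
  filter_upwards [ae_le_eLpNormEssSup (f := f) (μ := μ)] with x hx
  rw [← Real.norm_eq_abs, ← toReal_enorm]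
  refine ENNReal.toReal_mono h.2.ne ?_
  rwa [eLpNorm_exponent_top]

lemma IsACWithDeriv.abs_sub_le {f f' : ℝ → ℝ} {N : ℝ} (h : IsACWithDeriv 0 1 f f')
    (hN : ∀ᵐ x ∂(volume.restrict (Ioo (0 : ℝ) 1)), |f' x| ≤ N) {x y : ℝ} (hx : 0 ≤ x)
    (hxy : x ≤ y) (hy : y ≤ 1) : |f y - f x| ≤ N * (y - x) := by
  rw [← (h.mono hx hxy hy).integral_eq hxy, ← Real.norm_eq_abs]
  have h2 : ∀ᵐ u ∂(volume.restrict (Ioo x y)), ‖f' u‖ ≤ N :=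
    ae_restrict_of_ae_restrict_of_subset (Ioo_subset_Ioo hx hy) hN
  have h3 := norm_integral_le_of_norm_le_const h2
  simpa [hxy] using h3

/-- The weak and strong cases are merged. Beyond the range of `K`, strong degeneracy is retained
only as the bound `a ≤ L |x - x₀|`, which follows from the boundedness of `a'` and `a x₀ = 0`. -/
lemma CoefficientHypothesis.exists_data {a : ℝ → ℝ} {x₀ K : ℝ}
    (ha : CoefficientHypothesis a x₀ K) : ∃ m m', DegenerateCoefficient a m m' x₀ K := by
  obtain ⟨m, m', hm, hm2⟩ := ha.regular
  refine ⟨m, m', ?_⟩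
  rcases ha.degenerate with h | h
  · exact ⟨h.mem_x₀, h.zero, h.pos, h.sobolev.1, h.mem_K.1, by linarith [h.mem_K.2],
      ae_restrict_of_ae_restrict_of_subset Ioo_subset_Icc_self h.le, hm.1, MemLp.ae_abs_le hm.2,
      hm2, Or.inl h.mem_K.2⟩
  · refine ⟨h.mem_x₀, h.zero, h.pos, h.sobolev.1, by linarith [h.mem_K.1], h.mem_K.2,
      ae_restrict_of_ae_restrict_of_subset Ioo_subset_Icc_self h.le, hm.1, MemLp.ae_abs_le hm.2,
      hm2, Or.inr ?_⟩
    obtain ⟨N, hN⟩ := MemLp.ae_abs_le h.sobolev.2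
    refine ⟨N, fun x hx => ?_⟩
    rcases le_total x x₀ with hle | hle
    · have := h.sobolev.1.abs_sub_le hN hx.1 hle h.mem_x₀.2.le
      rw [h.zero, zero_sub, abs_neg] at this
      rw [abs_of_nonpos (by linarith), neg_sub]
      exact (le_abs_self _).trans this
    · have := h.sobolev.1.abs_sub_le hN h.mem_x₀.1.le hle hx.2
      rw [h.zero, sub_zero] at this
      rw [abs_of_nonneg (by linarith)]
      exact (le_abs_self _).trans this

/-! ### Comparison of the coefficient with powers of the distance to the degeneracy. -/

variable {a m m' : ℝ → ℝ} {x₀ K : ℝ}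

lemma DegenerateCoefficient.nonneg (ha : DegenerateCoefficient a m m' x₀ K) {x : ℝ}
    (hx : x ∈ Icc (0 : ℝ) 1) : 0 ≤ a x := by
  rcases eq_or_ne x x₀ with rfl | h
  · exact ha.zero.ge
  · exact (ha.pos x hx h).le

lemma DegenerateCoefficient.continuousOn (ha : DegenerateCoefficient a m m' x₀ K) :
    ContinuousOn a (Icc 0 1) := ha.ac.continuousOn zero_le_one

lemma DegenerateCoefficient.locAC_right (ha : DegenerateCoefficient a m m' x₀ K) :
    LocAC x₀ 1 a (deriv a) := ha.ac.locAC.mono ha.mem.1.le le_rfl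

lemma DegenerateCoefficient.locAC_left (ha : DegenerateCoefficient a m m' x₀ K) :
    LocAC 0 x₀ a (deriv a) := ha.ac.locAC.mono le_rfl ha.mem.2.le

/-- The quotient `(u - x₀)^K / a` is nondecreasing: its derivative is `(u - x₀)^(K-1) (K a - (u -
x₀) a') / a²`. The endpoint `1` is reached by continuity, since local absolute continuity stops
short of it. -/
lemma DegenerateCoefficient.rpow_div_le_right (ha : DegenerateCoefficient a m m' x₀ K) {x : ℝ}
    (hx : x₀ < x) (hx1 : x ≤ 1) : (x - x₀) ^ K / a x ≤ (1 - x₀) ^ K / a 1 := by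
  rcases hx1.eq_or_lt with rfl | hx1
  · exact le_rfl
  have hpos : ∀ u ∈ Ioo x₀ 1, 0 < a u := fun u hu =>
    ha.pos u ⟨ha.mem.1.le.trans hu.1.le, hu.2.le⟩ hu.1.ne'
  have h1 : LocAC x₀ 1 (fun u => (u - x₀) ^ K) (fun u => K * (u - x₀) ^ (K - 1)) := by
    refine LocAC.of_hasDerivAt (fun u hu => ?_) ?_
    · have := ((hasDerivAt_id u).sub_const x₀).rpow_const (p := K) (Or.inl (sub_pos.2 hu.1).ne')
      simpa using this
    · refine continuousOn_const.mul (ContinuousOn.rpow_const (by fun_prop) fun u hu =>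
        Or.inl (sub_pos.2 hu.1).ne')
  have h2 := h1.mul (ha.locAC_right.inv fun u hu => (hpos u hu).ne')
  have hnn : ∀ᵐ u ∂(volume.restrict (Ioo x₀ 1)),
      0 ≤ K * (u - x₀) ^ (K - 1) * (a u)⁻¹ + (u - x₀) ^ K * (-deriv a u / a u ^ 2) := by
    filter_upwards [ae_restrict_of_ae_restrict_of_subset (Ioo_subset_Ioo_left ha.mem.1.le) ha.le,
      ae_restrict_mem measurableSet_Ioo] with u hu hmem
    have hau := hpos u hmem
    have hu0 : 0 < u - x₀ := sub_pos.2 hmem.1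
    have e : (u - x₀) ^ K = (u - x₀) ^ (K - 1) * (u - x₀) := by
      rw [← Real.rpow_add_one hu0.ne']; congr 1; ring
    rw [e]
    have : K * (u - x₀) ^ (K - 1) * (a u)⁻¹ + (u - x₀) ^ (K - 1) * (u - x₀) * (-deriv a u / a u ^ 2)
      = (u - x₀) ^ (K - 1) / a u ^ 2 * (K * a u - (u - x₀) * deriv a u) := by field_simp; ring
    rw [this]
    exact mul_nonneg (by positivity) (by linarith)
  have hmono : ∀ y ∈ Ioo x 1, (x - x₀) ^ K * (a x)⁻¹ ≤ (y - x₀) ^ K * (a y)⁻¹ := fun y hy =>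
    (h2.isAC hx hy.1.le hy.2).le_of_nonneg hy.1.le
      (ae_restrict_of_ae_restrict_of_subset (Ioo_subset_Ioo hx.le hy.2.le) hnn)
  have ha1 : 0 < a 1 := ha.pos 1 (by simp) ha.mem.2.ne'
  have hlim : Tendsto (fun y => (y - x₀) ^ K * (a y)⁻¹) (𝓝[<] 1) (𝓝 ((1 - x₀) ^ K * (a 1)⁻¹)) := by
    have hac : Tendsto a (𝓝[<] 1) (𝓝 (a 1)) :=
      (ha.continuousOn 1 (by simp)).mono_left (by
        rw [← nhdsWithin_Ioo_eq_nhdsLT zero_lt_one]; exact nhdsWithin_mono _ Ioo_subset_Icc_self)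
    refine Tendsto.mul ?_ (hac.inv₀ ha1.ne')
    have : ContinuousAt (fun y : ℝ => (y - x₀) ^ K) 1 :=
      ContinuousAt.rpow_const (by fun_prop) (Or.inl (sub_pos.2 ha.mem.2).ne')
    exact this.tendsto.mono_left nhdsWithin_le_nhds
  rw [div_eq_mul_inv, div_eq_mul_inv]
  exact ge_of_tendsto hlim (by filter_upwards [Ioo_mem_nhdsLT hx1] with y hy using hmono y hy)

lemma DegenerateCoefficient.rpow_div_le_left (ha : DegenerateCoefficient a m m' x₀ K) {x : ℝ}
    (hx : x < x₀) (hx0 : 0 ≤ x) : (x₀ - x) ^ K / a x ≤ x₀ ^ K / a 0 := by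
  rcases hx0.eq_or_lt with rfl | hx0
  · simp
  have hpos : ∀ u ∈ Ioo 0 x₀, 0 < a u := fun u hu =>
    ha.pos u ⟨hu.1.le, hu.2.le.trans ha.mem.2.le⟩ hu.2.ne
  have h1 : LocAC 0 x₀ (fun u => (x₀ - u) ^ K) (fun u => -(K * (x₀ - u) ^ (K - 1))) := by
    refine LocAC.of_hasDerivAt (fun u hu => ?_) ?_
    · have := ((hasDerivAt_id u).const_sub x₀).rpow_const (p := K) (Or.inl (sub_pos.2 hu.2).ne')
      simpa using this
    · refine (continuousOn_const.mul (ContinuousOn.rpow_const (by fun_prop) fun u hu =>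
        Or.inl (sub_pos.2 hu.2).ne')).neg
  -- On the left the quotient decreases towards `x₀`; the sign is flipped so that `le_of_nonneg`
  -- applies.
  have h2 := (h1.mul (ha.locAC_left.inv fun u hu => (hpos u hu).ne')).const_mul (-1)
  have hnn : ∀ᵐ u ∂(volume.restrict (Ioo 0 x₀)),
      0 ≤ -1 * (-(K * (x₀ - u) ^ (K - 1)) * (a u)⁻¹ + (x₀ - u) ^ K * (-deriv a u / a u ^ 2)) := by
    filter_upwards [ae_restrict_of_ae_restrict_of_subset (Ioo_subset_Ioo_right ha.mem.2.le) ha.le,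
      ae_restrict_mem measurableSet_Ioo] with u hu hmem
    have hau := hpos u hmem
    have hu0 : 0 < x₀ - u := sub_pos.2 hmem.2
    have e : (x₀ - u) ^ K = (x₀ - u) ^ (K - 1) * (x₀ - u) := by
      rw [← Real.rpow_add_one hu0.ne']; congr 1; ring
    rw [e]
    have : -1 * (-(K * (x₀ - u) ^ (K - 1)) * (a u)⁻¹ +
        (x₀ - u) ^ (K - 1) * (x₀ - u) * (-deriv a u / a u ^ 2))
      = (x₀ - u) ^ (K - 1) / a u ^ 2 * (K * a u - (u - x₀) * deriv a u) := by field_simp; ring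
    rw [this]
    exact mul_nonneg (by positivity) (by linarith)
  have hmono : ∀ y ∈ Ioo 0 x, (x₀ - x) ^ K * (a x)⁻¹ ≤ (x₀ - y) ^ K * (a y)⁻¹ := fun y hy => by
    have := (h2.isAC hy.1 hy.2.le hx).le_of_nonneg hy.2.le
      (ae_restrict_of_ae_restrict_of_subset (Ioo_subset_Ioo hy.1.le hx.le) hnn)
    linarith
  have ha1 : 0 < a 0 := ha.pos 0 (by simp) ha.mem.1.ne
  have hlim : Tendsto (fun y => (x₀ - y) ^ K * (a y)⁻¹) (𝓝[>] 0) (𝓝 ((x₀ - 0) ^ K * (a 0)⁻¹)) := by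
    have hac : Tendsto a (𝓝[>] 0) (𝓝 (a 0)) :=
      (ha.continuousOn 0 (by simp)).mono_left (by
        rw [← nhdsWithin_Ioo_eq_nhdsGT zero_lt_one]; exact nhdsWithin_mono _ Ioo_subset_Icc_self)
    refine Tendsto.mul ?_ (hac.inv₀ ha1.ne')
    have : ContinuousAt (fun y : ℝ => (x₀ - y) ^ K) 0 :=
      ContinuousAt.rpow_const (by fun_prop) (Or.inl (by simpa using ha.mem.1.ne'))
    exact this.tendsto.mono_left nhdsWithin_le_nhds
  rw [sub_zero] at hlim
  rw [div_eq_mul_inv, div_eq_mul_inv]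
  exact ge_of_tendsto hlim (by filter_upwards [Ioo_mem_nhdsGT hx0] with y hy using hmono y hy)

/-- `(y - x₀) / a` is dominated by a power of the distance to `x₀`. -/
lemma DegenerateCoefficient.exists_abs_div_le (ha : DegenerateCoefficient a m m' x₀ K) :
    ∃ D, 0 < D ∧ ∀ x ∈ Icc (0 : ℝ) 1, x ≠ x₀ → |(x - x₀) / a x| ≤ D * |x - x₀| ^ (1 - K) := by
  have h1 : 0 < a 1 := ha.pos 1 (by simp) ha.mem.2.ne'
  have h0 : 0 < a 0 := ha.pos 0 (by simp) ha.mem.1.ne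
  have hx1 : 0 < 1 - x₀ := sub_pos.2 ha.mem.2
  have hx0 := ha.mem.1
  refine ⟨max ((1 - x₀) ^ K / a 1) (x₀ ^ K / a 0), lt_max_of_lt_left (by positivity),
    fun x hx hne => ?_⟩
  have hax := ha.pos x hx hne
  have hd : 0 < |x - x₀| := abs_pos.2 (sub_ne_zero.2 hne)
  have hb : |x - x₀| ^ K / a x ≤ max ((1 - x₀) ^ K / a 1) (x₀ ^ K / a 0) := by
    rcases lt_or_gt_of_ne hne with h | h
    · rw [abs_of_neg (sub_neg.2 h), neg_sub]
      exact (ha.rpow_div_le_left h hx.1).trans (le_max_right _ _)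
    · rw [abs_of_pos (sub_pos.2 h)]
      exact (ha.rpow_div_le_right h hx.2).trans (le_max_left _ _)
  rw [abs_div, abs_of_pos hax]
  have e : |x - x₀| / a x = |x - x₀| ^ K / a x * |x - x₀| ^ (1 - K) := by
    rw [div_mul_eq_mul_div, ← Real.rpow_add hd]; simp
  rw [e]
  gcongr

/-- The exponent `2 - K` is positive, so `(x - x₀)²/a` stays bounded at `x₀`. This is what makes
`(aψ')²/a` bounded. -/
lemma DegenerateCoefficient.exists_sq_div_le (ha : DegenerateCoefficient a m m' x₀ K) :
    ∃ D, 0 < D ∧ ∀ x ∈ Icc (0 : ℝ) 1, (x - x₀) ^ 2 / a x ≤ D * |x - x₀| ^ (2 - K) := by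
  obtain ⟨D, hD, h⟩ := ha.exists_abs_div_le
  refine ⟨D, hD, fun x hx => ?_⟩
  rcases eq_or_ne x x₀ with rfl | hne
  · simp; positivity
  have hd : 0 < |x - x₀| := abs_pos.2 (sub_ne_zero.2 hne)
  have e : (x - x₀) ^ 2 / a x = |x - x₀| * |(x - x₀) / a x| := by
    rw [abs_div, abs_of_pos (ha.pos x hx hne), ← mul_div_assoc, abs_mul_abs_self, pow_two]
  have e2 : |x - x₀| ^ (2 - K) = |x - x₀| * |x - x₀| ^ (1 - K) := by
    rw [mul_comm, ← Real.rpow_add_one hd.ne']; congr 1; ring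
  rw [e, e2]
  calc _ ≤ |x - x₀| * (D * |x - x₀| ^ (1 - K)) := by gcongr; exact h x hx hne
    _ = _ := by ring

end

section

variable {a m m' : ℝ → ℝ} {x₀ K : ℝ}

/-! ### The weight `ψ` -/

/-- `a ψ'`. -/
def drift (x₀ R d₁ x : ℝ) : ℝ := d₁ * (x - x₀) * Real.exp (R * (x - x₀) ^ 2)

/-- `(a ψ')'`. -/
def driftDeriv (x₀ R d₁ x : ℝ) : ℝ :=
  d₁ * Real.exp (R * (x - x₀) ^ 2) * (1 + 2 * R * (x - x₀) ^ 2)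

/-- `ψ'`. -/
def psiDeriv (a : ℝ → ℝ) (x₀ R d₁ x : ℝ) : ℝ := drift x₀ R d₁ x / a x

/-- `a ψ''`, where `m` represents `(x - x₀) a' / a`. -/
def curvature (m : ℝ → ℝ) (x₀ R d₁ x : ℝ) : ℝ :=
  d₁ * Real.exp (R * (x - x₀) ^ 2) * (1 + 2 * R * (x - x₀) ^ 2 - m x)

/-- `(a ψ'')'`. -/
def curvatureDeriv (m m' : ℝ → ℝ) (x₀ R d₁ x : ℝ) : ℝ :=
  d₁ * Real.exp (R * (x - x₀) ^ 2) *
    (2 * R * (x - x₀) * (1 + 2 * R * (x - x₀) ^ 2 - m x) + 4 * R * (x - x₀) - m' x)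

lemma hasDerivAt_exp_sq (x₀ R x : ℝ) : HasDerivAt (fun y => Real.exp (R * (y - x₀) ^ 2))
    (Real.exp (R * (x - x₀) ^ 2) * (2 * R * (x - x₀))) x := by
  have h := ((((hasDerivAt_id x).sub_const x₀).fun_pow 2).const_mul R).exp
  refine h.congr_deriv ?_
  simp; ring

lemma hasDerivAt_drift (x₀ R d₁ x : ℝ) :
    HasDerivAt (drift x₀ R d₁) (driftDeriv x₀ R d₁ x) x := by
  have h := (((hasDerivAt_id x).sub_const x₀).const_mul d₁).mul (hasDerivAt_exp_sq x₀ R x)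
  refine h.congr_deriv ?_
  simp [driftDeriv]; ring

lemma continuous_drift (x₀ R d₁ : ℝ) : Continuous (drift x₀ R d₁) := by
  unfold drift; fun_prop

lemma continuous_driftDeriv (x₀ R d₁ : ℝ) : Continuous (driftDeriv x₀ R d₁) := by
  unfold driftDeriv; fun_prop

lemma DegenerateCoefficient.continuousOn_psiDeriv (ha : DegenerateCoefficient a m m' x₀ K)
    (R d₁ : ℝ) : ContinuousOn (psiDeriv a x₀ R d₁) (Icc 0 1 \ {x₀}) :=
  (continuous_drift x₀ R d₁).continuousOn.div (ha.continuousOn.mono sdiff_subset)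
    fun x hx => (ha.pos x hx.1 hx.2).ne'

lemma DegenerateCoefficient.locAC_curvature (ha : DegenerateCoefficient a m m' x₀ K) (R d₁ : ℝ) :
    LocAC 0 1 (curvature m x₀ R d₁) (curvatureDeriv m m' x₀ R d₁) := by
  have h1 : LocAC 0 1 (fun x => d₁ * Real.exp (R * (x - x₀) ^ 2))
      (fun x => d₁ * (Real.exp (R * (x - x₀) ^ 2) * (2 * R * (x - x₀)))) :=
    LocAC.of_hasDerivAt (fun x _ => (hasDerivAt_exp_sq x₀ R x).const_mul d₁) (by fun_prop)
  have h2 : LocAC 0 1 (fun x => 1 + 2 * R * (x - x₀) ^ 2) (fun x => 4 * R * (x - x₀)) := by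
    refine LocAC.of_hasDerivAt (fun x _ => ?_) (by fun_prop)
    have h := ((((hasDerivAt_id x).sub_const x₀).fun_pow 2).const_mul (2 * R)).const_add 1
    refine h.congr_deriv ?_
    simp; ring
  refine (h1.mul (h2.sub ha.reg.locAC)).congr_deriv (Eventually.of_forall fun x => ?_)
  simp only [curvatureDeriv]; ring

lemma DegenerateCoefficient.continuousOn_curvature (ha : DegenerateCoefficient a m m' x₀ K)
    (R d₁ : ℝ) : ContinuousOn (curvature m x₀ R d₁) (Icc 0 1) := by
  have := ha.reg.continuousOn zero_le_one
  unfold curvature; fun_prop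

/-- `ψ'` is locally absolutely continuous off `x₀`, with derivative `(a ψ'') / a`. -/
lemma DegenerateCoefficient.locAC_psiDeriv (ha : DegenerateCoefficient a m m' x₀ K) (R d₁ : ℝ)
    {α β : ℝ} (hα : 0 ≤ α) (hβ : β ≤ 1) (hx₀ : x₀ ∉ Ioo α β) :
    LocAC α β (psiDeriv a x₀ R d₁) (fun x => curvature m x₀ R d₁ x / a x) := by
  have hpos : ∀ x ∈ Ioo α β, 0 < a x := fun x hx =>
    ha.pos x ⟨hα.trans hx.1.le, hx.2.le.trans hβ⟩ fun h => hx₀ (h ▸ hx)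
  have h1 : LocAC α β (drift x₀ R d₁) (driftDeriv x₀ R d₁) :=
    LocAC.of_hasDerivAt (fun x _ => hasDerivAt_drift x₀ R d₁ x)
      (continuous_driftDeriv x₀ R d₁).continuousOn
  have h2 := h1.mul ((ha.ac.locAC.mono hα hβ).inv fun x hx => (hpos x hx).ne')
  refine LocAC.congr_deriv (f := psiDeriv a x₀ R d₁)
    (f' := fun x => driftDeriv x₀ R d₁ x * (a x)⁻¹ + drift x₀ R d₁ x * (-deriv a x / a x ^ 2))
    (by simpa only [psiDeriv, div_eq_mul_inv] using! h2) ?_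
  -- Substituting `m` for `(x - x₀) a'/a` eliminates `a'`; thus `aψ''` is itself absolutely
  -- continuous and can be differentiated once more.
  filter_upwards [ae_restrict_of_ae_restrict_of_subset (Ioo_subset_Ioo hα hβ) ha.reg_eq,
    ae_restrict_mem measurableSet_Ioo] with x hx hmem
  have hax := hpos x hmem
  simp only [curvature, drift, driftDeriv, ← hx]
  field_simp
  ring

/-! ### Integrability of `ψ'` and negativity of `ψ`. -/

lemma integrableOn_rpow_abs {x₀ r : ℝ} (hx : x₀ ∈ Ioo (0 : ℝ) 1) (hr : -1 < r) :
    IntegrableOn (fun x => |x - x₀| ^ r) (Ioo 0 1) := by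
  have h1 : IntervalIntegrable (fun x => |x - x₀| ^ r) volume x₀ 1 := by
    have := (intervalIntegral.intervalIntegrable_rpow' hr (a := 0) (b := 1 - x₀)).comp_sub_right x₀
    simp only [zero_add, sub_add_cancel] at this
    refine this.congr fun x hx' => ?_
    rw [uIoc_of_le hx.2.le] at hx'
    simp only [abs_of_pos (sub_pos.2 hx'.1)]
  have h0 : IntervalIntegrable (fun x => |x - x₀| ^ r) volume 0 x₀ := by
    have := (intervalIntegral.intervalIntegrable_rpow' hr (a := 0) (b := x₀)).comp_sub_left x₀
    simp only [sub_zero, sub_self] at this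
    refine this.symm.congr fun x hx' => ?_
    rw [uIoc_of_le hx.1.le] at hx'
    simp only [abs_of_nonpos (sub_nonpos.2 hx'.2), neg_sub]
  exact (intervalIntegrable_iff_integrableOn_Ioo_of_le zero_le_one).1 (h0.trans h1)

lemma ae_ne_of_restrict (x₀ : ℝ) (s : Set ℝ) : ∀ᵐ x ∂(volume.restrict s), x ≠ x₀ :=
  ae_restrict_of_ae (by simp [ae_iff, measure_singleton])

lemma DegenerateCoefficient.integrableOn_weight (ha : DegenerateCoefficient a m m' x₀ K) (R : ℝ) :
    IntegrableOn (fun y => (y - x₀) / a y * Real.exp (R * (y - x₀) ^ 2)) (Ioo 0 1) := by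
  obtain ⟨D, hD, h⟩ := ha.exists_abs_div_le
  -- The condition `K < 2` enters as `1 - K > -1`.
  have hi := (integrableOn_rpow_abs ha.mem (r := 1 - K) (by linarith [ha.K_lt])).const_mul D
  refine Integrable.mul_bdd (c := Real.exp |R|) ?_ (by fun_prop) ?_
  · refine hi.mono' ?_ ?_
    · have hc : AEStronglyMeasurable a (volume.restrict (Ioo 0 1)) :=
        (ha.continuousOn.mono Ioo_subset_Icc_self).aestronglyMeasurable measurableSet_Ioo
      exact (AEMeasurable.div (by fun_prop) hc.aemeasurable).aestronglyMeasurable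
    · filter_upwards [ae_ne_of_restrict x₀ _, ae_restrict_mem measurableSet_Ioo] with x h1 h2
      exact h x (Ioo_subset_Icc_self h2) h1
  · filter_upwards [ae_restrict_mem measurableSet_Ioo] with x hx
    rw [Real.norm_eq_abs, Real.abs_exp, Real.exp_le_exp]
    have h1 : |x - x₀| ≤ 1 := by
      rw [abs_le]; constructor <;> linarith [hx.1, hx.2, ha.mem.1, ha.mem.2]
    have h2 : (x - x₀) ^ 2 ≤ 1 := by rw [← sq_abs]; exact pow_le_one₀ (abs_nonneg _) h1
    calc R * (x - x₀) ^ 2 ≤ |R| * (x - x₀) ^ 2 := by gcongr; exact le_abs_self R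
      _ ≤ |R| * 1 := by gcongr
      _ = |R| := mul_one _

lemma DegenerateCoefficient.continuousOn_psi (ha : DegenerateCoefficient a m m' x₀ K)
    (R d₁ d₂ : ℝ) : ContinuousOn (psi a x₀ R d₁ d₂) (Icc 0 1) := by
  have hII := (intervalIntegrable_iff_integrableOn_Ioo_of_le zero_le_one).2
    (ha.integrableOn_weight R)
  have := intervalIntegral.continuousOn_primitive_interval' hII
    (by rw [uIcc_of_le zero_le_one]; exact Ioo_subset_Icc_self ha.mem)
  rw [uIcc_of_le zero_le_one] at this
  unfold psi
  fun_prop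

lemma DegenerateCoefficient.hasDerivAt_psi (ha : DegenerateCoefficient a m m' x₀ K)
    (R d₁ d₂ : ℝ) {x : ℝ} (hx : x ∈ Ioo (0 : ℝ) 1) (hne : x ≠ x₀) :
    HasDerivAt (psi a x₀ R d₁ d₂) (psiDeriv a x₀ R d₁ x) x := by
  have hII := (intervalIntegrable_iff_integrableOn_Ioo_of_le zero_le_one).2
    (ha.integrableOn_weight R)
  have hopen : Ioo (0 : ℝ) 1 \ {x₀} ∈ 𝓝 x :=
    (isOpen_Ioo.sdiff isClosed_singleton).mem_nhds ⟨hx, hne⟩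
  have hc : ContinuousOn (fun y => (y - x₀) / a y * Real.exp (R * (y - x₀) ^ 2))
      (Ioo (0 : ℝ) 1 \ {x₀}) := by
    refine ContinuousOn.mul (ContinuousOn.div (by fun_prop)
      (ha.continuousOn.mono (sdiff_subset.trans Ioo_subset_Icc_self)) fun y hy =>
      (ha.pos y (Ioo_subset_Icc_self hy.1) hy.2).ne') (by fun_prop)
  have h := intervalIntegral.integral_hasDerivAt_right
    (hII.mono_set (a := 0) (b := 1) (c := x₀) (d := x) ?_)
    (hc.stronglyMeasurableAtFilter (isOpen_Ioo.sdiff isClosed_singleton) x ⟨hx, hne⟩)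
    (hc.continuousAt hopen)
  · refine ((h.sub_const d₂).const_mul d₁).congr_deriv ?_
    simp only [psiDeriv, drift]; ring
  · rw [uIcc_of_le zero_le_one]
    exact uIcc_subset_Icc (Ioo_subset_Icc_self ha.mem) (Ioo_subset_Icc_self hx)

/-- The condition on `d₂` makes `ψ` negative. -/
lemma DegenerateCoefficient.exists_psi_le (ha : DegenerateCoefficient a m m' x₀ K)
    {R d₁ d₂ : ℝ} (hR : 0 < R) (hd₁ : 0 < d₁)
    (hd₂ : max ((1 - x₀) ^ 2 * Real.exp (R * (1 - x₀) ^ 2) / ((2 - K) * a 1))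
      (x₀ ^ 2 * Real.exp (R * x₀ ^ 2) / ((2 - K) * a 0)) < d₂) :
    ∃ c, 0 < c ∧ ∀ x ∈ Icc (0 : ℝ) 1, psi a x₀ R d₁ d₂ x ≤ -c := by
  set M := max ((1 - x₀) ^ 2 * Real.exp (R * (1 - x₀) ^ 2) / ((2 - K) * a 1))
      (x₀ ^ 2 * Real.exp (R * x₀ ^ 2) / ((2 - K) * a 0)) with hM
  have h1 : 0 < a 1 := ha.pos 1 (by simp) ha.mem.2.ne'
  have h0 : 0 < a 0 := ha.pos 0 (by simp) ha.mem.1.ne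
  have hx1 : 0 < 1 - x₀ := sub_pos.2 ha.mem.2
  have hx0 := ha.mem.1
  have hK : 0 < 2 - K := sub_pos.2 ha.K_lt
  have hII := (intervalIntegrable_iff_integrableOn_Ioo_of_le zero_le_one).2
    (ha.integrableOn_weight R)
  have hr : -1 < 1 - K := by linarith
  -- Majorizing `(y - x₀)/a` by the power bound and the exponential by its value at the endpoint
  -- leaves an elementary integral, whose value at `x = L` is exactly one of the two quantities in
  -- the condition on `d₂`.
  have bound : ∀ L A x : ℝ, 0 < L → 0 < A → 0 ≤ x → x ≤ L →
      ∫ y in (0 : ℝ)..x, L ^ K / A * y ^ (1 - K) * Real.exp (R * L ^ 2)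
        ≤ L ^ 2 * Real.exp (R * L ^ 2) / ((2 - K) * A) := by
    intro L A x hL hA hx hxL
    rw [intervalIntegral.integral_mul_const, intervalIntegral.integral_const_mul,
      integral_rpow (Or.inl hr)]
    have e : (1 : ℝ) - K + 1 = 2 - K := by ring
    rw [e, Real.zero_rpow hK.ne', sub_zero]
    have e2 : L ^ K * L ^ (2 - K) = L ^ 2 := by
      rw [← Real.rpow_add hL]; simp
    have : x ^ (2 - K) ≤ L ^ (2 - K) := Real.rpow_le_rpow hx hxL hK.le
    calc L ^ K / A * (x ^ (2 - K) / (2 - K)) * Real.exp (R * L ^ 2)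
        ≤ L ^ K / A * (L ^ (2 - K) / (2 - K)) * Real.exp (R * L ^ 2) := by gcongr
      _ = (L ^ K * L ^ (2 - K)) * Real.exp (R * L ^ 2) / ((2 - K) * A) := by field_simp
      _ = _ := by rw [e2]
  have key : ∀ x ∈ Icc (0 : ℝ) 1,
      ∫ y in x₀..x, (y - x₀) / a y * Real.exp (R * (y - x₀) ^ 2) ≤ M := by
    intro x hx
    rcases le_total x₀ x with hle | hle
    · refine le_trans ?_ (le_max_left _ _)
      refine le_trans ?_ (bound (1 - x₀) (a 1) (x - x₀) hx1 h1 (sub_nonneg.2 hle)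
        (by linarith [hx.2]))
      have hsub := (intervalIntegral.intervalIntegrable_rpow' hr (a := 0)
        (b := x - x₀)).comp_sub_right x₀
      simp only [zero_add, sub_add_cancel] at hsub
      have e := intervalIntegral.integral_comp_sub_right (a := x₀) (b := x)
        (fun y => (1 - x₀) ^ K / a 1 * y ^ (1 - K) * Real.exp (R * (1 - x₀) ^ 2)) x₀
      rw [sub_self] at e
      rw [← e]
      refine intervalIntegral.integral_mono_on_of_le_Ioo hle (hII.mono_set ?_)
        ((hsub.const_mul _).mul_const _) fun y hy => ?_
      · rw [uIcc_of_le zero_le_one]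
        exact uIcc_subset_Icc (Ioo_subset_Icc_self ha.mem) hx
      · have hy0 : 0 < y - x₀ := sub_pos.2 hy.1
        have hay : 0 < a y := ha.pos y ⟨by linarith, hy.2.le.trans hx.2⟩ hy.1.ne'
        have hq := ha.rpow_div_le_right hy.1 (hy.2.le.trans hx.2)
        have e3 : (y - x₀) / a y = (y - x₀) ^ K / a y * (y - x₀) ^ (1 - K) := by
          rw [div_mul_eq_mul_div, ← Real.rpow_add hy0]; simp
        rw [e3]
        have : y - x₀ ≤ 1 - x₀ := by linarith [hy.2, hx.2]
        gcongr
    · refine le_trans ?_ (le_max_right _ _)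
      refine le_trans ?_ (bound x₀ (a 0) (x₀ - x) hx0 h0 (sub_nonneg.2 hle)
        (by linarith [hx.1]))
      have hsub := (intervalIntegral.intervalIntegrable_rpow' hr (a := 0)
        (b := x₀ - x)).comp_sub_left x₀
      simp only [sub_zero, sub_sub_cancel] at hsub
      have e := intervalIntegral.integral_comp_sub_left (a := x) (b := x₀)
        (fun y => x₀ ^ K / a 0 * y ^ (1 - K) * Real.exp (R * x₀ ^ 2)) x₀
      rw [sub_self] at e
      rw [← e, intervalIntegral.integral_symm, ← intervalIntegral.integral_neg]
      refine intervalIntegral.integral_mono_on_of_le_Ioo hle (hII.mono_set ?_).neg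
        ((hsub.symm.const_mul _).mul_const _) fun y hy => ?_
      · rw [uIcc_of_le zero_le_one]
        exact uIcc_subset_Icc hx (Ioo_subset_Icc_self ha.mem)
      · have hy0 : 0 < x₀ - y := sub_pos.2 hy.2
        have hy00 : 0 ≤ y := hx.1.trans hy.1.le
        have hay : 0 < a y := ha.pos y ⟨hy00, by linarith [ha.mem.2]⟩ hy.2.ne
        have hq := ha.rpow_div_le_left hy.2 hy00
        have e3 : -((y - x₀) / a y * Real.exp (R * (y - x₀) ^ 2)) =
            (x₀ - y) ^ K / a y * (x₀ - y) ^ (1 - K) * Real.exp (R * (x₀ - y) ^ 2) := by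
          have e4 : (x₀ - y) ^ K / a y * (x₀ - y) ^ (1 - K) = (x₀ - y) / a y := by
            rw [div_mul_eq_mul_div, ← Real.rpow_add hy0]; simp
          rw [e4, ← neg_sub x₀ y, neg_sq]; ring
        rw [e3]
        have : x₀ - y ≤ x₀ := by linarith
        gcongr
  refine ⟨d₁ * (d₂ - M), mul_pos hd₁ (sub_pos.2 hd₂), fun x hx => ?_⟩
  have := key x hx
  unfold psi
  nlinarith

end

section

variable {a m m' : ℝ → ℝ} {x₀ K : ℝ}

/-! ### A weighted interpolation inequality -/

lemma restrict_Ioo_split {x₀ : ℝ} (hx : x₀ ∈ Ioo (0 : ℝ) 1) (f : ℝ → ℝ)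
    (hf : IntegrableOn f (Ioo 0 1)) :
    ∫ x in Ioo 0 1, f x = (∫ x in Ioo 0 x₀, f x) + ∫ x in Ioo x₀ 1, f x := by
  have h := (intervalIntegrable_iff_integrableOn_Ioo_of_le zero_le_one).2 hf
  have e := intervalIntegral.integral_add_adjacent_intervals (a := 0) (b := x₀) (c := 1)
    (f := f) (μ := volume)
    (h.mono_set (by rw [uIcc_of_le hx.1.le, uIcc_of_le zero_le_one]; exact Icc_subset_Icc_right hx.2.le))
    (h.mono_set (by rw [uIcc_of_le hx.2.le, uIcc_of_le zero_le_one]; exact Icc_subset_Icc_left hx.1.le))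
  rw [intervalIntegral.integral_of_le hx.1.le, intervalIntegral.integral_of_le hx.2.le,
    intervalIntegral.integral_of_le zero_le_one] at e
  simp only [integral_Ioc_eq_integral_Ioo] at e
  exact e.symm

/-- The fundamental theorem of calculus for a function that is absolutely continuous off an interior
point at which its one-sided limits agree. -/
lemma LocAC.integral_eq_of_split {x₀ A B L : ℝ} {f f' : ℝ → ℝ} (hx : x₀ ∈ Ioo (0 : ℝ) 1)
    (hl : LocAC 0 x₀ f f') (hr : LocAC x₀ 1 f f') (hint : IntegrableOn f' (Ioo 0 1))
    (hA : Tendsto f (𝓝[>] 0) (𝓝 A)) (hL : Tendsto f (𝓝[≠] x₀) (𝓝 L))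
    (hB : Tendsto f (𝓝[<] 1) (𝓝 B)) : ∫ x in Ioo 0 1, f' x = B - A := by
  rw [restrict_Ioo_split hx f' hint,
    hl.integral_eq hx.1 (hint.mono_set (Ioo_subset_Ioo_right hx.2.le)) hA
      (hL.mono_left (nhdsWithin_mono _ fun y hy => ne_of_lt hy)),
    hr.integral_eq hx.2 (hint.mono_set (Ioo_subset_Ioo_left hx.1.le))
      (hL.mono_left (nhdsWithin_mono _ fun y hy => ne_of_gt hy)) hB]
  ring

lemma ContinuousOn.tendsto_zero_right {f : ℝ → ℝ} (hf : ContinuousOn f (Icc 0 1)) :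
    Tendsto f (𝓝[>] 0) (𝓝 (f 0)) :=
  (hf 0 (by simp)).mono_left (by
    rw [← nhdsWithin_Ioo_eq_nhdsGT zero_lt_one]; exact nhdsWithin_mono _ Ioo_subset_Icc_self)

lemma ContinuousOn.tendsto_one_left {f : ℝ → ℝ} (hf : ContinuousOn f (Icc 0 1)) :
    Tendsto f (𝓝[<] 1) (𝓝 (f 1)) :=
  (hf 1 (by simp)).mono_left (by
    rw [← nhdsWithin_Ioo_eq_nhdsLT zero_lt_one]; exact nhdsWithin_mono _ Ioo_subset_Icc_self)

lemma ContinuousOn.tendsto_interior {f : ℝ → ℝ} (hf : ContinuousOn f (Icc 0 1)) {x : ℝ}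
    (hx : x ∈ Ioo (0 : ℝ) 1) : Tendsto f (𝓝[≠] x) (𝓝 (f x)) :=
  (hf.continuousAt (Icc_mem_nhds hx.1 hx.2)).tendsto.mono_left nhdsWithin_le_nhds

lemma eventually_Icc_ne {x₀ : ℝ} (hx : x₀ ∈ Ioo (0 : ℝ) 1) :
    ∀ᶠ x in 𝓝[≠] x₀, x ∈ Icc (0 : ℝ) 1 ∧ x ≠ x₀ := by
  filter_upwards [self_mem_nhdsWithin, mem_nhdsWithin_of_mem_nhds (Icc_mem_nhds hx.1 hx.2)]
    with x h1 h2 using ⟨h2, h1⟩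

lemma tendsto_rpow_abs_sub {x₀ r : ℝ} (hr : 0 < r) :
    Tendsto (fun x => |x - x₀| ^ r) (𝓝[≠] x₀) (𝓝 0) := by
  have h : ContinuousAt (fun x : ℝ => |x - x₀| ^ r) x₀ :=
    ContinuousAt.rpow_const (by fun_prop) (Or.inr hr.le)
  have := h.tendsto.mono_left (nhdsWithin_le_nhds (s := {x₀}ᶜ))
  simpa [Real.zero_rpow hr.ne'] using this

/-- `(x - x₀) / a · w → 0` at `x₀`, for `w` bounded if the degeneracy is weak, and for
`w = O(x - x₀)` otherwise. -/
lemma DegenerateCoefficient.tendsto_div_mul (ha : DegenerateCoefficient a m m' x₀ K) {w : ℝ → ℝ}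
    (hw : ContinuousOn w (Icc 0 1))
    (hB : 1 ≤ K → ∃ B, ∀ x ∈ Icc (0 : ℝ) 1, |w x| ≤ B * |x - x₀|) :
    Tendsto (fun x => (x - x₀) / a x * w x) (𝓝[≠] x₀) (𝓝 0) := by
  obtain ⟨D, hD, hD'⟩ := ha.exists_abs_div_le
  rcases lt_or_ge K 1 with hK | hK
  · have h1 : Tendsto (fun x => (x - x₀) / a x) (𝓝[≠] x₀) (𝓝 0) := by
      have := (tendsto_rpow_abs_sub (x₀ := x₀) (sub_pos.2 hK)).const_mul D
      rw [mul_zero] at this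
      refine squeeze_zero_norm' ?_ this
      filter_upwards [eventually_Icc_ne ha.mem] with x hx using hD' x hx.1 hx.2
    simpa using h1.mul (ContinuousOn.tendsto_interior hw ha.mem)
  · obtain ⟨B, hB⟩ := hB hK
    have := (tendsto_rpow_abs_sub (x₀ := x₀) (sub_pos.2 ha.K_lt)).const_mul (D * B)
    rw [mul_zero] at this
    refine squeeze_zero_norm' ?_ this
    filter_upwards [eventually_Icc_ne ha.mem] with x hx
    have hd : 0 < |x - x₀| := abs_pos.2 (sub_ne_zero.2 hx.2)
    have e2 : |x - x₀| ^ (2 - K) = |x - x₀| ^ (1 - K) * |x - x₀| := by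
      rw [← Real.rpow_add_one hd.ne']; congr 1; ring
    rw [e2, norm_mul, Real.norm_eq_abs, Real.norm_eq_abs]
    calc _ ≤ (D * |x - x₀| ^ (1 - K)) * (B * |x - x₀|) :=
          mul_le_mul (hD' x hx.1 hx.2) (hB x hx.1) (abs_nonneg _) (by positivity)
      _ = _ := by ring

lemma DegenerateCoefficient.locAC_div (ha : DegenerateCoefficient a m m' x₀ K)
    {α β : ℝ} (hα : 0 ≤ α) (hβ : β ≤ 1) (hx₀ : x₀ ∉ Ioo α β) :
    LocAC α β (fun x => (x - x₀) / a x) (fun x => (1 - m x) / a x) := by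
  have h := ha.locAC_psiDeriv 0 1 hα hβ hx₀
  have e1 : psiDeriv a x₀ 0 1 = fun x => (x - x₀) / a x := by
    funext x; simp [psiDeriv, drift]
  have e2 : (fun x => curvature m x₀ 0 1 x / a x) = fun x => (1 - m x) / a x := by
    funext x; simp [curvature]
  rwa [e1, e2] at h

lemma LocAC.aestronglyMeasurable {α β : ℝ} {f f' : ℝ → ℝ} (h : LocAC α β f f') :
    AEStronglyMeasurable f' (volume.restrict (Ioo α β)) := by
  refine (measurable_deriv f).aestronglyMeasurable.congr ?_
  filter_upwards [h.2] with x hx using hx.deriv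

lemma restrict_Ioo_union {x₀ : ℝ} (hx : x₀ ∈ Ioo (0 : ℝ) 1) :
    volume.restrict (Ioo (0 : ℝ) 1) = volume.restrict (Ioo 0 x₀ ∪ Ioo x₀ 1) := by
  refine Measure.restrict_congr_set ?_
  have : ∀ᵐ x : ℝ, x ≠ x₀ := by simp [ae_iff, measure_singleton]
  filter_upwards [this] with x hne
  apply propext
  constructor
  · intro h
    rcases lt_or_gt_of_ne hne with h' | h'
    · exact Or.inl ⟨h.1, h'⟩
    · exact Or.inr ⟨h', h.2⟩
  · rintro (h | h)
    · exact ⟨h.1, h.2.trans hx.2⟩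
    · exact ⟨hx.1.trans h.1, h.2⟩

lemma LocAC.aestronglyMeasurable_of_split {x₀ : ℝ} {f f' : ℝ → ℝ} (hx : x₀ ∈ Ioo (0 : ℝ) 1)
    (hl : LocAC 0 x₀ f f') (hr : LocAC x₀ 1 f f') :
    AEStronglyMeasurable f' (volume.restrict (Ioo 0 1)) := by
  rw [restrict_Ioo_union hx, aestronglyMeasurable_union_iff]
  exact ⟨hl.aestronglyMeasurable, hr.aestronglyMeasurable⟩

lemma LocAC.sub_const_inv {x₀ α β : ℝ} (hx₀ : x₀ ∉ Ioo α β) :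
    LocAC α β (fun x => (x - x₀)⁻¹) (fun x => -1 / (x - x₀) ^ 2) := by
  have h : LocAC α β (fun x => x - x₀) (fun _ => 1) :=
    LocAC.of_hasDerivAt (fun x _ => (hasDerivAt_id x).sub_const x₀) continuousOn_const
  exact h.inv fun x hx => sub_ne_zero.2 fun h => hx₀ (h ▸ hx)

/-- Hardy's inequality at an interior point. -/
lemma hardy_inequality {x₀ B : ℝ} {w p : ℝ → ℝ} (hx : x₀ ∈ Ioo (0 : ℝ) 1)
    (hl : LocAC 0 x₀ w p) (hr : LocAC x₀ 1 w p) (hw : ContinuousOn w (Icc 0 1))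
    (hw0 : w 0 = 0) (hw1 : w 1 = 0) (hB : ∀ x ∈ Icc (0 : ℝ) 1, |w x| ≤ B * |x - x₀|)
    (hp : IntegrableOn (fun x => p x ^ 2) (Ioo 0 1)) :
    IntegrableOn (fun x => (w x / (x - x₀)) ^ 2) (Ioo 0 1) ∧
      ∫ x in Ioo 0 1, (w x / (x - x₀)) ^ 2 ≤ 4 * ∫ x in Ioo 0 1, p x ^ 2 := by
  have hmw : AEStronglyMeasurable w (volume.restrict (Ioo 0 1)) :=
    (hw.mono Ioo_subset_Icc_self).aestronglyMeasurable measurableSet_Ioo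
  have hmp := LocAC.aestronglyMeasurable_of_split hx hl hr
  have hmq : AEStronglyMeasurable (fun x => w x / (x - x₀)) (volume.restrict (Ioo 0 1)) :=
    (hmw.aemeasurable.div (by fun_prop)).aestronglyMeasurable
  -- The bound `B` is used only qualitatively, for integrability and for the vanishing of the flux
  -- at `x₀`; it does not enter the constant `4`.
  have hqB : ∀ x ∈ Icc (0 : ℝ) 1, |w x / (x - x₀)| ≤ |B| := by
    intro x hx'
    rcases eq_or_ne x x₀ with rfl | hne
    · simp
    · rw [abs_div, div_le_iff₀ (abs_pos.2 (sub_ne_zero.2 hne))]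
      exact (hB x hx').trans (by gcongr; exact le_abs_self B)
  have hq : IntegrableOn (fun x => (w x / (x - x₀)) ^ 2) (Ioo 0 1) := by
    refine Integrable.of_bound (hmq.pow 2) (|B| ^ 2) ?_
    filter_upwards [ae_restrict_mem measurableSet_Ioo] with x hx'
    rw [norm_pow, Real.norm_eq_abs]
    exact pow_le_pow_left₀ (abs_nonneg _) (hqB x (Ioo_subset_Icc_self hx')) 2
  refine ⟨hq, ?_⟩
  have hqp : IntegrableOn (fun x => w x / (x - x₀) * p x) (Ioo 0 1) := by
    refine Integrable.mono' (hq.add hp) (hmq.mul hmp) (Eventually.of_forall fun x => ?_)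
    simp only [Pi.add_apply, norm_mul, Real.norm_eq_abs]
    nlinarith [sq_abs (w x / (x - x₀)), sq_abs (p x), sq_nonneg (|w x / (x - x₀)| - |p x|),
      sq_nonneg (|w x / (x - x₀)|), sq_nonneg (|p x|)]
  -- With `q = w/(x - x₀)`, the derivative of `w²/(x - x₀)` is `2qp - q²`, and this flux vanishes at
  -- `0`, `x₀` and `1`. Hence `∫ q² = 2∫ qp`.
  have hf : ∀ α β : ℝ, x₀ ∉ Ioo α β → LocAC α β w p → LocAC α β (fun x => w x ^ 2 * (x - x₀)⁻¹)
      (fun x => 2 * (w x / (x - x₀) * p x) - (w x / (x - x₀)) ^ 2) := by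
    intro α β h h2
    refine (h2.sq.mul (LocAC.sub_const_inv h)).congr_deriv ?_
    filter_upwards with x
    rw [div_eq_mul_inv, div_eq_mul_inv, mul_pow, inv_pow]
    ring
  have hint := (hqp.const_mul 2).sub hq
  have lim : Tendsto (fun x => w x ^ 2 * (x - x₀)⁻¹) (𝓝[≠] x₀) (𝓝 0) := by
    have h1 := (ContinuousOn.tendsto_interior hw hx).const_mul |B|
    have hwx : w x₀ = 0 := by
      have := hB x₀ (Ioo_subset_Icc_self hx)
      simpa using this
    rw [hwx, mul_zero] at h1
    have h1' := h1.norm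
    rw [norm_zero] at h1'
    refine squeeze_zero_norm' ?_ h1'
    filter_upwards [eventually_Icc_ne hx] with x hx'
    have : w x ^ 2 * (x - x₀)⁻¹ = w x / (x - x₀) * w x := by
      rw [div_eq_mul_inv]; ring
    rw [this, norm_mul, norm_mul]
    gcongr
    rw [Real.norm_eq_abs, Real.norm_eq_abs, abs_abs]
    exact hqB x hx'.1
  have lim0 : Tendsto (fun x => w x ^ 2 * (x - x₀)⁻¹) (𝓝[>] 0) (𝓝 0) := by
    have h1 := (ContinuousOn.tendsto_zero_right hw).pow 2
    have h2 : Tendsto (fun x : ℝ => (x - x₀)⁻¹) (𝓝[>] 0) (𝓝 (0 - x₀)⁻¹) :=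
      (ContinuousAt.inv₀ (by fun_prop) (by simpa using hx.1.ne')).tendsto.mono_left nhdsWithin_le_nhds
    simpa [hw0] using h1.mul h2
  have lim1 : Tendsto (fun x => w x ^ 2 * (x - x₀)⁻¹) (𝓝[<] 1) (𝓝 0) := by
    have h1 := (ContinuousOn.tendsto_one_left hw).pow 2
    have h2 : Tendsto (fun x : ℝ => (x - x₀)⁻¹) (𝓝[<] 1) (𝓝 (1 - x₀)⁻¹) :=
      (ContinuousAt.inv₀ (f := fun x => x - x₀) (by fun_prop) (sub_ne_zero.2 hx.2.ne')).tendsto.mono_left nhdsWithin_le_nhds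
    simpa [hw1] using h1.mul h2
  have key := LocAC.integral_eq_of_split hx (hf 0 x₀ (by simp) hl) (hf x₀ 1 (by simp) hr) hint
    lim0 lim lim1
  have e : ∫ x in Ioo 0 1, (2 * (w x / (x - x₀) * p x) - (w x / (x - x₀)) ^ 2) =
      (∫ x in Ioo 0 1, 2 * (w x / (x - x₀) * p x)) - ∫ x in Ioo 0 1, (w x / (x - x₀)) ^ 2 :=
    integral_sub (hqp.const_mul 2) hq
  -- Young's inequality `2qp ≤ q²/2 + 2p²` lets half of `∫ q²` be absorbed, whence the factor `4`.
  have hle : ∫ x in Ioo 0 1, 2 * (w x / (x - x₀) * p x) ≤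
      ∫ x in Ioo 0 1, (1 / 2 * (w x / (x - x₀)) ^ 2 + 2 * p x ^ 2) := by
    refine integral_mono (hqp.const_mul 2) ((hq.const_mul _).add (hp.const_mul _)) fun x => ?_
    simp only
    nlinarith [sq_nonneg (w x / (x - x₀) - 2 * p x)]
  rw [integral_add (hq.const_mul _) (hp.const_mul _)] at hle
  simp only [integral_const_mul] at hle e key
  linarith

lemma DegenerateCoefficient.m_le (ha : DegenerateCoefficient a m m' x₀ K) :
    ∀ᵐ x ∂(volume.restrict (Ioo (0 : ℝ) 1)), m x ≤ K := by
  filter_upwards [ha.reg_eq, ha.le, ae_ne_of_restrict x₀ _, ae_restrict_mem measurableSet_Ioo]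
    with x h1 h2 h3 h4
  rw [← h1, div_le_iff₀ (ha.pos x (Ioo_subset_Icc_self h4) h3)]
  exact h2

/-- This absorbs the zeroth-order terms of the bulk, which come with the weight `1/a`. If `K < 1`,
integrate the derivative of `(x - x₀)/a · w²`, whose zeroth-order part `(1 - m) w²/a` is at least
`(1 - K) w²/a`. If `K ≥ 1`, write `w²/a` as the product of `w/(x - x₀)` and `(x - x₀)/a · w` and
apply Hardy's inequality to the first factor. The constant does not depend on the bound `B` for `w`.
-/
lemma DegenerateCoefficient.weighted_interpolation (ha : DegenerateCoefficient a m m' x₀ K) :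
    ∃ C, 0 < C ∧ ∀ w p : ℝ → ℝ, LocAC 0 x₀ w p → LocAC x₀ 1 w p → ContinuousOn w (Icc 0 1) →
      w 0 = 0 → w 1 = 0 → (1 ≤ K → ∃ B, ∀ x ∈ Icc (0 : ℝ) 1, |w x| ≤ B * |x - x₀|) →
      IntegrableOn (fun x => p x ^ 2) (Ioo 0 1) → IntegrableOn (fun x => w x ^ 2 / a x) (Ioo 0 1) →
      IntegrableOn (fun x => ((x - x₀) / a x) ^ 2 * w x ^ 2) (Ioo 0 1) → ∀ l : ℝ, 0 < l →
      ∫ x in Ioo 0 1, w x ^ 2 / a x ≤ C * (l * (∫ x in Ioo 0 1, p x ^ 2) +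
        l⁻¹ * ∫ x in Ioo 0 1, ((x - x₀) / a x) ^ 2 * w x ^ 2) := by
  rcases lt_or_ge K 1 with hK | hK
  · have hC : 0 < 1 - K := sub_pos.2 hK
    refine ⟨(1 - K)⁻¹, inv_pos.2 hC, fun w p hl hr hw hw0 hw1 hB hp hwa hrw l hlpos => ?_⟩
    have hmw : AEStronglyMeasurable w (volume.restrict (Ioo 0 1)) :=
      (hw.mono Ioo_subset_Icc_self).aestronglyMeasurable measurableSet_Ioo
    have hma : AEStronglyMeasurable a (volume.restrict (Ioo 0 1)) :=
      (ha.continuousOn.mono Ioo_subset_Icc_self).aestronglyMeasurable measurableSet_Ioo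
    have hmp := LocAC.aestronglyMeasurable_of_split ha.mem hl hr
    have hmq : AEStronglyMeasurable (fun x => (x - x₀) / a x * w x) (volume.restrict (Ioo 0 1)) :=
      ((AEMeasurable.div (by fun_prop) hma.aemeasurable).mul
        hmw.aemeasurable).aestronglyMeasurable
    have hqp : IntegrableOn (fun x => (x - x₀) / a x * w x * p x) (Ioo 0 1) := by
      refine Integrable.mono' (hrw.add hp) (hmq.mul hmp) (Eventually.of_forall fun x => ?_)
      simp only [Pi.add_apply, ← mul_pow]
      rw [norm_mul, Real.norm_eq_abs, Real.norm_eq_abs]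
      generalize (x - x₀) / a x * w x = q
      nlinarith [sq_abs q, sq_abs (p x), sq_nonneg (|q| - |p x|), sq_nonneg (|q|), sq_nonneg (|p x|)]
    have hmc := ha.reg.continuousOn zero_le_one
    obtain ⟨N, hN⟩ := isCompact_Icc.exists_bound_of_continuousOn
      (continuousOn_const (c := (1 : ℝ)).sub hmc)
    have hmwa : IntegrableOn (fun x => (1 - m x) * (w x ^ 2 / a x)) (Ioo 0 1) := by
      refine Integrable.bdd_mul (c := N) hwa
        (((continuousOn_const.sub hmc).mono Ioo_subset_Icc_self).aestronglyMeasurable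
          measurableSet_Ioo) ?_
      filter_upwards [ae_restrict_mem measurableSet_Ioo] with x hx
      exact hN x (Ioo_subset_Icc_self hx)
    have hf : ∀ α β : ℝ, 0 ≤ α → β ≤ 1 → x₀ ∉ Ioo α β → LocAC α β w p →
        LocAC α β (fun x => (x - x₀) / a x * w x ^ 2)
          (fun x => (1 - m x) * (w x ^ 2 / a x) + 2 * ((x - x₀) / a x * w x * p x)) := by
      intro α β h1 h2 h3 h4
      refine ((ha.locAC_div h1 h2 h3).mul h4.sq).congr_deriv (Eventually.of_forall fun x => ?_)
      ring
    have lim : Tendsto (fun x => (x - x₀) / a x * w x ^ 2) (𝓝[≠] x₀) (𝓝 0) := by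
      have := (ha.tendsto_div_mul hw hB).mul (ContinuousOn.tendsto_interior hw ha.mem)
      rw [zero_mul] at this
      refine this.congr fun x => ?_
      ring
    have hc : ∀ y ∈ Icc (0 : ℝ) 1, y ≠ x₀ → ContinuousWithinAt (fun x => (x - x₀) / a x * w x ^ 2)
        (Icc 0 1) y := fun y hy hne =>
      (ContinuousWithinAt.div (by fun_prop) (ha.continuousOn y hy) (ha.pos y hy hne).ne').mul
        ((hw y hy).pow 2)
    have lim0 : Tendsto (fun x => (x - x₀) / a x * w x ^ 2) (𝓝[>] 0) (𝓝 0) := by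
      have := (hc 0 (by simp) ha.mem.1.ne).mono_left (show 𝓝[>] (0 : ℝ) ≤ _ by
        rw [← nhdsWithin_Ioo_eq_nhdsGT zero_lt_one]; exact nhdsWithin_mono _ Ioo_subset_Icc_self)
      simpa [hw0] using this
    have lim1 : Tendsto (fun x => (x - x₀) / a x * w x ^ 2) (𝓝[<] 1) (𝓝 0) := by
      have := (hc 1 (by simp) ha.mem.2.ne').mono_left (show 𝓝[<] (1 : ℝ) ≤ _ by
        rw [← nhdsWithin_Ioo_eq_nhdsLT zero_lt_one]; exact nhdsWithin_mono _ Ioo_subset_Icc_self)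
      simpa [hw1] using this
    have key := LocAC.integral_eq_of_split ha.mem
      (hf 0 x₀ le_rfl ha.mem.2.le (by simp) hl) (hf x₀ 1 ha.mem.1.le le_rfl (by simp) hr)
      (hmwa.add (hqp.const_mul 2)) lim0 lim lim1
    rw [integral_add hmwa (hqp.const_mul 2)] at key
    have h1 : ∫ x in Ioo 0 1, (1 - K) * (w x ^ 2 / a x) ≤
        ∫ x in Ioo 0 1, (1 - m x) * (w x ^ 2 / a x) := by
      refine integral_mono_ae (hwa.const_mul _) hmwa ?_
      filter_upwards [ha.m_le, ae_restrict_mem measurableSet_Ioo] with x h1 h2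
      have := div_nonneg (sq_nonneg (w x)) (ha.nonneg (Ioo_subset_Icc_self h2))
      gcongr
    have h2 : -∫ x in Ioo 0 1, 2 * ((x - x₀) / a x * w x * p x) ≤
        ∫ x in Ioo 0 1, (l * p x ^ 2 + l⁻¹ * (((x - x₀) / a x) ^ 2 * w x ^ 2)) := by
      rw [← integral_neg]
      refine integral_mono (hqp.const_mul 2).neg ((hp.const_mul _).add (hrw.const_mul _))
        fun x => ?_
      simp only [← mul_pow]
      generalize (x - x₀) / a x * w x = q
      have : l * p x ^ 2 + l⁻¹ * q ^ 2 + 2 * (q * p x) = l⁻¹ * (q + l * p x) ^ 2 := by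
        field_simp; ring
      have h0 : 0 ≤ l⁻¹ * (q + l * p x) ^ 2 := by positivity
      linarith
    rw [integral_add (hp.const_mul _) (hrw.const_mul _)] at h2
    simp only [integral_const_mul] at h1 h2 key
    rw [inv_mul_eq_div, le_div_iff₀ hC]
    linarith
  · refine ⟨1, one_pos, fun w p hl hr hw hw0 hw1 hB hp hwa hrw l hlpos => ?_⟩
    obtain ⟨B, hB⟩ := hB hK
    obtain ⟨hq, hle⟩ := hardy_inequality ha.mem hl hr hw hw0 hw1 hB hp
    -- The weight `l / 4` in Young's inequality compensates Hardy's constant `4`.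
    have h2 : ∫ x in Ioo 0 1, w x ^ 2 / a x ≤ ∫ x in Ioo 0 1,
        (l / 4 * (w x / (x - x₀)) ^ 2 + l⁻¹ * (((x - x₀) / a x) ^ 2 * w x ^ 2)) := by
      refine integral_mono_ae hwa ((hq.const_mul _).add (hrw.const_mul _)) ?_
      filter_upwards [ae_ne_of_restrict x₀ _] with x hne
      have e : w x ^ 2 / a x = w x / (x - x₀) * ((x - x₀) / a x * w x) := by
        have := sub_ne_zero.2 hne
        field_simp
      rw [e, ← mul_pow]
      generalize (x - x₀) / a x * w x = q
      generalize w x / (x - x₀) = r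
      have : l / 4 * r ^ 2 + l⁻¹ * q ^ 2 - r * q = l⁻¹ * (q - l / 2 * r) ^ 2 := by
        field_simp; ring
      have h0 : 0 ≤ l⁻¹ * (q - l / 2 * r) ^ 2 := by positivity
      linarith
    rw [integral_add (hq.const_mul _) (hrw.const_mul _)] at h2
    simp only [integral_const_mul] at h2
    have := mul_le_mul_of_nonneg_left hle (show 0 ≤ l / 4 by positivity)
    linarith

end

section

/-! ### The singular time weight -/

/-- `Θ'`. -/
def thetaDeriv (T t : ℝ) : ℝ := -4 * (T - 2 * t) / (t * (T - t)) ^ 5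

/-- `Θ''`. -/
def thetaDeriv2 (T t : ℝ) : ℝ :=
  20 * (T - 2 * t) ^ 2 / (t * (T - t)) ^ 6 + 8 / (t * (T - t)) ^ 5

lemma tau_pos {T t : ℝ} (ht : t ∈ Ioo 0 T) : 0 < t * (T - t) :=
  mul_pos ht.1 (sub_pos.2 ht.2)

lemma tau_le {T t : ℝ} (ht : t ∈ Ioo 0 T) : t * (T - t) ≤ T ^ 2 := by
  nlinarith [ht.1, ht.2]

lemma theta_pos {T t : ℝ} (ht : t ∈ Ioo 0 T) : 0 < Theta T t := by
  have := tau_pos ht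
  unfold Theta; positivity

lemma hasDerivAt_tau (T t : ℝ) : HasDerivAt (fun u => u * (T - u)) (T - 2 * t) t := by
  refine ((hasDerivAt_id t).mul ((hasDerivAt_id t).const_sub T)).congr_deriv ?_
  simp; ring

lemma hasDerivAt_theta {T t : ℝ} (ht : t ∈ Ioo 0 T) :
    HasDerivAt (Theta T) (thetaDeriv T t) t := by
  have hτ := tau_pos ht
  have h := ((hasDerivAt_tau T t).fun_pow 4).fun_inv (pow_pos hτ 4).ne'
  have e : Theta T = fun u => ((u * (T - u)) ^ 4)⁻¹ := by
    funext u; simp [Theta]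
  rw [e]
  refine h.congr_deriv ?_
  have := (sub_pos.2 ht.2).ne'
  have := ht.1.ne'
  simp only [thetaDeriv]
  field_simp
  norm_num
  ring

lemma hasDerivAt_thetaDeriv {T t : ℝ} (ht : t ∈ Ioo 0 T) :
    HasDerivAt (thetaDeriv T) (thetaDeriv2 T t) t := by
  have hτ := tau_pos ht
  have h1 : HasDerivAt (fun u => -4 * (T - 2 * u)) 8 t := by
    refine ((((hasDerivAt_id t).const_mul 2).const_sub T).const_mul (-4)).congr_deriv ?_
    norm_num
  have h := h1.fun_div ((hasDerivAt_tau T t).fun_pow 5) (pow_pos hτ 5).ne'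
  refine h.congr_deriv ?_
  have := (sub_pos.2 ht.2).ne'
  have := ht.1.ne'
  simp only [thetaDeriv2]
  field_simp
  norm_num
  ring

lemma continuousOn_theta (T : ℝ) : ContinuousOn (Theta T) (Ioo 0 T) := fun _ ht =>
  (hasDerivAt_theta ht).continuousAt.continuousWithinAt

lemma continuousOn_thetaDeriv (T : ℝ) : ContinuousOn (thetaDeriv T) (Ioo 0 T) := fun _ ht =>
  (hasDerivAt_thetaDeriv ht).continuousAt.continuousWithinAt

lemma continuousOn_thetaDeriv2 (T : ℝ) : ContinuousOn (thetaDeriv2 T) (Ioo 0 T) := by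
  have h : ∀ (k : ℕ), ∀ t ∈ Ioo 0 T, (t * (T - t)) ^ k ≠ 0 := fun k t ht =>
    (pow_pos (tau_pos ht) k).ne'
  unfold thetaDeriv2
  exact (ContinuousOn.div (by fun_prop) (by fun_prop) (h 6)).add
    (ContinuousOn.div (by fun_prop) (by fun_prop) (h 5))

lemma measurable_theta (T : ℝ) : Measurable (Theta T) := by unfold Theta; fun_prop
lemma measurable_thetaDeriv (T : ℝ) : Measurable (thetaDeriv T) := by unfold thetaDeriv; fun_prop
lemma measurable_thetaDeriv2 (T : ℝ) : Measurable (thetaDeriv2 T) := by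
  unfold thetaDeriv2; fun_prop

lemma theta_lower {T t : ℝ} (ht : t ∈ Ioo 0 T) :
    1 / T ^ 8 ≤ Theta T t := by
  unfold Theta
  have h := tau_pos ht
  refine one_div_le_one_div_of_le (by positivity) ?_
  calc (t * (T - t)) ^ 4 ≤ (T ^ 2) ^ 4 := pow_le_pow_left₀ h.le (tau_le ht) 4
    _ = T ^ 8 := by ring

/-- With `τ = t(T - t)`, `Θ'` has order `τ⁻⁵` and `Θ²` order `τ⁻⁸`; the spare `τ³` is at most `T⁶`.
The exponent `2` is not sharp but is all that the absorption needs. -/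
lemma abs_thetaDeriv_le {T : ℝ} {t : ℝ} (ht : t ∈ Ioo 0 T) :
    |thetaDeriv T t| ≤ 4 * T ^ 7 * Theta T t ^ 2 := by
  have h := tau_pos ht
  have hT : 0 < T := ht.1.trans ht.2
  have e : 4 * T ^ 7 * Theta T t ^ 2 = 4 * T ^ 7 / (t * (T - t)) ^ 8 := by
    unfold Theta; rw [div_pow, ← pow_mul]; ring
  have h2 : |T - 2 * t| ≤ T := by rw [abs_le]; constructor <;> linarith [ht.1, ht.2]
  have h3 : (t * (T - t)) ^ 3 ≤ (T ^ 2) ^ 3 := pow_le_pow_left₀ h.le (tau_le ht) 3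
  have hn : |(-4 : ℝ)| = 4 := by norm_num
  unfold thetaDeriv
  rw [e, abs_div, abs_mul, abs_of_pos (pow_pos h 5), hn, div_le_div_iff₀ (by positivity)
    (by positivity)]
  calc 4 * |T - 2 * t| * (t * (T - t)) ^ 8
      = 4 * |T - 2 * t| * ((t * (T - t)) ^ 3 * (t * (T - t)) ^ 5) := by ring
    _ ≤ 4 * T * ((T ^ 2) ^ 3 * (t * (T - t)) ^ 5) := by gcongr
    _ = _ := by ring

lemma abs_thetaDeriv2_le {T : ℝ} {t : ℝ} (ht : t ∈ Ioo 0 T) :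
    |thetaDeriv2 T t| ≤ 28 * T ^ 6 * Theta T t ^ 2 := by
  have h := tau_pos ht
  have hT : 0 < T := ht.1.trans ht.2
  have e : 28 * T ^ 6 * Theta T t ^ 2 = 20 * T ^ 6 / (t * (T - t)) ^ 8 +
      8 * T ^ 6 / (t * (T - t)) ^ 8 := by
    unfold Theta; rw [div_pow, ← pow_mul]; ring
  have h2 : (T - 2 * t) ^ 2 ≤ T ^ 2 := by
    nlinarith [ht.1, ht.2]
  unfold thetaDeriv2
  rw [e, abs_of_nonneg (by positivity)]
  have h3 : (t * (T - t)) ^ 3 ≤ (T ^ 2) ^ 3 := pow_le_pow_left₀ h.le (tau_le ht) 3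
  have h4 : (t * (T - t)) ^ 2 ≤ (T ^ 2) ^ 2 := pow_le_pow_left₀ h.le (tau_le ht) 2
  gcongr ?_ + ?_
  · rw [div_le_div_iff₀ (by positivity) (by positivity)]
    calc 20 * (T - 2 * t) ^ 2 * (t * (T - t)) ^ 8
        = 20 * (T - 2 * t) ^ 2 * ((t * (T - t)) ^ 2 * (t * (T - t)) ^ 6) := by ring
      _ ≤ 20 * T ^ 2 * ((T ^ 2) ^ 2 * (t * (T - t)) ^ 6) := by gcongr
      _ = _ := by ring
  · rw [div_le_div_iff₀ (by positivity) (by positivity)]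
    calc 8 * (t * (T - t)) ^ 8 = 8 * ((t * (T - t)) ^ 3 * (t * (T - t)) ^ 5) := by ring
      _ ≤ 8 * ((T ^ 2) ^ 3 * (t * (T - t)) ^ 5) := by gcongr
      _ = _ := by ring

lemma pow_mul_exp_neg_le {c : ℝ} (hc : 0 < c) (k : ℕ) {y : ℝ} (hy : 0 ≤ y) :
    y ^ k * Real.exp (-(c * y)) ≤ k.factorial / c ^ k := by
  have h := Real.pow_div_factorial_le_exp (c * y) (by positivity) k
  rw [div_le_iff₀ (by positivity), mul_pow] at h
  rw [Real.exp_neg, ← div_eq_mul_inv, div_le_div_iff₀ (Real.exp_pos _) (by positivity)]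
  linarith

/-! ### Functions on the cylinder that decay at the ends of the time interval -/

lemma volQ_eq (T : ℝ) :
    volQ T = (volume.restrict (Ioo 0 T)).prod (volume.restrict (Ioo (0 : ℝ) 1)) := by
  rw [Measure.prod_restrict]; rfl

lemma ae_volQ_mem (T : ℝ) : ∀ᵐ p ∂(volQ T), p.1 ∈ Ioo 0 T ∧ p.2 ∈ Ioo (0 : ℝ) 1 := by
  filter_upwards [ae_restrict_mem (measurableSet_Ioo.prod measurableSet_Ioo)] with p hp
    using ⟨hp.1, hp.2⟩

lemma ae_volQ_of_ae_snd {T : ℝ} {P : ℝ → Prop}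
    (h : ∀ᵐ x ∂(volume.restrict (Ioo (0 : ℝ) 1)), P x) : ∀ᵐ p ∂(volQ T), P p.2 := by
  rw [volQ_eq]; exact Measure.quasiMeasurePreserving_snd.ae h

lemma aestronglyMeasurable_snd {T : ℝ} {f : ℝ → ℝ}
    (h : AEStronglyMeasurable f (volume.restrict (Ioo (0 : ℝ) 1))) :
    AEStronglyMeasurable (fun p : ℝ × ℝ => f p.2) (volQ T) := by
  rw [volQ_eq]; exact h.comp_snd

/-- A coefficient that grows at most like a power of `Θ`. -/
def Moderate (T : ℝ) (c : ℝ × ℝ → ℝ) : Prop :=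
  AEStronglyMeasurable c (volQ T) ∧
    ∃ (C : ℝ) (k : ℕ), ∀ᵐ p ∂(volQ T), |c p| ≤ C * Theta T p.1 ^ k

/-- A function that remains square integrable when multiplied by a power of `Θ`. -/
def RapidL2 (T : ℝ) (F : ℝ × ℝ → ℝ) : Prop :=
  ∀ k : ℕ, MemLp (fun p => Theta T p.1 ^ k * F p) 2 (volQ T)

lemma Moderate.of_fst {T C : ℝ} {k : ℕ} {f : ℝ → ℝ} (hf : Measurable f)
    (h : ∀ t ∈ Ioo 0 T, |f t| ≤ C * Theta T t ^ k) : Moderate T (fun p => f p.1) :=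
  ⟨(hf.comp measurable_fst).aestronglyMeasurable, C, k, by
    filter_upwards [ae_volQ_mem T] with p hp using h _ hp.1⟩

lemma Moderate.theta (T : ℝ) : Moderate T (fun p => Theta T p.1) :=
  Moderate.of_fst (C := 1) (k := 1) (measurable_theta T) fun t ht => by
    rw [abs_of_pos (theta_pos ht)]; simp

lemma Moderate.thetaDeriv (T : ℝ) : Moderate T (fun p => thetaDeriv T p.1) :=
  Moderate.of_fst (measurable_thetaDeriv T) fun _ ht => abs_thetaDeriv_le ht

lemma Moderate.thetaDeriv2 (T : ℝ) : Moderate T (fun p => thetaDeriv2 T p.1) :=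
  Moderate.of_fst (measurable_thetaDeriv2 T) fun _ ht => abs_thetaDeriv2_le ht

lemma Moderate.const (T c : ℝ) : Moderate T (fun _ => c) :=
  ⟨aestronglyMeasurable_const, |c|, 0, by simp⟩

lemma Moderate.of_snd {T N : ℝ} {f : ℝ → ℝ}
    (hf : AEStronglyMeasurable f (volume.restrict (Ioo (0 : ℝ) 1)))
    (h : ∀ᵐ x ∂(volume.restrict (Ioo (0 : ℝ) 1)), |f x| ≤ N) : Moderate T (fun p => f p.2) :=
  ⟨aestronglyMeasurable_snd hf, N, 0, by
    filter_upwards [ae_volQ_of_ae_snd h] with p hp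
    simpa using hp⟩

lemma Moderate.of_continuousOn {T : ℝ} {f : ℝ → ℝ} (hf : ContinuousOn f (Icc 0 1)) :
    Moderate T (fun p => f p.2) := by
  obtain ⟨C, hC⟩ := isCompact_Icc.exists_bound_of_continuousOn hf
  refine Moderate.of_snd (N := C)
    ((hf.mono Ioo_subset_Icc_self).aestronglyMeasurable measurableSet_Ioo) ?_
  filter_upwards [ae_restrict_mem measurableSet_Ioo] with x hx using hC x (Ioo_subset_Icc_self hx)

lemma Moderate.mul {T : ℝ} {c d : ℝ × ℝ → ℝ} (hc : Moderate T c) (hd : Moderate T d) :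
    Moderate T (fun p => c p * d p) := by
  obtain ⟨hc, C, k, h1⟩ := hc
  obtain ⟨hd, D, l, h2⟩ := hd
  refine ⟨hc.mul hd, C * D, k + l, ?_⟩
  filter_upwards [h1, h2] with p h1 h2
  rw [abs_mul]
  calc |c p| * |d p| ≤ (C * Theta T p.1 ^ k) * (D * Theta T p.1 ^ l) :=
        mul_le_mul h1 h2 (abs_nonneg _) ((abs_nonneg _).trans h1)
    _ = _ := by ring

lemma RapidL2.add {T : ℝ} {F G : ℝ × ℝ → ℝ} (hF : RapidL2 T F) (hG : RapidL2 T G) :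
    RapidL2 T (fun p => F p + G p) := fun k => by
  refine ((hF k).add (hG k)).ae_eq (Eventually.of_forall fun p => ?_)
  simp only [Pi.add_apply]; ring

lemma RapidL2.sub {T : ℝ} {F G : ℝ × ℝ → ℝ} (hF : RapidL2 T F) (hG : RapidL2 T G) :
    RapidL2 T (fun p => F p - G p) := fun k => by
  refine ((hF k).sub (hG k)).ae_eq (Eventually.of_forall fun p => ?_)
  simp only [Pi.sub_apply]; ring

lemma RapidL2.moderate_mul {T : ℝ} {c F : ℝ × ℝ → ℝ} (hc : Moderate T c) (hF : RapidL2 T F) :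
    RapidL2 T (fun p => c p * F p) := fun k => by
  obtain ⟨hm, C, l, h⟩ := hc
  have hθ : AEStronglyMeasurable (fun p : ℝ × ℝ => Theta T p.1 ^ k) (volQ T) :=
    (((measurable_theta T).comp measurable_fst).pow_const k).aestronglyMeasurable
  have hFm : AEStronglyMeasurable F (volQ T) := by simpa using (hF 0).1
  refine (((hF (k + l)).const_mul C).mono (hθ.mul (hm.mul hFm)) ?_)
  filter_upwards [h, ae_volQ_mem T] with p h1 h2
  have hp := theta_pos h2.1
  simp only [norm_mul, Real.norm_eq_abs, abs_pow, pow_add]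
  have hCn : C * Theta T p.1 ^ l ≤ |C| * Theta T p.1 ^ l := by gcongr; exact le_abs_self C
  have : |c p| ≤ |C| * |Theta T p.1| ^ l := by
    rw [abs_of_pos hp]; exact h1.trans hCn
  calc |Theta T p.1| ^ k * (|c p| * |F p|)
      ≤ |Theta T p.1| ^ k * ((|C| * |Theta T p.1| ^ l) * |F p|) := by gcongr
    _ = _ := by ring

lemma RapidL2.const_mul {T : ℝ} (c : ℝ) {F : ℝ × ℝ → ℝ} (hF : RapidL2 T F) :
    RapidL2 T (fun p => c * F p) := RapidL2.moderate_mul (Moderate.const T c) hF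

lemma RapidL2.memLp {T : ℝ} {F : ℝ × ℝ → ℝ} (hF : RapidL2 T F) : MemLp F 2 (volQ T) := by
  simpa using hF 0

lemma RapidL2.integrable_mul {T : ℝ} {F G : ℝ × ℝ → ℝ} (hF : RapidL2 T F) (hG : RapidL2 T G) :
    Integrable (fun p => F p * G p) (volQ T) := hF.memLp.integrable_mul hG.memLp

lemma RapidL2.integrable_sq {T : ℝ} {F : ℝ × ℝ → ℝ} (hF : RapidL2 T F) :
    Integrable (fun p => F p ^ 2) (volQ T) := hF.memLp.integrable_sq

lemma RapidL2.congr {T : ℝ} {F G : ℝ × ℝ → ℝ} (hF : RapidL2 T F)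
    (h : ∀ᵐ p ∂(volQ T), F p = G p) : RapidL2 T G := fun k => by
  refine (hF k).ae_eq ?_
  filter_upwards [h] with p hp
  rw [hp]

lemma theta_pow_mul_exp_le {s c y θ : ℝ} (hs : 0 < s) (hc : 0 < c) (hy : y ≤ -c) (hθ : 0 ≤ θ)
    (k : ℕ) : θ ^ k * Real.exp (s * θ * y) ≤ k.factorial / (s * c) ^ k := by
  refine le_trans ?_ (pow_mul_exp_neg_le (mul_pos hs hc) k hθ)
  gcongr
  nlinarith [mul_nonneg hs.le hθ]

/-- Since `ψ ≤ -c`, the factor `Θ^k e^{sΘψ}` is bounded for every `k`, so no decay in time is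
required of `V`. -/
lemma RapidL2.exp_mul {T s c : ℝ} {ψ : ℝ → ℝ} {V : ℝ × ℝ → ℝ} (hs : 0 < s) (hc : 0 < c)
    (hψ : ContinuousOn ψ (Icc 0 1)) (hψc : ∀ x ∈ Icc (0 : ℝ) 1, ψ x ≤ -c)
    (hV : MemLp V 2 (volQ T)) :
    RapidL2 T (fun p => Real.exp (s * Theta T p.1 * ψ p.2) * V p) := fun k => by
  have hθ : AEStronglyMeasurable (fun p : ℝ × ℝ => Theta T p.1) (volQ T) :=
    ((measurable_theta T).comp measurable_fst).aestronglyMeasurable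
  have hψm : AEStronglyMeasurable (fun p : ℝ × ℝ => ψ p.2) (volQ T) := aestronglyMeasurable_snd
    ((hψ.mono Ioo_subset_Icc_self).aestronglyMeasurable measurableSet_Ioo)
  have he : AEStronglyMeasurable (fun p : ℝ × ℝ => Real.exp (s * Theta T p.1 * ψ p.2))
      (volQ T) := Real.continuous_exp.comp_aestronglyMeasurable
    ((hθ.const_mul s).mul hψm)
  refine ((hV.const_mul (k.factorial / (s * c) ^ k)).mono ((hθ.pow k).mul (he.mul hV.1)) ?_)
  filter_upwards [ae_volQ_mem T] with p hp
  have h0 := theta_pos hp.1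
  have hb := theta_pow_mul_exp_le hs hc (hψc p.2 (Ioo_subset_Icc_self hp.2)) h0.le k
  simp only [norm_mul, Real.norm_eq_abs, abs_pow, Real.abs_exp, abs_of_pos h0, ← mul_assoc]
  gcongr
  exact hb.trans (le_abs_self _)

/-- A function of time that is bounded by a multiple of `Θ^k e^{s Θ y}`, `y < 0`, tends to zero at
both ends. -/
lemma tendsto_zero_of_le_theta_exp {T s c y C : ℝ} {k : ℕ} {f : ℝ → ℝ} {l : Filter ℝ}
    (hs : 0 < s) (hc : 0 < c) (hy : y ≤ -c) (hl : ∀ᶠ t in l, t ∈ Ioo 0 T)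
    (hτ : Tendsto (fun t => t * (T - t)) l (𝓝 0))
    (h : ∀ t ∈ Ioo 0 T, |f t| ≤ C * (Theta T t ^ k * Real.exp (s * Theta T t * y))) :
    Tendsto f l (𝓝 0) := by
  -- One power of `Θ` beyond `k` is spent: `Θ · (t(T - t))⁴ = 1`, and the bound on `Θ^(k+1) e^{sΘy}`
  -- leaves the factor `(t(T - t))⁴`, which tends to zero.
  have h2 : Tendsto (fun t => |C| * ((k + 1).factorial / (s * c) ^ (k + 1)) * (t * (T - t)) ^ 4) l
      (𝓝 0) := by
    simpa using (hτ.pow 4).const_mul (|C| * ((k + 1).factorial / (s * c) ^ (k + 1)))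
  refine squeeze_zero_norm' ?_ h2
  filter_upwards [hl] with t ht
  have h0 := theta_pos ht
  have hb := theta_pow_mul_exp_le hs hc hy h0.le (k + 1)
  have e : Theta T t * (t * (T - t)) ^ 4 = 1 := by
    have := tau_pos ht
    unfold Theta; rw [one_div, inv_mul_cancel₀ (by positivity)]
  have hτ0 := (tau_pos ht).le
  rw [Real.norm_eq_abs]
  calc |f t| ≤ C * (Theta T t ^ k * Real.exp (s * Theta T t * y)) := h t ht
    _ ≤ |C| * (Theta T t ^ k * Real.exp (s * Theta T t * y)) := by gcongr; exact le_abs_self C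
    _ = |C| * (Theta T t ^ k * Real.exp (s * Theta T t * y)) * (Theta T t * (t * (T - t)) ^ 4) := by
        rw [e, mul_one]
    _ = |C| * (Theta T t ^ (k + 1) * Real.exp (s * Theta T t * y)) * (t * (T - t)) ^ 4 := by ring
    _ ≤ _ := by gcongr

end

section

/-! ### The conjugated operator

With `k = s Θ` and `w = e^{kψ} v`, the derivatives of `w` are expressed through those of `v`. Here
`e` stands for `e^{kψ}`, `ρ` for `ψ'`, `n` for `aψ''`, `b` for `aψ'`, `k₁` and `k₂` for the time
derivatives of `k`, and `p`, `r`, `z`, `y` for `w_x`, `w_t`, `w_xx`, `w_tx`. -/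

/-- `w_x`. -/
def conjX (e k ρ v vx : ℝ) : ℝ := e * (vx + k * ρ * v)

/-- `w_t`. -/
def conjT (e k₁ ψ v vt : ℝ) : ℝ := e * (vt + k₁ * ψ * v)

/-- `w_xx`. -/
def conjXX (e k ρ q v vx vxx : ℝ) : ℝ :=
  e * (vxx + 2 * k * ρ * vx + k * q * v + k ^ 2 * ρ ^ 2 * v)

/-- `w_tx`. -/
def conjTX (e k k₁ ψ ρ v vx vt vtx : ℝ) : ℝ :=
  e * (vtx + k₁ * ψ * vx + k₁ * ρ * v + k * ρ * vt + k * k₁ * ψ * ρ * v)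

/-- The product of the symmetric and the skew part of the conjugated operator, divided by `a`. -/
def crossTerm (a ψ ρ b n k k₁ w p r z : ℝ) : ℝ :=
  (z - k₁ * ψ * w / a + k ^ 2 * ρ ^ 2 * w) * (r - 2 * k * b * p - k * n * w)

/-- The pair of fluxes collects the exact derivatives in the cross term. The product `w_x w_t` is
needed because `w_xx w_t` is its `x`-derivative minus `w_x w_tx`, and `w_x w_tx` is the
`t`-derivative of `w_x²/2`; so `p * y` occurs with opposite signs in the two flux derivatives and
`w_tx` drops out. -/
def spaceFlux (ψ ρ b n k k₁ w p r : ℝ) : ℝ :=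
  p * r - k * b * p ^ 2 - k * n * w * p + k * k₁ * (ψ * ρ * w ^ 2) - k ^ 3 * (b * ρ ^ 2 * w ^ 2)

def spaceFluxDeriv (a ψ ρ b b' n n' k k₁ w p r z y : ℝ) : ℝ :=
  z * r + p * y - k * (b' * p ^ 2 + 2 * b * p * z) - k * (n' * w * p + n * p ^ 2 + n * w * z) +
    k * k₁ * (ρ ^ 2 * w ^ 2 + ψ * (n / a) * w ^ 2 + 2 * ψ * ρ * w * p) -
    k ^ 3 * (b' * ρ ^ 2 * w ^ 2 + 2 * b * ρ * (n / a) * w ^ 2 + 2 * b * ρ ^ 2 * w * p)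

def timeFlux (a ψ ρ k k₁ w p : ℝ) : ℝ :=
  -(1 / 2) * p ^ 2 - 1 / 2 * k₁ * ψ * w ^ 2 / a + 1 / 2 * k ^ 2 * ρ ^ 2 * w ^ 2

def timeFluxDeriv (a ψ ρ k k₁ k₂ w p r y : ℝ) : ℝ :=
  -(p * y) - 1 / 2 * k₂ * ψ * w ^ 2 / a - k₁ * ψ * w * r / a + k * k₁ * ρ ^ 2 * w ^ 2 +
    k ^ 2 * ρ ^ 2 * w * r

/-- The terms in `b' + n` are the coercive ones. The term with `k * k₁` compensates the two equal
contributions `k k₁ ρ² w²` produced by differentiating each flux, and the one with `k₂` comes from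
the time derivative of `k₁`. -/
def bulkTerm (a ψ ρ b' n n' k k₁ k₂ w p : ℝ) : ℝ :=
  k * (b' + n) * p ^ 2 + k * n' * w * p + k ^ 3 * (b' + n) * ρ ^ 2 * w ^ 2 -
    2 * k * k₁ * ρ ^ 2 * w ^ 2 + 1 / 2 * k₂ * ψ * w ^ 2 / a

/-- The cross term is a divergence plus the bulk term. -/
lemma crossTerm_eq {a ψ ρ b b' n n' k k₁ k₂ w p r z y : ℝ} (ha : a ≠ 0) (hb : ρ = b / a) :
    crossTerm a ψ ρ b n k k₁ w p r z = spaceFluxDeriv a ψ ρ b b' n n' k k₁ w p r z y +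
      timeFluxDeriv a ψ ρ k k₁ k₂ w p r y + bulkTerm a ψ ρ b' n n' k k₁ k₂ w p := by
  subst hb
  unfold crossTerm spaceFluxDeriv timeFluxDeriv bulkTerm
  field_simp
  ring

/-- The cross term is controlled by the source. -/
lemma two_mul_crossTerm_le {a ψ ρ b n k k₁ v vx vxx vt e : ℝ} (ha : 0 < a) (hb : ρ = b / a) :
    2 * crossTerm a ψ ρ b n k k₁ (e * v) (conjX e k ρ v vx) (conjT e k₁ ψ v vt)
      (conjXX e k ρ (n / a) v vx vxx) ≤ (vt + a * vxx) ^ 2 * (e ^ 2 / a) := by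
  -- `A` and `B` are the symmetric and skew parts of the conjugated operator, so `A + B = e (v_t + a
  -- v_xx)`, and the claim is `2AB ≤ (A + B)²` divided by `a`.
  set A := a * (conjXX e k ρ (n / a) v vx vxx - k₁ * ψ * (e * v) / a + k ^ 2 * ρ ^ 2 * (e * v))
    with hA
  set B := conjT e k₁ ψ v vt - 2 * k * b * conjX e k ρ v vx - k * n * (e * v) with hB
  have e1 : crossTerm a ψ ρ b n k k₁ (e * v) (conjX e k ρ v vx) (conjT e k₁ ψ v vt)
      (conjXX e k ρ (n / a) v vx vxx) = A * B / a := by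
    rw [hA, hB]; unfold crossTerm; field_simp
  have e2 : (vt + a * vxx) ^ 2 * (e ^ 2 / a) = (A + B) ^ 2 / a := by
    rw [← mul_div_assoc]
    congr 1
    rw [← mul_pow]
    congr 1
    rw [hA, hB]
    unfold conjX conjT conjXX
    subst hb
    field_simp
    ring
  rw [e1, e2, ← mul_div_assoc]
  gcongr
  nlinarith [sq_nonneg A, sq_nonneg B]

/-! ### Structural conditions on the weight, and the flux in the space variable. -/

/-- The weights entering the estimate: `ψ` with `ψ' = ρ = b / a` and `aψ'' = n`. -/
structure CarlemanWeight (a ψ ρ b b' n n' : ℝ → ℝ) (x₀ : ℝ) : Prop where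
  mem : x₀ ∈ Ioo (0 : ℝ) 1
  a_cont : ContinuousOn a (Icc 0 1)
  a_zero : a x₀ = 0
  a_pos : ∀ x ∈ Icc (0 : ℝ) 1, x ≠ x₀ → 0 < a x
  psi_cont : ContinuousOn ψ (Icc 0 1)
  psi_deriv : ∀ x ∈ Ioo (0 : ℝ) 1, x ≠ x₀ → HasDerivAt ψ (ρ x) x
  psi_neg : ∃ c, 0 < c ∧ ∀ x ∈ Icc (0 : ℝ) 1, ψ x ≤ -c
  rho_eq : ∀ x, ρ x = b x / a x
  rho_cont : ContinuousOn ρ (Icc 0 1 \ {x₀})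
  rho_ac : ∀ α β, 0 ≤ α → β ≤ 1 → x₀ ∉ Ioo α β → LocAC α β ρ (fun x => n x / a x)
  b_deriv : ∀ x, HasDerivAt b (b' x) x
  b'_cont : Continuous b'
  b_zero : b x₀ = 0
  n_ac : LocAC 0 1 n n'
  n_cont : ContinuousOn n (Icc 0 1)
  n'_bound : ∃ N, ∀ᵐ x ∂(volume.restrict (Ioo (0 : ℝ) 1)), |n' x| ≤ N
  coercive : ∃ c, 0 < c ∧ ∀ᵐ x ∂(volume.restrict (Ioo (0 : ℝ) 1)), c ≤ b' x + n x
  b_sq : ∃ M, ∀ x ∈ Icc (0 : ℝ) 1, b x ^ 2 / a x ≤ M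

namespace CarlemanWeight

variable {a ψ ρ b b' n n' : ℝ → ℝ} {x₀ : ℝ}

lemma b_cont (h : CarlemanWeight a ψ ρ b b' n n' x₀) : Continuous b :=
  continuous_iff_continuousAt.2 fun x => (h.b_deriv x).continuousAt

lemma locAC_exp (h : CarlemanWeight a ψ ρ b b' n n' x₀) (k : ℝ) {α β : ℝ} (hα : 0 ≤ α)
    (hβ : β ≤ 1) (hx₀ : x₀ ∉ Ioo α β) :
    LocAC α β (fun x => Real.exp (k * ψ x)) (fun x => Real.exp (k * ψ x) * (k * ρ x)) := by
  have hsub : ∀ x ∈ Ioo α β, x ∈ Ioo (0 : ℝ) 1 ∧ x ≠ x₀ := fun x hx =>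
    ⟨⟨hα.trans_lt hx.1, hx.2.trans_le hβ⟩, fun h => hx₀ (h ▸ hx)⟩
  refine LocAC.of_hasDerivAt (fun x hx =>
    ((h.psi_deriv x (hsub x hx).1 (hsub x hx).2).const_mul k).exp) ?_
  have h1 : ContinuousOn ψ (Ioo α β) :=
    h.psi_cont.mono fun x hx => Ioo_subset_Icc_self (hsub x hx).1
  have h2 : ContinuousOn ρ (Ioo α β) :=
    h.rho_cont.mono fun x hx => ⟨Ioo_subset_Icc_self (hsub x hx).1, (hsub x hx).2⟩
  fun_prop

lemma locAC_psi (h : CarlemanWeight a ψ ρ b b' n n' x₀) {α β : ℝ} (hα : 0 ≤ α)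
    (hβ : β ≤ 1) (hx₀ : x₀ ∉ Ioo α β) : LocAC α β ψ ρ := by
  have hsub : ∀ x ∈ Ioo α β, x ∈ Ioo (0 : ℝ) 1 ∧ x ≠ x₀ := fun x hx =>
    ⟨⟨hα.trans_lt hx.1, hx.2.trans_le hβ⟩, fun h => hx₀ (h ▸ hx)⟩
  exact LocAC.of_hasDerivAt (fun x hx => h.psi_deriv x (hsub x hx).1 (hsub x hx).2)
    (h.rho_cont.mono fun x hx => ⟨Ioo_subset_Icc_self (hsub x hx).1, (hsub x hx).2⟩)

lemma locAC_b (h : CarlemanWeight a ψ ρ b b' n n' x₀) {α β : ℝ} : LocAC α β b b' :=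
  LocAC.of_hasDerivAt (fun x _ => h.b_deriv x) h.b'_cont.continuousOn

variable {u ux uxx ut utx : ℝ → ℝ} {k k₁ α β : ℝ}

lemma locAC_w (h : CarlemanWeight a ψ ρ b b' n n' x₀) (hα : 0 ≤ α) (hβ : β ≤ 1)
    (hx₀ : x₀ ∉ Ioo α β) (hu : LocAC α β u ux) :
    LocAC α β (fun x => Real.exp (k * ψ x) * u x)
      (fun x => conjX (Real.exp (k * ψ x)) k (ρ x) (u x) (ux x)) := by
  refine ((h.locAC_exp k hα hβ hx₀).mul hu).congr_deriv (Eventually.of_forall fun x => ?_)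
  unfold conjX; ring

lemma locAC_conjX (h : CarlemanWeight a ψ ρ b b' n n' x₀) (hα : 0 ≤ α) (hβ : β ≤ 1)
    (hx₀ : x₀ ∉ Ioo α β) (hu : LocAC α β u ux) (hux : LocAC α β ux uxx) :
    LocAC α β (fun x => conjX (Real.exp (k * ψ x)) k (ρ x) (u x) (ux x))
      (fun x => conjXX (Real.exp (k * ψ x)) k (ρ x) (n x / a x) (u x) (ux x) (uxx x)) := by
  unfold conjX
  refine ((h.locAC_exp k hα hβ hx₀).mul (hux.add
    (((h.rho_ac α β hα hβ hx₀).const_mul k).mul hu))).congr_deriv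
    (Eventually.of_forall fun x => ?_)
  simp only [conjXX]; ring

lemma locAC_conjT (h : CarlemanWeight a ψ ρ b b' n n' x₀) (hα : 0 ≤ α) (hβ : β ≤ 1)
    (hx₀ : x₀ ∉ Ioo α β) (hu : LocAC α β u ux) (hut : LocAC α β ut utx) :
    LocAC α β (fun x => conjT (Real.exp (k * ψ x)) k₁ (ψ x) (u x) (ut x))
      (fun x => conjTX (Real.exp (k * ψ x)) k k₁ (ψ x) (ρ x) (u x) (ux x) (ut x) (utx x)) := by
  unfold conjT
  refine ((h.locAC_exp k hα hβ hx₀).mul (hut.add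
    (((h.locAC_psi hα hβ hx₀).const_mul k₁).mul hu))).congr_deriv
    (Eventually.of_forall fun x => ?_)
  simp only [conjTX]; ring

lemma locAC_spaceFlux (h : CarlemanWeight a ψ ρ b b' n n' x₀) (hα : 0 ≤ α) (hβ : β ≤ 1)
    (hx₀ : x₀ ∉ Ioo α β) {w p r z y : ℝ → ℝ} (hw : LocAC α β w p) (hp : LocAC α β p z)
    (hr : LocAC α β r y) :
    LocAC α β (fun x => spaceFlux (ψ x) (ρ x) (b x) (n x) k k₁ (w x) (p x) (r x))
      (fun x => spaceFluxDeriv (a x) (ψ x) (ρ x) (b x) (b' x) (n x) (n' x) k k₁ (w x) (p x) (r x)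
        (z x) (y x)) := by
  have hn : LocAC α β n n' := h.n_ac.mono hα hβ
  have hρ := h.rho_ac α β hα hβ hx₀
  have hψ := h.locAC_psi hα hβ hx₀
  have hb : LocAC α β b b' := h.locAC_b
  unfold spaceFlux
  refine (((((hp.mul hr).sub ((hb.const_mul k).mul hp.sq)).sub
    (((hn.const_mul k).mul hw).mul hp)).add
    (((hψ.mul hρ).mul hw.sq).const_mul (k * k₁))).sub
    (((hb.mul hρ.sq).mul hw.sq).const_mul (k ^ 3))).congr_deriv
    (Eventually.of_forall fun x => ?_)
  simp only [spaceFluxDeriv]; ring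

/-- The `x`-integral of the divergence is the flux through the boundary. -/
lemma integral_spaceFluxDeriv (h : CarlemanWeight a ψ ρ b b' n n' x₀)
    (hu : IsACWithDeriv 0 1 u ux) (hux : IsACWithDeriv 0 1 ux uxx) (hut : IsACWithDeriv 0 1 ut utx)
    (hu0 : u 0 = 0) (hu1 : u 1 = 0) (hut0 : ut 0 = 0) (hut1 : ut 1 = 0)
    (hρu : Tendsto (fun x => ρ x * u x) (𝓝[≠] x₀) (𝓝 0)) {F : ℝ → ℝ}
    (hF : ∀ᵐ x ∂(volume.restrict (Ioo (0 : ℝ) 1)), F x =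
      spaceFluxDeriv (a x) (ψ x) (ρ x) (b x) (b' x) (n x) (n' x) k k₁
        (Real.exp (k * ψ x) * u x) (conjX (Real.exp (k * ψ x)) k (ρ x) (u x) (ux x))
        (conjT (Real.exp (k * ψ x)) k₁ (ψ x) (u x) (ut x))
        (conjXX (Real.exp (k * ψ x)) k (ρ x) (n x / a x) (u x) (ux x) (uxx x))
        (conjTX (Real.exp (k * ψ x)) k k₁ (ψ x) (ρ x) (u x) (ux x) (ut x) (utx x)))
    (hint : IntegrableOn F (Ioo 0 1)) :
    ∫ x in Ioo 0 1, F x =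
      -(k * b 1 * (Real.exp (k * ψ 1) * ux 1) ^ 2) + k * b 0 * (Real.exp (k * ψ 0) * ux 0) ^ 2 := by
  have hac : ∀ α β : ℝ, 0 ≤ α → β ≤ 1 → x₀ ∉ Ioo α β → _ := fun α β hα hβ hx₀ =>
    h.locAC_spaceFlux (k := k) (k₁ := k₁) hα hβ hx₀
      (h.locAC_w (k := k) hα hβ hx₀ (hu.locAC.mono hα hβ))
      (h.locAC_conjX hα hβ hx₀ (hu.locAC.mono hα hβ) (hux.locAC.mono hα hβ))
      (h.locAC_conjT (k := k) (k₁ := k₁) hα hβ hx₀ (hu.locAC.mono hα hβ) (hut.locAC.mono hα hβ))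
  have cu := hu.continuousOn zero_le_one
  have cux := hux.continuousOn zero_le_one
  have cut := hut.continuousOn zero_le_one
  have cψ := h.psi_cont
  have cn := h.n_cont
  have cb := h.b_cont
  rw [integral_congr_ae hF]
  have hend : ∀ y ∈ Icc (0 : ℝ) 1, y ≠ x₀ → ContinuousWithinAt (fun x =>
      spaceFlux (ψ x) (ρ x) (b x) (n x) k k₁ (Real.exp (k * ψ x) * u x)
      (conjX (Real.exp (k * ψ x)) k (ρ x) (u x) (ux x))
      (conjT (Real.exp (k * ψ x)) k₁ (ψ x) (u x) (ut x))) (Icc 0 1) y := by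
    intro y hy hne
    have cρ : ContinuousWithinAt ρ (Icc 0 1) y := by
      have : ρ = fun x => b x / a x := funext h.rho_eq
      rw [this]
      exact (cb.continuousWithinAt).div (h.a_cont y hy) (h.a_pos y hy hne).ne'
    have cu' := cu y hy
    have cux' := cux y hy
    have cut' := cut y hy
    have cψ' := cψ y hy
    have cn' := cn y hy
    have cb' : ContinuousWithinAt b (Icc 0 1) y := cb.continuousWithinAt
    unfold spaceFlux conjX conjT
    fun_prop
  -- At the lateral boundary `w` and `w_t` vanish, so only the term `-k b w_x²` of the flux
  -- survives.
  have hval : ∀ y, u y = 0 → ut y = 0 →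
      spaceFlux (ψ y) (ρ y) (b y) (n y) k k₁ (Real.exp (k * ψ y) * u y)
      (conjX (Real.exp (k * ψ y)) k (ρ y) (u y) (ux y))
      (conjT (Real.exp (k * ψ y)) k₁ (ψ y) (u y) (ut y)) =
      -(k * b y * (Real.exp (k * ψ y) * ux y) ^ 2) := by
    intro y h1 h2
    unfold spaceFlux conjX conjT
    rw [h1, h2]; ring
  have lim0 := (hend 0 (by simp) h.mem.1.ne).mono_left (show 𝓝[>] (0 : ℝ) ≤ _ by
        rw [← nhdsWithin_Ioo_eq_nhdsGT zero_lt_one]; exact nhdsWithin_mono _ Ioo_subset_Icc_self)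
  have lim1 := (hend 1 (by simp) h.mem.2.ne').mono_left (show 𝓝[<] (1 : ℝ) ≤ _ by
        rw [← nhdsWithin_Ioo_eq_nhdsLT zero_lt_one]; exact nhdsWithin_mono _ Ioo_subset_Icc_self)
  beta_reduce at lim0 lim1
  rw [hval 0 hu0 hut0] at lim0
  rw [hval 1 hu1 hut1] at lim1
  -- The flux involves the singular factor `ρ` only through `ρ u`, which tends to zero; all other
  -- ingredients are continuous at `x₀`. Hence the one-sided limits agree and `x₀` contributes
  -- nothing.
  obtain ⟨L, hL⟩ : ∃ L, Tendsto (fun x =>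
      spaceFlux (ψ x) (ρ x) (b x) (n x) k k₁ (Real.exp (k * ψ x) * u x)
      (conjX (Real.exp (k * ψ x)) k (ρ x) (u x) (ux x))
      (conjT (Real.exp (k * ψ x)) k₁ (ψ x) (u x) (ut x))) (𝓝[≠] x₀) (𝓝 L) := by
    have tu := ContinuousOn.tendsto_interior cu h.mem
    have tux := ContinuousOn.tendsto_interior cux h.mem
    have tut := ContinuousOn.tendsto_interior cut h.mem
    have tψ := ContinuousOn.tendsto_interior cψ h.mem
    have tn := ContinuousOn.tendsto_interior cn h.mem
    have tb := ContinuousOn.tendsto_interior (cb.continuousOn (s := Icc 0 1)) h.mem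
    have te : Tendsto (fun x => Real.exp (k * ψ x)) (𝓝[≠] x₀) (𝓝 (Real.exp (k * ψ x₀))) :=
      (Real.continuous_exp.tendsto _).comp (tψ.const_mul k)
    have tw := te.mul tu
    have tp := te.mul (tux.add (hρu.const_mul k))
    have tr := te.mul (tut.add ((tψ.const_mul k₁).mul tu))
    have tρw := te.mul hρu
    have := ((((tp.mul tr).sub ((tb.const_mul k).mul (tp.pow 2))).sub
      (((tn.const_mul k).mul tw).mul tp)).add (((tψ.mul tρw).mul tw).const_mul (k * k₁))).sub
      ((tb.mul (tρw.pow 2)).const_mul (k ^ 3))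
    refine ⟨_, this.congr fun x => ?_⟩
    unfold spaceFlux conjX conjT
    ring
  have hint' := hint.congr_fun_ae hF
  rw [LocAC.integral_eq_of_split h.mem (hac 0 x₀ le_rfl h.mem.2.le (by simp))
    (hac x₀ 1 h.mem.1.le le_rfl (by simp)) hint' lim0 hL lim1]
  ring

end CarlemanWeight

end

section

/-! ### Integrability of the terms of the identity on the cylinder -/

/-- `w = e^{sφ} v` as a function on the cylinder. -/
def cylW (T s : ℝ) (ψ : ℝ → ℝ) (v : ℝ → ℝ → ℝ) (p : ℝ × ℝ) : ℝ :=
  Real.exp (s * Theta T p.1 * ψ p.2) * v p.1 p.2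

/-- `w_x` on the cylinder. -/
def cylX (T s : ℝ) (ψ ρ : ℝ → ℝ) (v vx : ℝ → ℝ → ℝ) (p : ℝ × ℝ) : ℝ :=
  conjX (Real.exp (s * Theta T p.1 * ψ p.2)) (s * Theta T p.1) (ρ p.2) (v p.1 p.2) (vx p.1 p.2)

/-- `w_t` on the cylinder. -/
def cylT (T s : ℝ) (ψ : ℝ → ℝ) (v vt : ℝ → ℝ → ℝ) (p : ℝ × ℝ) : ℝ :=
  conjT (Real.exp (s * Theta T p.1 * ψ p.2)) (s * thetaDeriv T p.1) (ψ p.2) (v p.1 p.2)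
    (vt p.1 p.2)

/-- `w_xx` on the cylinder. -/
def cylXX (T s : ℝ) (a ψ ρ n : ℝ → ℝ) (v vx vxx : ℝ → ℝ → ℝ) (p : ℝ × ℝ) : ℝ :=
  conjXX (Real.exp (s * Theta T p.1 * ψ p.2)) (s * Theta T p.1) (ρ p.2) (n p.2 / a p.2)
    (v p.1 p.2) (vx p.1 p.2) (vxx p.1 p.2)

/-- `w_tx` on the cylinder. -/
def cylTX (T s : ℝ) (ψ ρ : ℝ → ℝ) (v vx vt vtx : ℝ → ℝ → ℝ) (p : ℝ × ℝ) : ℝ :=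
  conjTX (Real.exp (s * Theta T p.1 * ψ p.2)) (s * Theta T p.1) (s * thetaDeriv T p.1) (ψ p.2)
    (ρ p.2) (v p.1 p.2) (vx p.1 p.2) (vt p.1 p.2) (vtx p.1 p.2)

namespace CarlemanWeight

variable {a ψ ρ b b' n n' : ℝ → ℝ} {x₀ T s : ℝ} {v vx vxx vt vtx : ℝ → ℝ → ℝ}

lemma a_nonneg (h : CarlemanWeight a ψ ρ b b' n n' x₀) {x : ℝ} (hx : x ∈ Icc (0 : ℝ) 1) :
    0 ≤ a x := by
  rcases eq_or_ne x x₀ with rfl | hne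
  · exact h.a_zero.ge
  · exact (h.a_pos x hx hne).le

lemma ae_pos (h : CarlemanWeight a ψ ρ b b' n n' x₀) :
    ∀ᵐ x ∂(volume.restrict (Ioo (0 : ℝ) 1)), 0 < a x := by
  filter_upwards [ae_ne_of_restrict x₀ _, ae_restrict_mem measurableSet_Ioo] with x h1 h2
    using h.a_pos x (Ioo_subset_Icc_self h2) h1

lemma ae_volQ_pos (h : CarlemanWeight a ψ ρ b b' n n' x₀) (T : ℝ) :
    ∀ᵐ p ∂(volQ T), 0 < a p.2 := ae_volQ_of_ae_snd h.ae_pos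

lemma aestronglyMeasurable_sqrt (h : CarlemanWeight a ψ ρ b b' n n' x₀) :
    AEStronglyMeasurable (fun x => Real.sqrt (a x)) (volume.restrict (Ioo (0 : ℝ) 1)) :=
  ((Real.continuous_sqrt.comp_continuousOn h.a_cont).mono
    Ioo_subset_Icc_self).aestronglyMeasurable measurableSet_Ioo

/-- `ρ = b/a` may be unbounded at `x₀`. Writing `ρ y = (b/√a)(y/√a)` trades it for a bounded
coefficient and a weight under which `y` is square integrable. -/
lemma moderate_kappa (h : CarlemanWeight a ψ ρ b b' n n' x₀) :
    Moderate T (fun p => b p.2 / Real.sqrt (a p.2)) := by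
  obtain ⟨M, hM⟩ := h.b_sq
  refine Moderate.of_snd (f := fun x => b x / Real.sqrt (a x)) (N := Real.sqrt M)
    (h.b_cont.measurable.aemeasurable.div
      h.aestronglyMeasurable_sqrt.aemeasurable).aestronglyMeasurable ?_
  filter_upwards [ae_restrict_mem measurableSet_Ioo] with x hx
  refine Real.abs_le_sqrt ?_
  rw [div_pow, Real.sq_sqrt (h.a_nonneg (Ioo_subset_Icc_self hx))]
  exact hM x (Ioo_subset_Icc_self hx)

lemma moderate_n'_sqrt (h : CarlemanWeight a ψ ρ b b' n n' x₀) :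
    Moderate T (fun p => n' p.2 * Real.sqrt (a p.2)) := by
  obtain ⟨N, hN⟩ := h.n'_bound
  exact (Moderate.of_snd h.n_ac.aestronglyMeasurable hN).mul
    (Moderate.of_continuousOn (f := fun x => Real.sqrt (a x))
      (Real.continuous_sqrt.comp_continuousOn h.a_cont))

lemma moderate_bn (h : CarlemanWeight a ψ ρ b b' n n' x₀) :
    Moderate T (fun p => b' p.2 + n p.2) :=
  Moderate.of_continuousOn (f := fun x => b' x + n x) (h.b'_cont.continuousOn.add h.n_cont)

lemma memLp_div_sqrt (h : CarlemanWeight a ψ ρ b b' n n' x₀) {f : ℝ → ℝ → ℝ}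
    (hf : MemL2L2Inv a T f) : MemLp (fun p => f p.1 p.2 / Real.sqrt (a p.2)) 2 (volQ T) := by
  have hm : AEStronglyMeasurable (fun p : ℝ × ℝ => f p.1 p.2 / Real.sqrt (a p.2)) (volQ T) :=
    (hf.1.1.aemeasurable.div
      (aestronglyMeasurable_snd h.aestronglyMeasurable_sqrt).aemeasurable).aestronglyMeasurable
  rw [memLp_two_iff_integrable_sq hm]
  refine hf.2.congr ?_
  filter_upwards [h.ae_volQ_pos T] with p hp
  rw [div_pow, Real.sq_sqrt hp.le]

lemma memLp_sqrt_mul (h : CarlemanWeight a ψ ρ b b' n n' x₀) {f : ℝ → ℝ → ℝ}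
    (hf : MemL2L2Inv a T (fun t x => a x * f t x)) :
    MemLp (fun p => Real.sqrt (a p.2) * f p.1 p.2) 2 (volQ T) := by
  refine (h.memLp_div_sqrt hf).ae_eq ?_
  filter_upwards [h.ae_volQ_pos T] with p hp
  rw [mul_comm (a p.2), mul_div_assoc, Real.div_sqrt, mul_comm]

lemma rapid_exp (h : CarlemanWeight a ψ ρ b b' n n' x₀) (hs : 0 < s) {V : ℝ × ℝ → ℝ}
    (hV : MemLp V 2 (volQ T)) :
    RapidL2 T (fun p => Real.exp (s * Theta T p.1 * ψ p.2) * V p) := by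
  obtain ⟨c, hc, hψ⟩ := h.psi_neg
  exact RapidL2.exp_mul hs hc h.psi_cont hψ hV

lemma rho_sqrt (h : CarlemanWeight a ψ ρ b b' n n' x₀) {x : ℝ} (hx : 0 < a x) (y : ℝ) :
    ρ x * y = b x / Real.sqrt (a x) * (y / Real.sqrt (a x)) := by
  have h1 := Real.sqrt_pos.2 hx
  have h2 := Real.mul_self_sqrt hx.le
  rw [h.rho_eq, div_mul_div_comm, h2]
  ring

/-- Each derivative of `w` has its natural weight: `w/√a`, `w_x`, `w_t/√a`, `√a w_xx`, `w_tx`. In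
every product occurring below the weights match those of the coefficients, so integrability reduces
to the Cauchy–Schwarz inequality. -/
lemma rapid_w (h : CarlemanWeight a ψ ρ b b' n n' x₀) (hs : 0 < s) (hv : MemL2L2Inv a T v) :
    RapidL2 T (fun p => cylW T s ψ v p / Real.sqrt (a p.2)) := by
  refine (h.rapid_exp hs (h.memLp_div_sqrt hv)).congr (Eventually.of_forall fun p => ?_)
  simp only [cylW, mul_div_assoc]

lemma moderate_k (s T : ℝ) : Moderate T (fun p => s * Theta T p.1) :=
  (Moderate.const T s).mul (Moderate.theta T)

lemma moderate_k₁ (s T : ℝ) : Moderate T (fun p => s * thetaDeriv T p.1) :=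
  (Moderate.const T s).mul (Moderate.thetaDeriv T)

lemma moderate_k₂ (s T : ℝ) : Moderate T (fun p => s * thetaDeriv2 T p.1) :=
  (Moderate.const T s).mul (Moderate.thetaDeriv2 T)

lemma rapid_x (h : CarlemanWeight a ψ ρ b b' n n' x₀) (hs : 0 < s) (hv : MemL2L2Inv a T v)
    (hvx : MemL2L2 T vx) : RapidL2 T (cylX T s ψ ρ v vx) := by
  refine ((h.rapid_exp hs hvx).add (RapidL2.moderate_mul
    ((moderate_k s T).mul h.moderate_kappa) (h.rapid_w hs hv))).congr ?_
  filter_upwards [h.ae_volQ_pos T] with p hp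
  have := h.rho_sqrt hp (cylW T s ψ v p)
  rw [mul_assoc (s * Theta T p.1), ← this]
  unfold cylX conjX cylW
  ring

lemma rapid_t (h : CarlemanWeight a ψ ρ b b' n n' x₀) (hs : 0 < s) (hv : MemL2L2Inv a T v)
    (hvt : MemL2L2Inv a T vt) :
    RapidL2 T (fun p => cylT T s ψ v vt p / Real.sqrt (a p.2)) := by
  refine ((h.rapid_w hs hvt).add (RapidL2.moderate_mul
    ((moderate_k₁ s T).mul (Moderate.of_continuousOn h.psi_cont)) (h.rapid_w hs hv))).congr
    (Eventually.of_forall fun p => ?_)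
  simp only [cylT, conjT, cylW]
  ring

lemma rapid_xx (h : CarlemanWeight a ψ ρ b b' n n' x₀) (hs : 0 < s) (hv : MemL2L2Inv a T v)
    (hvx : MemL2L2 T vx) (hvxx : MemL2L2Inv a T (fun t x => a x * vxx t x)) :
    RapidL2 T (fun p => Real.sqrt (a p.2) * cylXX T s a ψ ρ n v vx vxx p) := by
  have hk := moderate_k s T
  have hκ : Moderate T _ := h.moderate_kappa
  refine ((((h.rapid_exp hs (h.memLp_sqrt_mul hvxx)).add (RapidL2.moderate_mul
    (((Moderate.const T 2).mul hk).mul hκ) (h.rapid_exp hs hvx))).add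
    (RapidL2.moderate_mul (hk.mul (Moderate.of_continuousOn h.n_cont)) (h.rapid_w hs hv))).add
    (RapidL2.moderate_mul ((hk.mul hk).mul (hκ.mul hκ)) (h.rapid_w hs hv))).congr ?_
  filter_upwards [h.ae_volQ_pos T] with p hp
  have h1 := Real.sqrt_pos.2 hp
  have h2 := Real.sq_sqrt hp.le
  simp only [cylXX, conjXX, cylW, h.rho_eq]
  set α := Real.sqrt (a p.2)
  rw [← h2]
  field_simp

lemma rapid_tx (h : CarlemanWeight a ψ ρ b b' n n' x₀) (hs : 0 < s) (hv : MemL2L2Inv a T v)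
    (hvx : MemL2L2 T vx) (hvt : MemL2L2Inv a T vt) (hvtx : MemL2L2 T vtx) :
    RapidL2 T (cylTX T s ψ ρ v vx vt vtx) := by
  have hk := moderate_k s T
  have hk₁ := moderate_k₁ s T
  have hκ : Moderate T _ := h.moderate_kappa
  have hψ : Moderate T _ := Moderate.of_continuousOn h.psi_cont
  refine (((((h.rapid_exp hs hvtx).add (RapidL2.moderate_mul (hk₁.mul hψ)
    (h.rapid_exp hs hvx))).add (RapidL2.moderate_mul (hk₁.mul hκ) (h.rapid_w hs hv))).add
    (RapidL2.moderate_mul (hk.mul hκ) (h.rapid_w hs hvt))).add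
    (RapidL2.moderate_mul ((hk.mul hk₁).mul (hψ.mul hκ)) (h.rapid_w hs hv))).congr ?_
  filter_upwards [h.ae_volQ_pos T] with p hp
  have h1 := Real.sqrt_pos.2 hp
  have h2 := Real.sq_sqrt hp.le
  simp only [cylTX, conjTX, cylW, h.rho_eq]
  set α := Real.sqrt (a p.2)
  rw [← h2]
  field_simp

/-- With `A` and `B` the two parts of the conjugated operator, the cross term is the product of
`A/√a` and `B/√a`, each square integrable against all powers of `Θ`. -/
lemma integrable_crossTerm (h : CarlemanWeight a ψ ρ b b' n n' x₀) (hs : 0 < s)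
    (hv : MemL2L2Inv a T v) (hvx : MemL2L2 T vx) (hvt : MemL2L2Inv a T vt)
    (hvxx : MemL2L2Inv a T (fun t x => a x * vxx t x)) :
    Integrable (fun p => crossTerm (a p.2) (ψ p.2) (ρ p.2) (b p.2) (n p.2) (s * Theta T p.1)
      (s * thetaDeriv T p.1) (cylW T s ψ v p) (cylX T s ψ ρ v vx p) (cylT T s ψ v vt p)
      (cylXX T s a ψ ρ n v vx vxx p)) (volQ T) := by
  have hk := moderate_k s T
  have hk₁ := moderate_k₁ s T
  have hκ : Moderate T _ := h.moderate_kappa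
  have hψ : Moderate T _ := Moderate.of_continuousOn h.psi_cont
  have hn : Moderate T _ := Moderate.of_continuousOn h.n_cont
  have hA := ((h.rapid_xx hs hv hvx hvxx).sub
    (RapidL2.moderate_mul (hk₁.mul hψ) (h.rapid_w hs hv))).add
    (RapidL2.moderate_mul ((hk.mul hk).mul (hκ.mul hκ)) (h.rapid_w hs hv))
  have hB := ((h.rapid_t hs hv hvt).sub (RapidL2.moderate_mul
    (((Moderate.const T 2).mul hk).mul hκ) (h.rapid_x hs hv hvx))).sub
    (RapidL2.moderate_mul (hk.mul hn) (h.rapid_w hs hv))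
  refine (hA.integrable_mul hB).congr ?_
  filter_upwards [h.ae_volQ_pos T] with p hp
  have h1 := Real.sqrt_pos.2 hp
  have h2 := Real.sq_sqrt hp.le
  simp only [crossTerm, h.rho_eq]
  -- Replacing `a` by `α²` makes the identity rational in `α`.
  set α := Real.sqrt (a p.2)
  rw [← h2]
  field_simp

lemma integrable_timeFluxDeriv (h : CarlemanWeight a ψ ρ b b' n n' x₀) (hs : 0 < s)
    (hv : MemL2L2Inv a T v) (hvx : MemL2L2 T vx) (hvt : MemL2L2Inv a T vt)
    (hvtx : MemL2L2 T vtx) :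
    Integrable (fun p => timeFluxDeriv (a p.2) (ψ p.2) (ρ p.2) (s * Theta T p.1)
      (s * thetaDeriv T p.1) (s * thetaDeriv2 T p.1) (cylW T s ψ v p) (cylX T s ψ ρ v vx p)
      (cylT T s ψ v vt p) (cylTX T s ψ ρ v vx vt vtx p)) (volQ T) := by
  have hk := moderate_k s T
  have hk₁ := moderate_k₁ s T
  have hk₂ := moderate_k₂ s T
  have hκ : Moderate T _ := h.moderate_kappa
  have hψ : Moderate T _ := Moderate.of_continuousOn h.psi_cont
  have hw := h.rapid_w hs hv
  have hr := h.rapid_t hs hv hvt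
  have hint := ((((((RapidL2.const_mul (-1) (h.rapid_x hs hv hvx)).integrable_mul
    (h.rapid_tx hs hv hvx hvt hvtx)).sub
    ((RapidL2.moderate_mul ((Moderate.const T (1 / 2)).mul (hk₂.mul hψ)) hw).integrable_mul
      hw)).sub
    ((RapidL2.moderate_mul (hk₁.mul hψ) hw).integrable_mul hr))).add
    ((RapidL2.moderate_mul ((hk.mul hk₁).mul (hκ.mul hκ)) hw).integrable_mul hw)).add
    ((RapidL2.moderate_mul ((hk.mul hk).mul (hκ.mul hκ)) hw).integrable_mul hr)
  refine hint.congr ?_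
  filter_upwards [h.ae_volQ_pos T] with p hp
  have h1 := Real.sqrt_pos.2 hp
  have h2 := Real.sq_sqrt hp.le
  simp only [timeFluxDeriv, h.rho_eq, Pi.add_apply, Pi.sub_apply]
  set α := Real.sqrt (a p.2)
  rw [← h2]
  field_simp

lemma integrable_bulkTerm (h : CarlemanWeight a ψ ρ b b' n n' x₀) (hs : 0 < s)
    (hv : MemL2L2Inv a T v) (hvx : MemL2L2 T vx) :
    Integrable (fun p => bulkTerm (a p.2) (ψ p.2) (ρ p.2) (b' p.2) (n p.2) (n' p.2)
      (s * Theta T p.1) (s * thetaDeriv T p.1) (s * thetaDeriv2 T p.1) (cylW T s ψ v p)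
      (cylX T s ψ ρ v vx p)) (volQ T) := by
  have hk := moderate_k s T
  have hk₁ := moderate_k₁ s T
  have hk₂ := moderate_k₂ s T
  have hκ : Moderate T _ := h.moderate_kappa
  have hψ : Moderate T _ := Moderate.of_continuousOn h.psi_cont
  have hw := h.rapid_w hs hv
  have hp := h.rapid_x hs hv hvx
  have hbn : Moderate T _ := h.moderate_bn
  have hn' : Moderate T _ := h.moderate_n'_sqrt
  have hint := ((((((RapidL2.moderate_mul (hk.mul hbn) hp).integrable_mul hp).add
    ((RapidL2.moderate_mul (hk.mul hn') hw).integrable_mul hp)).add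
    ((RapidL2.moderate_mul (((hk.mul (hk.mul hk)).mul hbn).mul (hκ.mul hκ)) hw).integrable_mul
      hw))).sub
    ((RapidL2.moderate_mul (((Moderate.const T 2).mul (hk.mul hk₁)).mul (hκ.mul hκ))
      hw).integrable_mul hw)).add
    ((RapidL2.moderate_mul ((Moderate.const T (1 / 2)).mul (hk₂.mul hψ)) hw).integrable_mul hw)
  refine hint.congr ?_
  filter_upwards [h.ae_volQ_pos T] with p hp
  have h1 := Real.sqrt_pos.2 hp
  have h2 := Real.sq_sqrt hp.le
  simp only [bulkTerm, h.rho_eq, Pi.add_apply, Pi.sub_apply]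
  set α := Real.sqrt (a p.2)
  rw [← h2]
  field_simp

lemma integrable_x_sq (h : CarlemanWeight a ψ ρ b b' n n' x₀) (hs : 0 < s)
    (hv : MemL2L2Inv a T v) (hvx : MemL2L2 T vx) (j : ℕ) :
    Integrable (fun p => (s * Theta T p.1) ^ j * cylX T s ψ ρ v vx p ^ 2) (volQ T) := by
  have hp := h.rapid_x hs hv hvx
  have : Moderate T (fun p => (s * Theta T p.1) ^ j) := by
    induction j with
    | zero => simpa using Moderate.const T 1
    | succ j ih => simpa only [pow_succ] using ih.mul (moderate_k s T)
  refine ((RapidL2.moderate_mul this hp).integrable_mul hp).congr (Eventually.of_forall fun p => ?_)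
  ring

lemma integrable_rho_w_sq (h : CarlemanWeight a ψ ρ b b' n n' x₀) (hs : 0 < s)
    (hv : MemL2L2Inv a T v) (j : ℕ) :
    Integrable (fun p => (s * Theta T p.1) ^ j * (ρ p.2 ^ 2 * cylW T s ψ v p ^ 2)) (volQ T) := by
  have hw := RapidL2.moderate_mul (h.moderate_kappa (T := T)) (h.rapid_w hs hv)
  have : Moderate T (fun p => (s * Theta T p.1) ^ j) := by
    induction j with
    | zero => simpa using Moderate.const T 1
    | succ j ih => simpa only [pow_succ] using ih.mul (moderate_k s T)
  refine ((RapidL2.moderate_mul this hw).integrable_mul hw).congr ?_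
  filter_upwards [h.ae_volQ_pos T] with p hp
  rw [← h.rho_sqrt hp]
  ring

lemma integrable_w_sq_div (h : CarlemanWeight a ψ ρ b b' n n' x₀) (hs : 0 < s)
    (hv : MemL2L2Inv a T v) : Integrable (fun p => cylW T s ψ v p ^ 2 / a p.2) (volQ T) := by
  refine (h.rapid_w hs hv).integrable_sq.congr ?_
  filter_upwards [h.ae_volQ_pos T] with p hp
  rw [div_pow, Real.sq_sqrt hp.le]

end CarlemanWeight

end

section

/-! ### Regularity in time of the space derivative -/

instance isFiniteMeasure_volQ (T : ℝ) : IsFiniteMeasure (volQ T) := by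
  rw [volQ_eq]; infer_instance

lemma ae_ae_swap_of_ae_prod {μ ν : Measure ℝ} [SFinite μ] [SFinite ν] {P : ℝ × ℝ → Prop}
    (h : ∀ᵐ p ∂(μ.prod ν), P p) : ∀ᵐ y ∂ν, ∀ᵐ x ∂μ, P (x, y) :=
  Measure.ae_ae_of_ae_prod (Measure.measurePreserving_swap.quasiMeasurePreserving.ae h)

lemma ae_eq_zero_of_primitive_eq_zero {f : ℝ → ℝ} (hf : IntegrableOn f (Ioo 0 1))
    (h : ∀ x ∈ Ioo (0 : ℝ) 1, ∫ y in Ioo 0 x, f y = 0) :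
    ∀ᵐ x ∂(volume.restrict (Ioo (0 : ℝ) 1)), f x = 0 := by
  have hII := (intervalIntegrable_iff_integrableOn_Ioo_of_le zero_le_one).2 hf
  rw [ae_restrict_iff' measurableSet_Ioo]
  filter_upwards [hII.ae_hasDerivAt_integral] with x hx hmem
  have h1 := hx (by rw [uIcc_of_le zero_le_one]; exact Ioo_subset_Icc_self hmem) 0 left_mem_uIcc
  have h2 : HasDerivAt (fun x => ∫ t in (0 : ℝ)..x, f t) 0 x := by
    refine (hasDerivAt_const x (0 : ℝ)).congr_of_eventuallyEq ?_
    filter_upwards [Ioo_mem_nhds hmem.1 hmem.2] with y hy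
    rw [intervalIntegral.integral_of_le hy.1.le, integral_Ioc_eq_integral_Ioo, h y hy]
  exact h1.unique h2

/-- The variable upper limit is encoded as the indicator of a measurable set in the product space,
so that joint measurability follows from that of parametric integrals. -/
lemma stronglyMeasurable_primitive {G : ℝ × ℝ → ℝ} (hG : StronglyMeasurable G) :
    StronglyMeasurable (fun p : ℝ × ℝ => ∫ τ in Ioo 0 p.1, G (τ, p.2)) := by
  have hS : MeasurableSet {q : (ℝ × ℝ) × ℝ | 0 < q.2 ∧ q.2 < q.1.1} :=
    (measurableSet_lt measurable_const measurable_snd).inter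
      (measurableSet_lt measurable_snd (measurable_fst.comp measurable_fst))
  have hm : StronglyMeasurable (fun q : (ℝ × ℝ) × ℝ => G (q.2, q.1.2)) :=
    hG.comp_measurable (measurable_snd.prodMk (measurable_snd.comp measurable_fst))
  have h := (hm.indicator hS).integral_prod_right' (ν := (volume : Measure ℝ))
  refine (iff_of_eq (congrArg _ (funext fun p => ?_))).1 h
  rw [← integral_indicator measurableSet_Ioo]
  refine integral_congr_ae (Eventually.of_forall fun τ => ?_)
  simp only [indicator, mem_ofPred_eq, mem_Ioo]

/-- The space derivative of a function in `H¹(0,T; 𝓗¹_{1/a}(0,1))` agrees almost everywhere with a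
function that is absolutely continuous in time, with derivative the mixed derivative. -/
lemma MemH1H1Inv.exists_time_primitive {a : ℝ → ℝ} {T : ℝ} (hT : 0 < T)
    {v vx vt vtx : ℝ → ℝ → ℝ} (h : MemH1H1Inv a T v vx vt vtx) :
    ∃ g : ℝ → ℝ → ℝ, (∀ᵐ p ∂(volQ T), vx p.1 p.2 = g p.1 p.2) ∧
      ∀ᵐ x ∂(volume.restrict (Ioo (0 : ℝ) 1)),
        IsACWithDeriv 0 T (fun t => g t x) (fun t => vtx t x) := by
  obtain ⟨⟨hv, -, hvx⟩, ⟨hvt, -, hvtx⟩, hac⟩ := h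
  set G : ℝ × ℝ → ℝ := hvtx.1.mk _ with hGdef
  have hGm : StronglyMeasurable G := hvtx.1.stronglyMeasurable_mk
  have hGe : ∀ᵐ p ∂(volQ T), vtx p.1 p.2 = G p := hvtx.1.ae_eq_mk
  have hGi : Integrable G (volQ T) :=
    (MemLp.integrable one_le_two hvtx).congr hGe
  have hGe' := hGe
  have hGi' := hGi
  rw [volQ_eq] at hGe' hGi'
  have hGt := Measure.ae_ae_of_ae_prod hGe'
  set J : ℝ → ℝ → ℝ := fun t y => ∫ τ in Ioo 0 t, G (τ, y) with hJ
  -- For a good time `t`, `∫₀ˣ v_x(t) = v(t, x)` and `v(t, x) - v(0, x) = ∫₀ᵗ v_t(τ, x) dτ = ∫₀ᵗ ∫₀ˣ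
  -- v_tx`; Fubini's theorem then exchanges the order.
  have key : ∀ t ∈ Ioo 0 T, IsACWithDeriv 0 1 (v t) (vx t) → v t 0 = 0 → ∀ x ∈ Ioo (0 : ℝ) 1,
      IntegrableOn (J t) (Ioo 0 1) ∧
      (∫ y in Ioo 0 x, vx t y) - v 0 x = ∫ y in Ioo 0 x, J t y := by
    intro t ht h1 h2 x hx
    have hsub : Integrable G ((volume.restrict (Ioo 0 t)).prod (volume.restrict (Ioo 0 1))) := by
      rw [Measure.prod_restrict] at hGi' ⊢
      exact hGi'.mono_measure (Measure.restrict_mono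
        (prod_mono (Ioo_subset_Ioo_right ht.2.le) le_rfl) le_rfl)
    refine ⟨hsub.integral_prod_right, ?_⟩
    have hsubx : Integrable G ((volume.restrict (Ioo 0 t)).prod (volume.restrict (Ioo 0 x))) := by
      rw [Measure.prod_restrict] at hsub ⊢
      exact hsub.mono_measure (Measure.restrict_mono
        (prod_mono le_rfl (Ioo_subset_Ioo_right hx.2.le)) le_rfl)
    rw [(h1.mono le_rfl hx.1.le hx.2.le).integral_eq hx.1.le, h2, sub_zero,
      ← ((hac x (Ioo_subset_Icc_self hx)).mono le_rfl ht.1.le ht.2.le).integral_eq ht.1.le]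
    have e : ∫ τ in Ioo 0 t, vt τ x = ∫ τ in Ioo 0 t, ∫ y in Ioo 0 x, G (τ, y) := by
      refine integral_congr_ae ?_
      filter_upwards [ae_restrict_of_ae_restrict_of_subset (Ioo_subset_Ioo_right ht.2.le) hvt,
        ae_restrict_of_ae_restrict_of_subset (Ioo_subset_Ioo_right ht.2.le) hGt] with τ h3 h4
      have e1 := (h3.2.1.1.mono le_rfl hx.1.le hx.2.le).integral_eq hx.1.le
      rw [h3.2.2.1, sub_zero] at e1
      rw [← e1]
      exact integral_congr_ae (ae_restrict_of_ae_restrict_of_subset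
        (Ioo_subset_Ioo_right hx.2.le) h4)
    rw [e]
    exact integral_integral_swap hsubx
  have hne : (ae (volume.restrict (Ioo 0 T))).NeBot := by
    rw [ae_neBot, Ne, Measure.restrict_eq_zero, Real.volume_Ioo]
    simpa using hT
  have hgood : ∀ᵐ t ∂(volume.restrict (Ioo 0 T)), t ∈ Ioo 0 T ∧
      IsACWithDeriv 0 1 (v t) (vx t) ∧ v t 0 = 0 := by
    filter_upwards [hv, ae_restrict_mem measurableSet_Ioo] with t h1 h2
      using ⟨h2, h1.2.1.1, h1.2.2.1⟩
  -- `v(0, ·)` is not known to be absolutely continuous in `x`. Subtracting the identity at one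
  -- fixed good time `t₁` eliminates it and shows that `v_x(t) - J(t)` is, up to null sets,
  -- independent of `t`.
  obtain ⟨t₁, ht₁, hac₁, hz₁⟩ := hgood.exists
  have hx2 : (1 / 2 : ℝ) ∈ Ioo (0 : ℝ) 1 := by norm_num
  have hJ₁ := (key t₁ ht₁ hac₁ hz₁ _ hx2).1
  have hvx₁ := hac₁.integrableOn zero_le_one
  have hDm : AEStronglyMeasurable (fun y => vx t₁ y - J t₁ y) (volume.restrict (Ioo 0 1)) :=
    (hvx₁.sub hJ₁).1
  set D := hDm.mk _ with hDdef
  have hD : ∀ᵐ y ∂(volume.restrict (Ioo 0 1)), vx t₁ y - J t₁ y = D y := hDm.ae_eq_mk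
  have hslice : ∀ᵐ t ∂(volume.restrict (Ioo 0 T)), ∀ᵐ y ∂(volume.restrict (Ioo 0 1)),
      vx t y = D y + J t y := by
    filter_upwards [hgood] with t ⟨ht, hact, hzt⟩
    have hJt := (key t ht hact hzt _ hx2).1
    have hvxt := hact.integrableOn zero_le_one
    have h0 := ae_eq_zero_of_primitive_eq_zero
      (f := fun y => (vx t y - J t y) - (vx t₁ y - J t₁ y)) ((hvxt.sub hJt).sub (hvx₁.sub hJ₁))
      fun x hx => by
        have hs : Ioo (0 : ℝ) x ⊆ Ioo 0 1 := Ioo_subset_Ioo_right hx.2.le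
        have e1 := (key t ht hact hzt x hx).2
        have e2 := (key t₁ ht₁ hac₁ hz₁ x hx).2
        have i1 := hvxt.mono_set hs
        have i2 := hJt.mono_set hs
        have i3 := hvx₁.mono_set hs
        have i4 := hJ₁.mono_set hs
        have e3 := integral_sub (i1.sub i2) (i3.sub i4)
        simp only [Pi.sub_apply] at e3
        rw [e3, integral_sub i1 i2, integral_sub i3 i4]
        linarith
    filter_upwards [h0, hD] with y h1 h2
    rw [← h2]; linarith
  refine ⟨fun t y => D y + ∫ τ in (0 : ℝ)..t, G (τ, y), ?_, ?_⟩
  · set H : ℝ × ℝ → ℝ := hvx.1.mk _ with hHdef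
    have hHm : StronglyMeasurable H := hvx.1.stronglyMeasurable_mk
    have hHe : ∀ᵐ p ∂(volQ T), vx p.1 p.2 = H p := hvx.1.ae_eq_mk
    have hHe' := hHe
    rw [volQ_eq] at hHe'
    have hgm : StronglyMeasurable (fun p : ℝ × ℝ => D p.2 + J p.1 p.2) :=
      (hDm.stronglyMeasurable_mk.comp_measurable measurable_snd).add
        (stronglyMeasurable_primitive hGm)
    -- An identity on almost every slice gives one almost everywhere on the cylinder only for a
    -- measurable set, hence the strongly measurable representatives `H`, `D` and `G`.
    have hset : MeasurableSet {p : ℝ × ℝ | H p = D p.2 + J p.1 p.2} :=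
      measurableSet_eq_fun hHm.measurable hgm.measurable
    have hall : ∀ᵐ p ∂(volQ T), H p = D p.2 + J p.1 p.2 := by
      rw [volQ_eq, Measure.ae_prod_iff_ae_ae hset]
      filter_upwards [hslice, Measure.ae_ae_of_ae_prod hHe'] with t h1 h2
      filter_upwards [h1, h2] with y h3 h4
      rw [← h3, ← h4]
    filter_upwards [hHe, hall, ae_volQ_mem T] with p h1 h2 h3
    rw [h1, h2, intervalIntegral.integral_of_le h3.1.1.le, integral_Ioc_eq_integral_Ioo]
  · have hswap : ∀ᵐ y ∂(volume.restrict (Ioo (0 : ℝ) 1)), ∀ᵐ t ∂(volume.restrict (Ioo 0 T)),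
        vtx t y = G (t, y) := ae_ae_swap_of_ae_prod hGe'
    filter_upwards [hGi'.prod_left_ae, hswap] with y h1 h2
    have hII : IntervalIntegrable (fun τ => G (τ, y)) volume 0 T :=
      (intervalIntegrable_iff_integrableOn_Ioo_of_le hT.le).2 h1
    refine ⟨?_, ?_⟩
    · have h3 := hII.absolutelyContinuousOnInterval_intervalIntegral left_mem_uIcc
      exact absolutelyContinuous_of_dist_le (C := 1) h3 fun s _ t _ => by simp
    · have h3 := hII.ae_hasDerivAt_integral
      filter_upwards [ae_restrict_of_ae h3, h2, ae_restrict_mem measurableSet_Ioo] with t h4 h5 h6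
      rw [h5]
      exact (h4 (by rw [uIcc_of_le hT.le]; exact Ioo_subset_Icc_self h6) 0 left_mem_uIcc).const_add _

end

section

/-! ### The contribution of the time derivative vanishes -/

lemma locAC_timeFlux {T s a ψ ρ : ℝ} {v vt g gt : ℝ → ℝ} (hv : LocAC 0 T v vt)
    (hg : LocAC 0 T g gt) :
    LocAC 0 T (fun t => timeFlux a ψ ρ (s * Theta T t) (s * thetaDeriv T t)
        (Real.exp (s * Theta T t * ψ) * v t)
        (conjX (Real.exp (s * Theta T t * ψ)) (s * Theta T t) ρ (v t) (g t)))
      (fun t => timeFluxDeriv a ψ ρ (s * Theta T t) (s * thetaDeriv T t) (s * thetaDeriv2 T t)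
        (Real.exp (s * Theta T t * ψ) * v t)
        (conjX (Real.exp (s * Theta T t * ψ)) (s * Theta T t) ρ (v t) (g t))
        (conjT (Real.exp (s * Theta T t * ψ)) (s * thetaDeriv T t) ψ (v t) (vt t))
        (conjTX (Real.exp (s * Theta T t * ψ)) (s * Theta T t) (s * thetaDeriv T t) ψ ρ (v t) (g t)
          (vt t) (gt t))) := by
  have hk : LocAC 0 T (fun t => s * Theta T t) (fun t => s * thetaDeriv T t) :=
    (LocAC.of_hasDerivAt (fun t ht => hasDerivAt_theta ht) (continuousOn_thetaDeriv T)).const_mul s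
  have hk₁ : LocAC 0 T (fun t => s * thetaDeriv T t) (fun t => s * thetaDeriv2 T t) :=
    (LocAC.of_hasDerivAt (fun t ht => hasDerivAt_thetaDeriv ht)
      (continuousOn_thetaDeriv2 T)).const_mul s
  have he : LocAC 0 T (fun t => Real.exp (s * Theta T t * ψ))
      (fun t => Real.exp (s * Theta T t * ψ) * (s * thetaDeriv T t * ψ)) := by
    refine LocAC.of_hasDerivAt
      (fun t ht => (((hasDerivAt_theta ht).const_mul s).mul_const ψ).exp) ?_
    have h1 := continuousOn_theta T
    have h2 := continuousOn_thetaDeriv T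
    fun_prop
  have hw := he.mul hv
  have hp := he.mul (hg.add ((hk.const_mul ρ).mul hv))
  have h := ((hp.sq.const_mul (-(1 / 2))).sub
    (((hk₁.const_mul (1 / 2 * ψ / a))).mul hw.sq)).add ((hk.sq.const_mul (1 / 2 * ρ ^ 2)).mul hw.sq)
  refine ⟨fun c d h1 h2 h3 => ?_, ?_⟩
  · have := h.1 c d h1 h2 h3
    refine absolutelyContinuous_of_dist_le (C := 1) this fun x _ y _ => le_of_eq ?_
    rw [one_mul]
    congr 1 <;> simp only [timeFlux, conjX] <;> ring
  · filter_upwards [h.2] with t ht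
    refine (ht.congr_of_eventuallyEq (Eventually.of_forall fun t => ?_)).congr_deriv ?_
    · simp only [timeFlux, conjX]; ring
    · simp only [timeFluxDeriv, conjX, conjT, conjTX]; ring

/-- The constant depends on `x` through `a`, `ρ` and `ψ`, and blow-up at `x₀` is harmless: the
limits in time are taken at fixed `x`. -/
lemma abs_timeFlux_le {T s a ψ ρ B B' t v g : ℝ} (ht : t ∈ Ioo 0 T) (hs : 0 < s) (ha : 0 < a)
    (hψ : ψ ≤ 0) (hv : |v| ≤ B) (hg : |g| ≤ B') :
    |timeFlux a ψ ρ (s * Theta T t) (s * thetaDeriv T t) (Real.exp (s * Theta T t * ψ) * v)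
      (conjX (Real.exp (s * Theta T t * ψ)) (s * Theta T t) ρ v g)| ≤
    (B' ^ 2 * T ^ 16 + 3 / 2 * s ^ 2 * ρ ^ 2 * B ^ 2 + 1 / 2 * s * (4 * T ^ 7) * |ψ| * B ^ 2 / a) *
      (Theta T t ^ 2 * Real.exp (s * Theta T t * ψ)) := by
  have hT : 0 < T := ht.1.trans ht.2
  have hθ := theta_pos ht
  have hθ1 := abs_thetaDeriv_le ht
  have hlow := theta_lower ht
  set θ := Theta T t
  set θ₁ := thetaDeriv T t
  set e := Real.exp (s * θ * ψ) with he
  have he0 : 0 < e := Real.exp_pos _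
  have he1 : e ≤ 1 := by
    rw [he, Real.exp_le_one_iff]
    exact mul_nonpos_of_nonneg_of_nonpos (by positivity) hψ
  have hee : e ^ 2 ≤ e := by nlinarith
  have hv2 : v ^ 2 ≤ B ^ 2 := by rw [← sq_abs]; exact pow_le_pow_left₀ (abs_nonneg _) hv 2
  have hg2 : g ^ 2 ≤ B' ^ 2 := by rw [← sq_abs]; exact pow_le_pow_left₀ (abs_nonneg _) hg 2
  -- The lower bound `Θ ≥ T⁻⁸` allows the term without `Θ` to be put under `Θ²`.
  have h1 : 1 ≤ T ^ 16 * θ ^ 2 := by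
    rw [div_le_iff₀ (by positivity)] at hlow
    have := pow_le_pow_left₀ zero_le_one hlow 2
    rw [one_pow] at this
    linarith [show (θ * T ^ 8) ^ 2 = T ^ 16 * θ ^ 2 by ring]
  have e1 : timeFlux a ψ ρ (s * θ) (s * θ₁) (e * v) (conjX e (s * θ) ρ v g) =
      e ^ 2 * (-(1 / 2) * (g + s * θ * ρ * v) ^ 2 - 1 / 2 * (s * θ₁) * ψ * v ^ 2 / a +
        1 / 2 * (s * θ) ^ 2 * ρ ^ 2 * v ^ 2) := by
    unfold timeFlux conjX; ring
  have b1 : |-(1 / 2) * (g + s * θ * ρ * v) ^ 2| ≤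
      (B' ^ 2 * T ^ 16 + s ^ 2 * ρ ^ 2 * B ^ 2) * θ ^ 2 := by
    have hn : |(-(1 / 2) : ℝ)| = 1 / 2 := by norm_num
    rw [abs_mul, abs_of_nonneg (sq_nonneg (g + s * θ * ρ * v)), hn]
    have q1 : 1 / 2 * (g + s * θ * ρ * v) ^ 2 ≤ g ^ 2 + s ^ 2 * θ ^ 2 * ρ ^ 2 * v ^ 2 := by
      nlinarith [sq_nonneg (g - s * θ * ρ * v)]
    have q2 : g ^ 2 ≤ B' ^ 2 * (T ^ 16 * θ ^ 2) :=
      hg2.trans (le_mul_of_one_le_right (sq_nonneg _) h1)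
    have q3 : s ^ 2 * θ ^ 2 * ρ ^ 2 * v ^ 2 ≤ s ^ 2 * θ ^ 2 * ρ ^ 2 * B ^ 2 := by gcongr
    linarith
  have b2 : |1 / 2 * (s * θ₁) * ψ * v ^ 2 / a| ≤
      1 / 2 * s * (4 * T ^ 7) * |ψ| * B ^ 2 / a * θ ^ 2 := by
    have hn : |(1 / 2 : ℝ)| = 1 / 2 := by norm_num
    rw [abs_div, abs_mul, abs_mul, abs_mul, abs_mul, hn, abs_of_pos hs, abs_of_pos ha,
      abs_of_nonneg (sq_nonneg v)]
    calc 1 / 2 * (s * |θ₁|) * |ψ| * v ^ 2 / a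
        ≤ 1 / 2 * (s * (4 * T ^ 7 * θ ^ 2)) * |ψ| * B ^ 2 / a := by gcongr
      _ = _ := by ring
  have b3 : |1 / 2 * (s * θ) ^ 2 * ρ ^ 2 * v ^ 2| ≤ 1 / 2 * s ^ 2 * ρ ^ 2 * B ^ 2 * θ ^ 2 := by
    rw [abs_of_nonneg (by positivity)]
    have : 1 / 2 * (s * θ) ^ 2 * ρ ^ 2 * v ^ 2 ≤ 1 / 2 * (s * θ) ^ 2 * ρ ^ 2 * B ^ 2 := by gcongr
    linarith
  rw [e1, abs_mul, abs_of_nonneg (sq_nonneg e)]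
  have b4 := (abs_add_le (-(1 / 2) * (g + s * θ * ρ * v) ^ 2 - 1 / 2 * (s * θ₁) * ψ * v ^ 2 / a)
    (1 / 2 * (s * θ) ^ 2 * ρ ^ 2 * v ^ 2))
  have b5 := abs_sub (-(1 / 2) * (g + s * θ * ρ * v) ^ 2) (1 / 2 * (s * θ₁) * ψ * v ^ 2 / a)
  calc e ^ 2 * _ ≤ e * ((B' ^ 2 * T ^ 16 + 3 / 2 * s ^ 2 * ρ ^ 2 * B ^ 2 +
        1 / 2 * s * (4 * T ^ 7) * |ψ| * B ^ 2 / a) * θ ^ 2) := by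
        refine mul_le_mul hee ?_ (abs_nonneg _) he0.le
        linarith
    _ = _ := by ring

namespace CarlemanWeight

variable {a ψ ρ b b' n n' : ℝ → ℝ} {x₀ T s : ℝ} {v vx vxx vt vtx : ℝ → ℝ → ℝ}

/-- Integrate in time first. For almost every `x`, `v_x` may be replaced by its version absolutely
continuous in time; then `v` and this version are bounded on `[0, T]` and the factor `e^{sΘψ}` kills
the flux at both ends. -/
lemma integral_timeFluxDeriv (h : CarlemanWeight a ψ ρ b b' n n' x₀) (hT : 0 < T) (hs : 0 < s)
    (hv : MemH1H1Inv a T v vx vt vtx) :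
    ∫ p, timeFluxDeriv (a p.2) (ψ p.2) (ρ p.2) (s * Theta T p.1)
      (s * thetaDeriv T p.1) (s * thetaDeriv2 T p.1) (cylW T s ψ v p) (cylX T s ψ ρ v vx p)
      (cylT T s ψ v vt p) (cylTX T s ψ ρ v vx vt vtx p) ∂(volQ T) = 0 := by
  have hint := h.integrable_timeFluxDeriv (T := T) hs hv.1.2.1 hv.1.2.2 hv.2.1.2.1 hv.2.1.2.2
  obtain ⟨g, hg, hgac⟩ := hv.exists_time_primitive hT
  rw [volQ_eq] at hint hg ⊢
  rw [integral_prod_symm _ hint]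
  have hg' : ∀ᵐ x ∂(volume.restrict (Ioo (0 : ℝ) 1)), ∀ᵐ t ∂(volume.restrict (Ioo 0 T)),
      vx t x = g t x := ae_ae_swap_of_ae_prod hg
  refine integral_eq_zero_of_ae ?_
  filter_upwards [hgac, hg', hint.prod_left_ae, h.ae_pos, ae_restrict_mem measurableSet_Ioo]
    with x h1 h2 h3 h4 h5
  have hvx := hv.2.2 x (Ioo_subset_Icc_self h5)
  have hac := locAC_timeFlux (s := s) (a := a x) (ψ := ψ x) (ρ := ρ x) hvx.locAC h1.locAC
  have hac' := hac.congr_deriv (g' := fun t => timeFluxDeriv (a x) (ψ x) (ρ x) (s * Theta T t)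
      (s * thetaDeriv T t) (s * thetaDeriv2 T t) (cylW T s ψ v (t, x)) (cylX T s ψ ρ v vx (t, x))
      (cylT T s ψ v vt (t, x)) (cylTX T s ψ ρ v vx vt vtx (t, x))) (by
    filter_upwards [h2] with t h6
    unfold cylW cylX cylT cylTX
    rw [h6])
  obtain ⟨B, hB⟩ := h1.1.exists_bound
  obtain ⟨B', hB'⟩ := hvx.1.exists_bound
  rw [uIcc_of_le hT.le] at hB hB'
  obtain ⟨c, hc, hψ⟩ := h.psi_neg
  have hψx := hψ x (Ioo_subset_Icc_self h5)
  have hbd := fun t (ht : t ∈ Ioo 0 T) => abs_timeFlux_le (ρ := ρ x) ht hs h4 (by linarith)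
    (hB' t (Ioo_subset_Icc_self ht)) (hB t (Ioo_subset_Icc_self ht))
  have hcτ : Continuous fun t : ℝ => t * (T - t) := by fun_prop
  have lim0 := tendsto_zero_of_le_theta_exp (l := 𝓝[>] 0) hs hc hψx (Ioo_mem_nhdsGT hT)
    (by simpa using (hcτ.tendsto 0).mono_left nhdsWithin_le_nhds) hbd
  have limT := tendsto_zero_of_le_theta_exp (l := 𝓝[<] T) hs hc hψx (Ioo_mem_nhdsLT hT)
    (by simpa using (hcτ.tendsto T).mono_left nhdsWithin_le_nhds) hbd
  have := hac'.integral_eq hT h3 lim0 limT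
  rw [sub_zero] at this
  exact this

end CarlemanWeight

end

section

/-! ### Coercivity of the bulk term -/

namespace CarlemanWeight

variable {a ψ ρ b b' n n' : ℝ → ℝ} {x₀ T : ℝ}

set_option maxHeartbeats 1000000 in
/-- For `s` large, the bulk term dominates the left-hand side of the estimate on every time slice on
which the weighted interpolation inequality holds. -/
lemma exists_bulkTerm_coercive (h : CarlemanWeight a ψ ρ b b' n n' x₀) (hT : 0 < T) {C : ℝ}
    (hC : 0 < C) : ∃ c s₀ : ℝ, 0 < c ∧ 0 < s₀ ∧ ∀ s, s₀ ≤ s → ∀ t ∈ Ioo 0 T, ∀ w p : ℝ → ℝ,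
      IntegrableOn (fun x => p x ^ 2) (Ioo 0 1) → IntegrableOn (fun x => w x ^ 2 / a x) (Ioo 0 1) →
      IntegrableOn (fun x => ρ x ^ 2 * w x ^ 2) (Ioo 0 1) →
      IntegrableOn (fun x => bulkTerm (a x) (ψ x) (ρ x) (b' x) (n x) (n' x) (s * Theta T t)
        (s * thetaDeriv T t) (s * thetaDeriv2 T t) (w x) (p x)) (Ioo 0 1) →
      (∀ l : ℝ, 0 < l → ∫ x in Ioo 0 1, w x ^ 2 / a x ≤ C * (l * (∫ x in Ioo 0 1, p x ^ 2) +
        l⁻¹ * ∫ x in Ioo 0 1, ρ x ^ 2 * w x ^ 2)) →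
      c * ∫ x in Ioo 0 1, (s * Theta T t * p x ^ 2 +
        (s * Theta T t) ^ 3 * (ρ x ^ 2 * w x ^ 2)) ≤
      ∫ x in Ioo 0 1, bulkTerm (a x) (ψ x) (ρ x) (b' x) (n x) (n' x) (s * Theta T t)
        (s * thetaDeriv T t) (s * thetaDeriv2 T t) (w x) (p x) := by
  obtain ⟨c₀, hc₀, hcoer⟩ := h.coercive
  obtain ⟨N, hN⟩ := h.n'_bound
  obtain ⟨Ψ, hΨ⟩ := isCompact_Icc.exists_bound_of_continuousOn h.psi_cont
  obtain ⟨A, hA⟩ := isCompact_Icc.exists_bound_of_continuousOn h.a_cont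
  have hA0 : 0 ≤ A := (norm_nonneg _).trans (hA 0 (by simp))
  have hΨ0 : 0 ≤ Ψ := (norm_nonneg _).trans (hΨ 0 (by simp))
  -- `D` gathers the coefficients of `sΘ² w²/a`: the first summand comes from Young's inequality on
  -- `k n' w w_x`, with `w² ≤ A w²/a` and `1 ≤ T⁸ Θ`; the second comes from `|Θ''| ≤ 28 T⁶ Θ²`.
  set D := 2 * N ^ 2 * A / c₀ * T ^ 8 + 1 / 2 * (28 * T ^ 6) * Ψ with hD
  have hD0 : 0 ≤ D := by positivity
  -- `ε` makes the gradient part of the interpolation at most `c₀/4`. Then `s₁` makes the other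
  -- part, of size `DC/ε`, at most `c₀ s²/8`.
  set ε := c₀ / (4 * (D * C + 1)) with hε
  have hε0 : 0 < ε := by positivity
  set s₁ := 8 * (D * C) / (ε * c₀) with hs₁
  have hs₁0 : 0 ≤ s₁ := by positivity
  -- The last entry of the maximum absorbs the `Θ'` term into the cubic one. The losses are `1/8 +
  -- 1/4` of the gradient coefficient and `1/8 + 1/8` of the cubic coefficient, so `c₀ / 2` remains.
  refine ⟨c₀ / 2, max 1 (max s₁ (16 * (4 * T ^ 7) / c₀)), by positivity,
    lt_max_of_lt_left one_pos, fun s hs t ht w p hp hwa hρw hbulk hI => ?_⟩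
  have hs1 : 1 ≤ s := (le_max_left _ _).trans hs
  have hs2 : s₁ ≤ s := (le_max_left _ _).trans ((le_max_right _ _).trans hs)
  have hs3 : 16 * (4 * T ^ 7) / c₀ ≤ s := (le_max_right _ _).trans ((le_max_right _ _).trans hs)
  have hs0 : 0 < s := by linarith
  have hθ := theta_pos ht
  have hθ1 := abs_thetaDeriv_le ht
  have hθ2 := abs_thetaDeriv2_le ht
  have hlow := theta_lower ht
  set θ := Theta T t
  set θ₁ := thetaDeriv T t
  set θ₂ := thetaDeriv2 T t
  have hθlow : 1 ≤ T ^ 8 * θ := by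
    rw [div_le_iff₀ (by positivity)] at hlow
    linarith
  set P := ∫ x in Ioo 0 1, p x ^ 2
  set Q := ∫ x in Ioo 0 1, ρ x ^ 2 * w x ^ 2
  set W := ∫ x in Ioo 0 1, w x ^ 2 / a x with hW
  have hP0 : 0 ≤ P := integral_nonneg fun x => sq_nonneg _
  have hQ0 : 0 ≤ Q := integral_nonneg fun x => by positivity
  have hW0 : 0 ≤ W := by
    refine integral_nonneg_of_ae ?_
    filter_upwards [h.ae_pos] with x hx
    have := sq_nonneg (w x)
    positivity
  have hpt : ∫ x in Ioo 0 1, (7 / 8 * c₀ * (s * θ) * p x ^ 2 +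
      (c₀ * (s * θ) ^ 3 - 2 * (s * θ) * (s * (4 * T ^ 7 * θ ^ 2))) * (ρ x ^ 2 * w x ^ 2) -
      D * (s * θ ^ 2) * (w x ^ 2 / a x)) ≤
      ∫ x in Ioo 0 1, bulkTerm (a x) (ψ x) (ρ x) (b' x) (n x) (n' x) (s * θ) (s * θ₁) (s * θ₂)
        (w x) (p x) := by
    refine integral_mono_ae (((hp.const_mul _).add (hρw.const_mul _)).sub (hwa.const_mul _))
      hbulk ?_
    filter_upwards [hcoer, hN, h.ae_pos, ae_restrict_mem measurableSet_Ioo] with x h1 h2 h3 h4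
    have h4' := Ioo_subset_Icc_self h4
    have hψx := hΨ x h4'
    have hax := hA x h4'
    rw [Real.norm_eq_abs] at hψx hax
    have hk : 0 < s * θ := by positivity
    have t1 : c₀ * (s * θ) * p x ^ 2 ≤ s * θ * (b' x + n x) * p x ^ 2 := by
      have : c₀ * (s * θ * p x ^ 2) ≤ (b' x + n x) * (s * θ * p x ^ 2) := by gcongr
      linarith
    have t2 : c₀ * (s * θ) ^ 3 * (ρ x ^ 2 * w x ^ 2) ≤
        (s * θ) ^ 3 * (b' x + n x) * ρ x ^ 2 * w x ^ 2 := by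
      have : c₀ * ((s * θ) ^ 3 * (ρ x ^ 2 * w x ^ 2)) ≤
        (b' x + n x) * ((s * θ) ^ 3 * (ρ x ^ 2 * w x ^ 2)) := by gcongr
      linarith
    have q0 : 0 ≤ w x ^ 2 / a x := by positivity
    have t3 : -(s * θ * (c₀ / 8 * p x ^ 2 + 2 * N ^ 2 / c₀ * w x ^ 2)) ≤ s * θ * n' x * w x * p x := by
      have q1 : (n' x) ^ 2 ≤ N ^ 2 := by
        rw [← sq_abs]; exact pow_le_pow_left₀ (abs_nonneg _) h2 2
      have q2 : c₀ / 8 * p x ^ 2 + 2 * (n' x) ^ 2 / c₀ * w x ^ 2 + n' x * w x * p x =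
          2 / c₀ * (c₀ / 4 * p x + n' x * w x) ^ 2 := by field_simp; ring
      have q3 : 0 ≤ 2 / c₀ * (c₀ / 4 * p x + n' x * w x) ^ 2 := by positivity
      have q4 : 2 * (n' x) ^ 2 / c₀ * w x ^ 2 ≤ 2 * N ^ 2 / c₀ * w x ^ 2 := by gcongr
      have q5 : 0 ≤ s * θ * (c₀ / 8 * p x ^ 2 + 2 * N ^ 2 / c₀ * w x ^ 2 + n' x * w x * p x) :=
        mul_nonneg hk.le (by linarith)
      linarith
    have t4 : s * θ * (2 * N ^ 2 / c₀ * w x ^ 2) ≤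
        2 * N ^ 2 * A / c₀ * T ^ 8 * (s * θ ^ 2) * (w x ^ 2 / a x) := by
      have q1 : w x ^ 2 ≤ A * (w x ^ 2 / a x) := by
        calc w x ^ 2 = a x * (w x ^ 2 / a x) := by field_simp
          _ ≤ A * (w x ^ 2 / a x) := by gcongr; exact (le_abs_self _).trans hax
      calc s * θ * (2 * N ^ 2 / c₀ * w x ^ 2)
          ≤ s * θ * (2 * N ^ 2 / c₀ * (A * (w x ^ 2 / a x))) := by gcongr
        _ ≤ s * θ * (2 * N ^ 2 / c₀ * (A * (w x ^ 2 / a x))) * (T ^ 8 * θ) :=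
            le_mul_of_one_le_right (by positivity) hθlow
        _ = _ := by ring
    have t5 : 2 * (s * θ) * (s * θ₁) * ρ x ^ 2 * w x ^ 2 ≤
        2 * (s * θ) * (s * (4 * T ^ 7 * θ ^ 2)) * (ρ x ^ 2 * w x ^ 2) := by
      have : 2 * (s * θ) * (s * θ₁) * (ρ x ^ 2 * w x ^ 2) ≤
        2 * (s * θ) * (s * (4 * T ^ 7 * θ ^ 2)) * (ρ x ^ 2 * w x ^ 2) := by
        gcongr; exact (le_abs_self _).trans hθ1
      linarith
    have t6 : -(1 / 2 * (28 * T ^ 6) * Ψ * (s * θ ^ 2) * (w x ^ 2 / a x)) ≤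
        1 / 2 * (s * θ₂) * ψ x * w x ^ 2 / a x := by
      have q1 : |θ₂ * ψ x| ≤ 28 * T ^ 6 * θ ^ 2 * Ψ := by
        rw [abs_mul]; gcongr
      have q2 := (abs_le.1 q1).1
      have q3 : -(28 * T ^ 6 * θ ^ 2 * Ψ) * (1 / 2 * s * (w x ^ 2 / a x)) ≤
          θ₂ * ψ x * (1 / 2 * s * (w x ^ 2 / a x)) := by gcongr
      have q4 : 1 / 2 * (s * θ₂) * ψ x * w x ^ 2 / a x =
        θ₂ * ψ x * (1 / 2 * s * (w x ^ 2 / a x)) := by ring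
      rw [q4]; linarith
    unfold bulkTerm
    rw [hD]
    linarith
  have e1 : ∫ x in Ioo 0 1, (7 / 8 * c₀ * (s * θ) * p x ^ 2 +
      (c₀ * (s * θ) ^ 3 - 2 * (s * θ) * (s * (4 * T ^ 7 * θ ^ 2))) * (ρ x ^ 2 * w x ^ 2) -
      D * (s * θ ^ 2) * (w x ^ 2 / a x)) = 7 / 8 * c₀ * (s * θ) * P +
      (c₀ * (s * θ) ^ 3 - 2 * (s * θ) * (s * (4 * T ^ 7 * θ ^ 2))) * Q - D * (s * θ ^ 2) * W := by
    have i1 := integral_sub ((hp.const_mul (7 / 8 * c₀ * (s * θ))).add (hρw.const_mul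
      (c₀ * (s * θ) ^ 3 - 2 * (s * θ) * (s * (4 * T ^ 7 * θ ^ 2))))) (hwa.const_mul (D * (s * θ ^ 2)))
    have i2 := integral_add (hp.const_mul (7 / 8 * c₀ * (s * θ))) (hρw.const_mul
      (c₀ * (s * θ) ^ 3 - 2 * (s * θ) * (s * (4 * T ^ 7 * θ ^ 2))))
    simp only [Pi.add_apply] at i1
    rw [i1, i2, integral_const_mul, integral_const_mul, integral_const_mul]
  have e2 : ∫ x in Ioo 0 1, (s * θ * p x ^ 2 + (s * θ) ^ 3 * (ρ x ^ 2 * w x ^ 2)) =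
      s * θ * P + (s * θ) ^ 3 * Q := by
    rw [integral_add (hp.const_mul _) (hρw.const_mul _), integral_const_mul, integral_const_mul]
  rw [e1] at hpt
  rw [e2]
  refine le_trans ?_ hpt
  -- With `l = ε/Θ`, the quantity `sΘ² ∫ w²/a` splits into `sΘ ∫ p²` and `sΘ³ ∫ ρ² w²`; the latter
  -- is smaller than the coercive term by a factor `s²`.
  have hI' := hI (ε / θ) (by positivity)
  rw [inv_div] at hI'
  have w1 : D * (s * θ ^ 2) * W ≤ c₀ / 4 * (s * θ * P) + c₀ / 8 * ((s * θ) ^ 3 * Q) := by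
    have r1 : D * C * ε ≤ c₀ / 4 := by
      rw [hε, mul_div_assoc', div_le_div_iff₀ (by positivity) (by positivity)]
      nlinarith
    have r2 : D * C / ε ≤ c₀ / 8 * s ^ 2 := by
      have : s₁ ≤ s ^ 2 := hs2.trans (by nlinarith)
      rw [hs₁, div_le_iff₀ (by positivity)] at this
      rw [div_le_iff₀ hε0]
      linarith
    calc D * (s * θ ^ 2) * W ≤ D * (s * θ ^ 2) * (C * (ε / θ * P + θ / ε * Q)) := by gcongr
      _ = (D * C * ε) * (s * θ * P) + (D * C / ε) * (s * θ ^ 3 * Q) := by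
          field_simp
      _ ≤ c₀ / 4 * (s * θ * P) + c₀ / 8 * s ^ 2 * (s * θ ^ 3 * Q) := by gcongr
      _ = _ := by ring
  have w2 : 2 * (s * θ) * (s * (4 * T ^ 7 * θ ^ 2)) * Q ≤ c₀ / 8 * ((s * θ) ^ 3 * Q) := by
    rw [div_le_iff₀ hc₀] at hs3
    calc 2 * (s * θ) * (s * (4 * T ^ 7 * θ ^ 2)) * Q
        = 2 * (4 * T ^ 7) * (s ^ 2 * θ ^ 3 * Q) := by ring
      _ ≤ (s * c₀ / 8) * (s ^ 2 * θ ^ 3 * Q) := by gcongr; linarith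
      _ = _ := by ring
  have w3 : 0 ≤ c₀ * (s * θ * P) := by positivity
  have w4 : 0 ≤ c₀ * ((s * θ) ^ 3 * Q) := by positivity
  linarith

end CarlemanWeight

/-! ### The concrete weight, and the behaviour at the degeneracy of functions of the energy space.
-/

variable {a m m' : ℝ → ℝ} {x₀ K : ℝ}

/-- The weight of the theorem satisfies the structural conditions. -/
lemma DegenerateCoefficient.carlemanWeight (ha : DegenerateCoefficient a m m' x₀ K)
    {R d₁ d₂ : ℝ} (hR : 0 < R) (hd₁ : 0 < d₁)
    (hd₂ : max ((1 - x₀) ^ 2 * Real.exp (R * (1 - x₀) ^ 2) / ((2 - K) * a 1))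
      (x₀ ^ 2 * Real.exp (R * x₀ ^ 2) / ((2 - K) * a 0)) < d₂) :
    CarlemanWeight a (psi a x₀ R d₁ d₂) (psiDeriv a x₀ R d₁) (drift x₀ R d₁) (driftDeriv x₀ R d₁)
      (curvature m x₀ R d₁) (curvatureDeriv m m' x₀ R d₁) x₀ where
  mem := ha.mem
  a_cont := ha.continuousOn
  a_zero := ha.zero
  a_pos := ha.pos
  psi_cont := ha.continuousOn_psi R d₁ d₂
  psi_deriv := fun _ hx hne => ha.hasDerivAt_psi R d₁ d₂ hx hne
  psi_neg := ha.exists_psi_le hR hd₁ hd₂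
  rho_eq := fun _ => rfl
  rho_cont := ha.continuousOn_psiDeriv R d₁
  rho_ac := fun _ _ => ha.locAC_psiDeriv R d₁
  b_deriv := hasDerivAt_drift x₀ R d₁
  b'_cont := continuous_driftDeriv x₀ R d₁
  b_zero := by simp [drift]
  n_ac := ha.locAC_curvature R d₁
  n_cont := ha.continuousOn_curvature R d₁
  n'_bound := by
    obtain ⟨N, hN⟩ := ha.reg_bound
    have hm := ha.reg.continuousOn zero_le_one
    obtain ⟨M, hM⟩ := isCompact_Icc.exists_bound_of_continuousOn
      (f := fun x => d₁ * Real.exp (R * (x - x₀) ^ 2) *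
        (2 * R * (x - x₀) * (1 + 2 * R * (x - x₀) ^ 2 - m x) + 4 * R * (x - x₀)))
      (s := Icc 0 1) (by fun_prop)
    obtain ⟨M', hM'⟩ := isCompact_Icc.exists_bound_of_continuousOn
      (f := fun x => d₁ * Real.exp (R * (x - x₀) ^ 2)) (s := Icc (0 : ℝ) 1) (by fun_prop)
    refine ⟨M + M' * N, ?_⟩
    filter_upwards [hN, ae_restrict_mem measurableSet_Ioo] with x h1 h2
    have h3 := hM x (Ioo_subset_Icc_self h2)
    have h4 := hM' x (Ioo_subset_Icc_self h2)
    rw [Real.norm_eq_abs] at h3 h4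
    have e : curvatureDeriv m m' x₀ R d₁ x = d₁ * Real.exp (R * (x - x₀) ^ 2) *
        (2 * R * (x - x₀) * (1 + 2 * R * (x - x₀) ^ 2 - m x) + 4 * R * (x - x₀)) -
        d₁ * Real.exp (R * (x - x₀) ^ 2) * m' x := by
      unfold curvatureDeriv; ring
    rw [e]
    refine (abs_sub _ _).trans (add_le_add h3 ?_)
    rw [abs_mul]
    exact mul_le_mul h4 h1 (abs_nonneg _) ((abs_nonneg _).trans h4)
  coercive := by
    have hK := sub_pos.2 ha.K_lt
    -- The sum is `d₁ e^{R(x - x₀)²} (2 + 4R(x - x₀)² - m)`, and `m ≤ K < 2` almost everywhere.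
    refine ⟨d₁ * (2 - K), by positivity, ?_⟩
    filter_upwards [ha.m_le] with x hx
    have e : driftDeriv x₀ R d₁ x + curvature m x₀ R d₁ x =
        d₁ * (Real.exp (R * (x - x₀) ^ 2) * (2 + 4 * R * (x - x₀) ^ 2 - m x)) := by
      unfold driftDeriv curvature; ring
    have h1 : 1 ≤ Real.exp (R * (x - x₀) ^ 2) := Real.one_le_exp (by positivity)
    have h2 : 2 - K ≤ 2 + 4 * R * (x - x₀) ^ 2 - m x := by
      have : 0 ≤ 4 * R * (x - x₀) ^ 2 := by positivity
      linarith
    rw [e]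
    gcongr
    calc 2 - K = 1 * (2 - K) := (one_mul _).symm
      _ ≤ _ := by gcongr
  b_sq := by
    obtain ⟨D, hD, hD'⟩ := ha.exists_sq_div_le
    obtain ⟨M', hM'⟩ := isCompact_Icc.exists_bound_of_continuousOn
      (f := fun x => (d₁ * Real.exp (R * (x - x₀) ^ 2)) ^ 2) (s := Icc (0 : ℝ) 1) (by fun_prop)
    refine ⟨M' * D, fun x hx => ?_⟩
    have h1 := hM' x hx
    have h2 := hD' x hx
    rw [Real.norm_eq_abs] at h1
    have h3 : |x - x₀| ^ (2 - K) ≤ 1 := Real.rpow_le_one (abs_nonneg _)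
      (by rw [abs_le]; constructor <;> linarith [hx.1, hx.2, ha.mem.1, ha.mem.2])
      (sub_pos.2 ha.K_lt).le
    have e : drift x₀ R d₁ x ^ 2 / a x =
        (d₁ * Real.exp (R * (x - x₀) ^ 2)) ^ 2 * ((x - x₀) ^ 2 / a x) := by
      unfold drift; ring
    rw [e]
    have h4 : 0 ≤ (x - x₀) ^ 2 / a x := div_nonneg (sq_nonneg _) (ha.nonneg hx)
    refine mul_le_mul ((le_abs_self _).trans h1) ?_ h4 ((abs_nonneg _).trans h1)
    nlinarith

/-- In the strongly degenerate case, the functions of `L²_{1/a}` vanish at the degeneracy. -/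
lemma DegenerateCoefficient.eq_zero_of_integrable (ha : DegenerateCoefficient a m m' x₀ K)
    (hK : 1 ≤ K) {u : ℝ → ℝ} (hu : ContinuousOn u (Icc 0 1))
    (hint : IntegrableOn (fun x => u x ^ 2 / a x) (Ioo 0 1)) : u x₀ = 0 := by
  obtain ⟨L, hL⟩ := ha.alt.resolve_left (not_lt.2 hK)
  -- If `u x₀ ≠ 0`, then near `x₀` the bound `a ≤ L |x - x₀|` gives `u²/a ≥ const / |x - x₀|`, which
  -- is not integrable.
  by_contra hne
  have hII := (intervalIntegrable_iff_integrableOn_Ioo_of_le zero_le_one).2 hint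
  refine not_intervalIntegrable_of_sub_inv_isBigO_punctured (c := x₀) ?_ zero_ne_one
    (by rw [uIcc_of_le zero_le_one]; exact Ioo_subset_Icc_self ha.mem) hII
  have hc : 0 < u x₀ ^ 2 / 2 := by positivity
  have htend := (ContinuousOn.tendsto_interior hu ha.mem).pow 2
  have hev := htend.eventually (lt_mem_nhds (show u x₀ ^ 2 / 2 < u x₀ ^ 2 by linarith))
  refine Asymptotics.IsBigO.of_bound (L / (u x₀ ^ 2 / 2)) ?_
  filter_upwards [hev, eventually_Icc_ne ha.mem] with x h1 h2
  have hax := ha.pos x h2.1 h2.2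
  have hd : 0 < |x - x₀| := abs_pos.2 (sub_ne_zero.2 h2.2)
  have hLx := hL x h2.1
  have hL0 : 0 < L := by
    by_contra hn
    have := mul_nonpos_of_nonpos_of_nonneg (not_lt.1 hn) hd.le
    linarith
  rw [norm_inv, norm_div, norm_pow, Real.norm_eq_abs, Real.norm_eq_abs, Real.norm_eq_abs, sq_abs,
    abs_of_pos hax, div_mul_div_comm, inv_eq_one_div, div_le_div_iff₀ hd (by positivity)]
  have h3 : u x₀ ^ 2 / 2 * a x ≤ u x ^ 2 * (L * |x - x₀|) := by gcongr
  linarith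

/-- `u` vanishes at `x₀`, and `u'` is continuous on `[0, 1]`, hence bounded; so `u` is Lipschitz. -/
lemma DegenerateCoefficient.exists_abs_le_mul (ha : DegenerateCoefficient a m m' x₀ K)
    (hK : 1 ≤ K) {u u' u'' : ℝ → ℝ} (hu : IsACWithDeriv 0 1 u u') (hu' : IsACWithDeriv 0 1 u' u'')
    (hint : IntegrableOn (fun x => u x ^ 2 / a x) (Ioo 0 1)) :
    ∃ B, ∀ x ∈ Icc (0 : ℝ) 1, |u x| ≤ B * |x - x₀| := by
  have h0 := ha.eq_zero_of_integrable hK (hu.continuousOn zero_le_one) hint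
  obtain ⟨B, hB⟩ := isCompact_Icc.exists_bound_of_continuousOn (hu'.continuousOn zero_le_one)
  have hB' : ∀ᵐ x ∂(volume.restrict (Ioo (0 : ℝ) 1)), |u' x| ≤ B := by
    filter_upwards [ae_restrict_mem measurableSet_Ioo] with x hx
      using hB x (Ioo_subset_Icc_self hx)
  refine ⟨B, fun x hx => ?_⟩
  rcases le_total x x₀ with hle | hle
  · have := hu.abs_sub_le hB' hx.1 hle ha.mem.2.le
    rw [h0, zero_sub, abs_neg] at this
    rwa [abs_of_nonpos (sub_nonpos.2 hle), neg_sub]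
  · have := hu.abs_sub_le hB' ha.mem.1.le hle hx.2
    rw [h0, sub_zero] at this
    rwa [abs_of_nonneg (sub_nonneg.2 hle)]

end

section

/-! ### The estimate for the conjugated function -/

namespace CarlemanWeight

variable {a ψ ρ b b' n n' : ℝ → ℝ} {x₀ T s : ℝ} {v vx vxx vt vtx : ℝ → ℝ → ℝ}

lemma integrable_energy (h : CarlemanWeight a ψ ρ b b' n n' x₀) (hs : 0 < s)
    (hv : MemL2L2Inv a T v) (hvx : MemL2L2 T vx) :
    Integrable (fun p => s * Theta T p.1 * cylX T s ψ ρ v vx p ^ 2 +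
      (s * Theta T p.1) ^ 3 * (ρ p.2 ^ 2 * cylW T s ψ v p ^ 2)) (volQ T) := by
  have h1 := h.integrable_x_sq hs hv hvx 1
  simp only [pow_one] at h1
  exact h1.add (h.integrable_rho_w_sq hs hv 3)

/-- For `s` large, the integral of the bulk term over the cylinder is coercive. -/
lemma exists_integral_bulkTerm_coercive (h : CarlemanWeight a ψ ρ b b' n n' x₀) (hT : 0 < T) {C : ℝ}
    (hC : 0 < C) : ∃ c s₀ : ℝ, 0 < c ∧ 0 < s₀ ∧ ∀ s, s₀ ≤ s → ∀ v vx : ℝ → ℝ → ℝ,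
      MemL2L2Inv a T v → MemL2L2 T vx →
      (∀ᵐ t ∂(volume.restrict (Ioo 0 T)), IntegrableOn (fun x => cylX T s ψ ρ v vx (t, x) ^ 2)
          (Ioo 0 1) → IntegrableOn (fun x => cylW T s ψ v (t, x) ^ 2 / a x) (Ioo 0 1) →
        IntegrableOn (fun x => ρ x ^ 2 * cylW T s ψ v (t, x) ^ 2) (Ioo 0 1) → ∀ l : ℝ, 0 < l →
        ∫ x in Ioo 0 1, cylW T s ψ v (t, x) ^ 2 / a x ≤
          C * (l * (∫ x in Ioo 0 1, cylX T s ψ ρ v vx (t, x) ^ 2) +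
          l⁻¹ * ∫ x in Ioo 0 1, ρ x ^ 2 * cylW T s ψ v (t, x) ^ 2)) →
      c * ∫ p, (s * Theta T p.1 * cylX T s ψ ρ v vx p ^ 2 +
        (s * Theta T p.1) ^ 3 * (ρ p.2 ^ 2 * cylW T s ψ v p ^ 2)) ∂(volQ T) ≤
      ∫ p, bulkTerm (a p.2) (ψ p.2) (ρ p.2) (b' p.2) (n p.2) (n' p.2)
        (s * Theta T p.1) (s * thetaDeriv T p.1) (s * thetaDeriv2 T p.1) (cylW T s ψ v p)
        (cylX T s ψ ρ v vx p) ∂(volQ T) := by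
  obtain ⟨c, s₀, hc, hs₀, hcoer⟩ := h.exists_bulkTerm_coercive hT hC
  refine ⟨c, s₀, hc, hs₀, fun s hss v vx hv hvx hI => ?_⟩
  have hs : 0 < s := hs₀.trans_le hss
  have i1 := h.integrable_x_sq hs hv hvx 0
  have i2 := h.integrable_rho_w_sq hs hv 0
  have i3 := h.integrable_w_sq_div hs hv
  have i4 := h.integrable_bulkTerm hs hv hvx
  have i5 := h.integrable_energy hs hv hvx
  simp only [pow_zero, one_mul] at i1 i2
  rw [volQ_eq] at i1 i2 i3 i4 i5 ⊢
  rw [integral_prod _ i4, integral_prod _ i5, ← integral_const_mul]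
  refine integral_mono_ae (i5.integral_prod_left.const_mul c) i4.integral_prod_left ?_
  filter_upwards [hI, i1.prod_right_ae, i2.prod_right_ae, i3.prod_right_ae, i4.prod_right_ae,
    ae_restrict_mem measurableSet_Ioo] with t h1 h2 h3 h4 h5 ht
  exact hcoer s hss t ht (fun x => cylW T s ψ v (t, x)) (fun x => cylX T s ψ ρ v vx (t, x))
    h2 h4 h3 h5 (h1 h2 h4 h3)

/-- The integral of the cross term is that of the bulk term, up to the flux through the lateral
boundary. -/
lemma integral_crossTerm (h : CarlemanWeight a ψ ρ b b' n n' x₀) (hT : 0 < T) (hs : 0 < s)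
    (hv : MemS2 a T v vx vxx vt vtx)
    (hρv : ∀ᵐ t ∂(volume.restrict (Ioo 0 T)),
      Tendsto (fun x => ρ x * v t x) (𝓝[≠] x₀) (𝓝 0)) :
    ∫ p, crossTerm (a p.2) (ψ p.2) (ρ p.2) (b p.2) (n p.2) (s * Theta T p.1)
      (s * thetaDeriv T p.1) (cylW T s ψ v p) (cylX T s ψ ρ v vx p) (cylT T s ψ v vt p)
      (cylXX T s a ψ ρ n v vx vxx p) ∂(volQ T) =
    (∫ t in Ioo 0 T, (-(s * Theta T t * b 1 * (Real.exp (s * Theta T t * ψ 1) * vx t 1) ^ 2) +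
      s * Theta T t * b 0 * (Real.exp (s * Theta T t * ψ 0) * vx t 0) ^ 2)) +
    ∫ p, bulkTerm (a p.2) (ψ p.2) (ρ p.2) (b' p.2) (n p.2) (n' p.2)
        (s * Theta T p.1) (s * thetaDeriv T p.1) (s * thetaDeriv2 T p.1) (cylW T s ψ v p)
        (cylX T s ψ ρ v vx p) ∂(volQ T) := by
  obtain ⟨hv1, hv2⟩ := hv
  have j1 := h.integrable_crossTerm hs hv1.1.2.1 hv1.1.2.2 hv1.2.1.2.1 hv2.2.2
  have j2 := h.integrable_timeFluxDeriv hs hv1.1.2.1 hv1.1.2.2 hv1.2.1.2.1 hv1.2.1.2.2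
  have j3 := h.integrable_bulkTerm hs hv1.1.2.1 hv1.1.2.2
  have htime := h.integral_timeFluxDeriv hT hs hv1
  -- The `x`-divergence inherits its integrability from the other three members of the identity, so
  -- it need not be checked term by term.
  have hF := (j1.sub j2).sub j3
  have e1 := integral_sub (j1.sub j2) j3
  have e2 := integral_sub j1 j2
  simp only [Pi.sub_apply] at e1 e2 hF
  rw [e2, htime, sub_zero] at e1
  rw [← sub_eq_iff_eq_add, ← e1]
  have hpos : ∀ᵐ p ∂(volQ T), 0 < a p.2 := h.ae_volQ_pos T
  rw [volQ_eq] at hF hpos ⊢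
  refine (integral_prod _ hF).trans (integral_congr_ae ?_)
  filter_upwards [hρv, hv2.1, hv1.2.1.1, hF.prod_right_ae, Measure.ae_ae_of_ae_prod hpos]
    with t t1 t2 t3 t4 t5
  refine h.integral_spaceFluxDeriv (k₁ := s * thetaDeriv T t) t2.1.2.1.1 t2.2.1 t3.2.1.1 t2.1.2.2.1
    t2.1.2.2.2 t3.2.2.1 t3.2.2.2 t1 ?_ t4
  filter_upwards [t5] with x hx
  have := crossTerm_eq (ψ := ψ x) (b' := b' x) (n := n x) (n' := n' x) (k := s * Theta T t)
    (k₁ := s * thetaDeriv T t) (k₂ := s * thetaDeriv2 T t) (w := cylW T s ψ v (t, x))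
    (p := cylX T s ψ ρ v vx (t, x)) (r := cylT T s ψ v vt (t, x))
    (z := cylXX T s a ψ ρ n v vx vxx (t, x)) (y := cylTX T s ψ ρ v vx vt vtx (t, x)) hx.ne'
    (h.rho_eq x)
  simp only [Pi.sub_apply]
  rw [this, sub_sub, add_assoc, add_sub_cancel_right]
  rfl

/-- The source of the estimate, `h² e^{2sφ} / a` for `h = v_t + a v_xx`. -/
lemma integrable_source (h : CarlemanWeight a ψ ρ b b' n n' x₀) (hs : 0 < s)
    (hvt : MemL2L2Inv a T vt) (hvxx : MemL2L2Inv a T (fun t x => a x * vxx t x)) :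
    Integrable (fun p => (vt p.1 p.2 + a p.2 * vxx p.1 p.2) ^ 2 *
      (Real.exp (s * Theta T p.1 * ψ p.2) ^ 2 / a p.2)) (volQ T) := by
  have hF := (h.rapid_exp hs (h.memLp_div_sqrt hvt)).add (h.rapid_exp hs (h.memLp_sqrt_mul hvxx))
  refine hF.integrable_sq.congr ?_
  filter_upwards [h.ae_volQ_pos T] with p hp
  have h1 := Real.sqrt_pos.2 hp
  have h2 := Real.sq_sqrt hp.le
  set α := Real.sqrt (a p.2)
  rw [← h2]
  field_simp

lemma two_mul_integral_crossTerm_le (h : CarlemanWeight a ψ ρ b b' n n' x₀) (hs : 0 < s)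
    (hv : MemL2L2Inv a T v) (hvx : MemL2L2 T vx) (hvt : MemL2L2Inv a T vt)
    (hvxx : MemL2L2Inv a T (fun t x => a x * vxx t x)) :
    2 * ∫ p, crossTerm (a p.2) (ψ p.2) (ρ p.2) (b p.2) (n p.2) (s * Theta T p.1)
      (s * thetaDeriv T p.1) (cylW T s ψ v p) (cylX T s ψ ρ v vx p) (cylT T s ψ v vt p)
      (cylXX T s a ψ ρ n v vx vxx p) ∂(volQ T) ≤
    ∫ p, (vt p.1 p.2 + a p.2 * vxx p.1 p.2) ^ 2 *
      (Real.exp (s * Theta T p.1 * ψ p.2) ^ 2 / a p.2) ∂(volQ T) := by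
  rw [← integral_const_mul]
  refine integral_mono_ae ((h.integrable_crossTerm hs hv hvx hvt hvxx).const_mul 2)
    (h.integrable_source hs hvt hvxx) ?_
  filter_upwards [h.ae_volQ_pos T] with p hp
  exact two_mul_crossTerm_le hp (h.rho_eq _)

/-- The integrand is the `x`-derivative of `b v_x²`, from which the traces of `v_x` at `x = 0` and
`x = 1` are recovered. -/
lemma integrable_flux_density (h : CarlemanWeight a ψ ρ b b' n n' x₀)
    (hvx : MemL2L2 T vx) (hvxx : MemL2L2Inv a T (fun t x => a x * vxx t x)) :
    Integrable (fun p => b' p.2 * vx p.1 p.2 ^ 2 + b p.2 * (2 * vx p.1 p.2 * vxx p.1 p.2))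
      (volQ T) := by
  obtain ⟨M, hM⟩ := isCompact_Icc.exists_bound_of_continuousOn
    (h.b'_cont.continuousOn (s := Icc (0 : ℝ) 1))
  obtain ⟨N, hN⟩ := h.b_sq
  have h1 : Integrable (fun p : ℝ × ℝ => b' p.2 * vx p.1 p.2 ^ 2) (volQ T) := by
    refine (MemLp.integrable_sq hvx).bdd_mul (c := M)
      (h.b'_cont.comp continuous_snd).aestronglyMeasurable ?_
    filter_upwards [ae_volQ_mem T] with p hp using hM _ (Ioo_subset_Icc_self hp.2)
  have h2 : Integrable (fun p : ℝ × ℝ => 2 * (b p.2 / Real.sqrt (a p.2)) *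
      (vx p.1 p.2 * (Real.sqrt (a p.2) * vxx p.1 p.2))) (volQ T) := by
    refine (MemLp.integrable_mul hvx (h.memLp_sqrt_mul hvxx)).bdd_mul (c := 2 * Real.sqrt N)
      (h.moderate_kappa.1.const_mul 2) ?_
    filter_upwards [ae_volQ_mem T] with p hp
    have hp2 := Ioo_subset_Icc_self hp.2
    rw [Real.norm_eq_abs, abs_mul, abs_two]
    gcongr
    refine Real.abs_le_sqrt ?_
    rw [div_pow, Real.sq_sqrt (h.a_nonneg hp2)]
    exact hN _ hp2
  refine h1.add (h2.congr ?_)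
  filter_upwards [h.ae_volQ_pos T] with p hp
  have h1 := Real.sqrt_pos.2 hp
  field_simp

/-- The normal derivative is square integrable on the lateral boundary. -/
lemma integrableOn_boundary (h : CarlemanWeight a ψ ρ b b' n n' x₀)
    (hv : MemL2H2Inv a T v vx vxx) :
    IntegrableOn (fun t => b 1 * vx t 1 ^ 2) (Ioo 0 T) ∧
      IntegrableOn (fun t => b 0 * vx t 0 ^ 2) (Ioo 0 T) := by
  have hG := h.integrable_flux_density hv.2.1.2.2 hv.2.2
  have hac : ∀ α β : ℝ, 0 ≤ α → α < β → β ≤ 1 → ∀ᵐ t ∂(volume.restrict (Ioo 0 T)),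
      ∫ x in Ioo α β, (b' x * vx t x ^ 2 + b x * (2 * vx t x * vxx t x)) =
        b β * vx t β ^ 2 - b α * vx t α ^ 2 := by
    intro α β hα hαβ hβ
    have hr : volQ T = (volume.restrict (Ioo 0 T)).prod (volume.restrict (Ioo (0 : ℝ) 1)) :=
      volQ_eq T
    rw [hr] at hG
    filter_upwards [hv.1, hG.prod_right_ae] with t ht ht'
    have hvx := ht.2.1
    have hc := hvx.continuousOn zero_le_one
    have hf : LocAC α β (fun x => b x * vx t x ^ 2) _ := (h.locAC_b).mul (hvx.locAC.mono hα hβ).sq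
    have hcf : ContinuousOn (fun x => b x * vx t x ^ 2) (Icc 0 1) :=
      h.b_cont.continuousOn.mul (hc.pow 2)
    have hsub : Ioo α β ⊆ Icc 0 1 := Ioo_subset_Icc_self.trans (Icc_subset_Icc hα hβ)
    refine hf.integral_eq hαβ (ht'.mono_measure
      (Measure.restrict_mono (Ioo_subset_Ioo hα hβ) le_rfl)) ?_ ?_
    · refine (hcf α ⟨hα, hαβ.le.trans hβ⟩).mono_left ?_
      rw [← nhdsWithin_Ioo_eq_nhdsGT hαβ]; exact nhdsWithin_mono _ hsub
    · refine (hcf β ⟨hα.trans hαβ.le, hβ⟩).mono_left ?_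
      rw [← nhdsWithin_Ioo_eq_nhdsLT hαβ]; exact nhdsWithin_mono _ hsub
  have hm : ∀ α β : ℝ, 0 ≤ α → β ≤ 1 → IntegrableOn (fun t =>
      ∫ x in Ioo α β, (b' x * vx t x ^ 2 + b x * (2 * vx t x * vxx t x))) (Ioo 0 T) := by
    intro α β hα hβ
    have : Integrable (fun p : ℝ × ℝ => b' p.2 * vx p.1 p.2 ^ 2 +
        b p.2 * (2 * vx p.1 p.2 * vxx p.1 p.2))
        ((volume.restrict (Ioo 0 T)).prod (volume.restrict (Ioo α β))) := by
      refine hG.mono_measure ?_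
      rw [Measure.prod_restrict]
      exact Measure.restrict_mono (prod_mono le_rfl (Ioo_subset_Ioo hα hβ)) le_rfl
    exact this.integral_prod_left
  -- Since `b` vanishes at `x₀`, integrating the derivative of `b v_x²` between `x₀` and an endpoint
  -- leaves the trace at that endpoint alone.
  constructor
  · refine (hm x₀ 1 h.mem.1.le le_rfl).congr ?_
    filter_upwards [hac x₀ 1 h.mem.1.le h.mem.2 le_rfl] with t ht
    rw [ht, h.b_zero]; ring
  · refine (hm 0 x₀ le_rfl h.mem.2.le).neg.congr ?_
    filter_upwards [hac 0 x₀ le_rfl h.mem.1 h.mem.2.le] with t ht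
    rw [Pi.neg_apply, ht, h.b_zero]; ring

lemma integrableOn_theta_exp_mul (h : CarlemanWeight a ψ ρ b b' n n' x₀) (hs : 0 < s) {y : ℝ}
    (hy : y ∈ Icc (0 : ℝ) 1) {f : ℝ → ℝ} (hf : IntegrableOn f (Ioo 0 T)) :
    IntegrableOn (fun t => Theta T t * Real.exp (s * Theta T t * ψ y) ^ 2 * f t) (Ioo 0 T) := by
  obtain ⟨c, hc, hψ⟩ := h.psi_neg
  have hm := measurable_theta T
  refine Integrable.bdd_mul (c := (Nat.factorial 1 : ℝ) / (s * c) ^ 1) hf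
    (by fun_prop) ?_
  filter_upwards [ae_restrict_mem measurableSet_Ioo] with t ht
  have h0 := theta_pos ht
  have h1 := theta_pow_mul_exp_le hs hc (hψ y hy) h0.le 1
  have h2 : Real.exp (s * Theta T t * ψ y) ≤ 1 := by
    rw [Real.exp_le_one_iff]
    exact mul_nonpos_of_nonneg_of_nonpos (by positivity) (by linarith [hψ y hy])
  rw [Real.norm_of_nonneg (by positivity)]
  refine le_trans ?_ h1
  rw [pow_one, sq]
  gcongr
  exact mul_le_of_le_one_right (Real.exp_pos _).le h2

end CarlemanWeight

end

section

/-! ### The Carleman estimate -/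

variable {a m m' : ℝ → ℝ} {x₀ K T R d₁ d₂ s : ℝ} {v vx vxx vt vtx : ℝ → ℝ → ℝ}

lemma sq_sub_div_eq (a : ℝ → ℝ) (x₀ R : ℝ) {d₁ : ℝ} (hd₁ : 0 < d₁) (x : ℝ) :
    ((x - x₀) / a x) ^ 2 =
      (d₁⁻¹ * Real.exp (-(R * (x - x₀) ^ 2))) ^ 2 * psiDeriv a x₀ R d₁ x ^ 2 := by
  rw [Real.exp_neg, ← mul_pow]
  have := Real.exp_pos (R * (x - x₀) ^ 2)
  unfold psiDeriv drift
  congr 1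
  field_simp

lemma sq_inv_mul_exp_le (x₀ x : ℝ) (hR : 0 < R) (hd₁ : 0 < d₁) :
    (d₁⁻¹ * Real.exp (-(R * (x - x₀) ^ 2))) ^ 2 ≤ (d₁⁻¹) ^ 2 := by
  have h : Real.exp (-(R * (x - x₀) ^ 2)) ≤ 1 := by
    rw [Real.exp_le_one_iff]
    have : 0 ≤ R * (x - x₀) ^ 2 := by positivity
    linarith
  have h0 := Real.exp_pos (-(R * (x - x₀) ^ 2))
  gcongr
  exact mul_le_of_le_one_right (by positivity) h

lemma DegenerateCoefficient.exists_abs_le_mul_of_memH2Inv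
    (ha : DegenerateCoefficient a m m' x₀ K) {u u' u'' : ℝ → ℝ} (hu : MemH2Inv a u u' u'')
    (hK : 1 ≤ K) : ∃ B, ∀ x ∈ Icc (0 : ℝ) 1, |u x| ≤ B * |x - x₀| :=
  ha.exists_abs_le_mul hK hu.1.2.1.1 hu.2.1 hu.1.1.2

lemma DegenerateCoefficient.tendsto_psiDeriv_mul (ha : DegenerateCoefficient a m m' x₀ K)
    (R d₁ : ℝ) {u u' u'' : ℝ → ℝ} (hu : MemH2Inv a u u' u'') :
    Tendsto (fun x => psiDeriv a x₀ R d₁ x * u x) (𝓝[≠] x₀) (𝓝 0) := by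
  have h1 := ha.tendsto_div_mul (hu.1.2.1.1.continuousOn zero_le_one)
    (ha.exists_abs_le_mul_of_memH2Inv hu)
  have h2 : Tendsto (fun x => d₁ * Real.exp (R * (x - x₀) ^ 2)) (𝓝[≠] x₀)
      (𝓝 (d₁ * Real.exp (R * (x₀ - x₀) ^ 2))) :=
    (Continuous.tendsto (by fun_prop) x₀).mono_left nhdsWithin_le_nhds
  have := h2.mul h1
  rw [mul_zero] at this
  refine this.congr fun x => ?_
  unfold psiDeriv drift
  ring

/-- The interpolation inequality for the conjugated function, on a time slice. -/
lemma DegenerateCoefficient.exists_interpolation_conj (ha : DegenerateCoefficient a m m' x₀ K)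
    (hR : 0 < R) (hd₁ : 0 < d₁)
    (hd₂ : max ((1 - x₀) ^ 2 * Real.exp (R * (1 - x₀) ^ 2) / ((2 - K) * a 1))
      (x₀ ^ 2 * Real.exp (R * x₀ ^ 2) / ((2 - K) * a 0)) < d₂) :
    ∃ C, 0 < C ∧ ∀ k : ℝ, 0 ≤ k → ∀ u u' u'' w p : ℝ → ℝ, MemH2Inv a u u' u'' →
      (w = fun x => Real.exp (k * psi a x₀ R d₁ d₂ x) * u x) →
      (p = fun x => conjX (Real.exp (k * psi a x₀ R d₁ d₂ x)) k (psiDeriv a x₀ R d₁ x) (u x)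
        (u' x)) →
      IntegrableOn (fun x => p x ^ 2) (Ioo 0 1) → IntegrableOn (fun x => w x ^ 2 / a x) (Ioo 0 1) →
      IntegrableOn (fun x => psiDeriv a x₀ R d₁ x ^ 2 * w x ^ 2) (Ioo 0 1) → ∀ l : ℝ, 0 < l →
      ∫ x in Ioo 0 1, w x ^ 2 / a x ≤ C * (l * (∫ x in Ioo 0 1, p x ^ 2) +
        l⁻¹ * ∫ x in Ioo 0 1, psiDeriv a x₀ R d₁ x ^ 2 * w x ^ 2) := by
  obtain ⟨C, hC, hI⟩ := ha.weighted_interpolation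
  have hW := ha.carlemanWeight hR hd₁ hd₂
  -- The factor accounts for the passage from `((x - x₀)/a)²` to `ψ'²`, since `|(x - x₀)/a| ≤ d₁⁻¹
  -- |ψ'|`.
  refine ⟨C * (1 + (d₁⁻¹) ^ 2), by positivity,
    fun k hk u u' u'' w p hu hw hp hp2 hwa hρw l hl => ?_⟩
  have hac := hu.1.2.1.1
  have hcu := hac.continuousOn zero_le_one
  obtain ⟨c, hc, hψ⟩ := hW.psi_neg
  have hle : ∀ x ∈ Icc (0 : ℝ) 1, Real.exp (k * psi a x₀ R d₁ d₂ x) ≤ 1 := fun x hx => by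
    rw [Real.exp_le_one_iff]
    exact mul_nonpos_of_nonneg_of_nonpos hk (by linarith [hψ x hx])
  have hlac : ∀ α β : ℝ, 0 ≤ α → β ≤ 1 → x₀ ∉ Ioo α β → LocAC α β w p := fun α β h0 h1 h2 => by
    rw [hw, hp]
    exact hW.locAC_w h0 h1 h2 (hac.locAC.mono h0 h1)
  have hcw : ContinuousOn w (Icc 0 1) := by
    have := hW.psi_cont
    rw [hw]; fun_prop
  have hw0 : w 0 = 0 := by simp [hw, hu.1.2.2.1]
  have hw1 : w 1 = 0 := by simp [hw, hu.1.2.2.2]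
  have hB : 1 ≤ K → ∃ B, ∀ x ∈ Icc (0 : ℝ) 1, |w x| ≤ B * |x - x₀| := fun hK => by
    obtain ⟨B, hB⟩ := ha.exists_abs_le_mul_of_memH2Inv hu hK
    refine ⟨B, fun x hx => le_trans ?_ (hB x hx)⟩
    rw [hw, abs_mul, Real.abs_exp]
    exact mul_le_of_le_one_left (abs_nonneg _) (hle x hx)
  have hint : IntegrableOn (fun x => ((x - x₀) / a x) ^ 2 * w x ^ 2) (Ioo 0 1) := by
    refine (Integrable.bdd_mul (c := (d₁⁻¹) ^ 2)
      (f := fun x => (d₁⁻¹ * Real.exp (-(R * (x - x₀) ^ 2))) ^ 2) hρw (by fun_prop) ?_).congr ?_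
    · refine Eventually.of_forall fun x => ?_
      rw [Real.norm_of_nonneg (sq_nonneg _)]
      exact sq_inv_mul_exp_le x₀ x hR hd₁
    · refine Eventually.of_forall fun x => ?_
      simp only
      rw [sq_sub_div_eq a x₀ R hd₁, mul_assoc]
  have hle2 : ∫ x in Ioo 0 1, ((x - x₀) / a x) ^ 2 * w x ^ 2 ≤
      (d₁⁻¹) ^ 2 * ∫ x in Ioo 0 1, psiDeriv a x₀ R d₁ x ^ 2 * w x ^ 2 := by
    rw [← integral_const_mul]
    refine integral_mono_ae hint (hρw.const_mul _) (Eventually.of_forall fun x => ?_)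
    simp only
    rw [sq_sub_div_eq a x₀ R hd₁, mul_assoc]
    exact mul_le_mul_of_nonneg_right (sq_inv_mul_exp_le x₀ x hR hd₁) (by positivity)
  have h0 : 0 ≤ ∫ x in Ioo 0 1, p x ^ 2 := integral_nonneg fun x => sq_nonneg _
  have h1 : 0 ≤ ∫ x in Ioo 0 1, psiDeriv a x₀ R d₁ x ^ 2 * w x ^ 2 :=
    integral_nonneg fun x => by positivity
  refine (hI w p (hlac 0 x₀ le_rfl ha.mem.2.le (by simp)) (hlac x₀ 1 ha.mem.1.le le_rfl (by simp))
    hcw hw0 hw1 hB hp2 hwa hint l hl).trans ?_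
  rw [mul_assoc]
  gcongr
  calc l * (∫ x in Ioo 0 1, p x ^ 2) + l⁻¹ * ∫ x in Ioo 0 1, ((x - x₀) / a x) ^ 2 * w x ^ 2
      ≤ l * (∫ x in Ioo 0 1, p x ^ 2) +
        l⁻¹ * ((d₁⁻¹) ^ 2 * ∫ x in Ioo 0 1, psiDeriv a x₀ R d₁ x ^ 2 * w x ^ 2) := by gcongr
    _ ≤ _ := by
      have q1 : 0 ≤ (d₁⁻¹) ^ 2 * (l * ∫ x in Ioo 0 1, p x ^ 2) := by positivity
      have q2 : 0 ≤ l⁻¹ * ∫ x in Ioo 0 1, psiDeriv a x₀ R d₁ x ^ 2 * w x ^ 2 := by positivity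
      linarith

lemma exp_two_mul_phi (a : ℝ → ℝ) (x₀ T R d₁ d₂ s t x : ℝ) :
    Real.exp (2 * s * phi a x₀ T R d₁ d₂ t x) =
      Real.exp (s * Theta T t * psi a x₀ R d₁ d₂ x) ^ 2 := by
  rw [← Real.exp_nat_mul]
  congr 1
  unfold phi
  push_cast
  ring

lemma carlemanLHS_eq (a : ℝ → ℝ) (x₀ T R d₂ s : ℝ) (hd₁ : 0 < d₁) (v vx : ℝ → ℝ → ℝ)
    (p : ℝ × ℝ) : carlemanLHS a x₀ T R d₁ d₂ s v vx p = s * Theta T p.1 *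
      (Real.exp (s * Theta T p.1 * psi a x₀ R d₁ d₂ p.2) * vx p.1 p.2) ^ 2 +
      (d₁⁻¹ * Real.exp (-(R * (p.2 - x₀) ^ 2))) ^ 2 * ((s * Theta T p.1) ^ 3 *
        (psiDeriv a x₀ R d₁ p.2 ^ 2 * cylW T s (psi a x₀ R d₁ d₂) v p ^ 2)) := by
  unfold carlemanLHS cylW
  rw [exp_two_mul_phi, sq_sub_div_eq a x₀ R hd₁]
  ring

lemma DegenerateCoefficient.integrable_carlemanLHS (ha : DegenerateCoefficient a m m' x₀ K)
    (hR : 0 < R) (hd₁ : 0 < d₁)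
    (hd₂ : max ((1 - x₀) ^ 2 * Real.exp (R * (1 - x₀) ^ 2) / ((2 - K) * a 1))
      (x₀ ^ 2 * Real.exp (R * x₀ ^ 2) / ((2 - K) * a 0)) < d₂) (hs : 0 < s)
    (hv : MemL2L2Inv a T v) (hvx : MemL2L2 T vx) :
    Integrable (carlemanLHS a x₀ T R d₁ d₂ s v vx) (volQ T) := by
  have hW := ha.carlemanWeight hR hd₁ hd₂
  have e : carlemanLHS a x₀ T R d₁ d₂ s v vx = _ := funext (carlemanLHS_eq a x₀ T R d₂ s hd₁ v vx)
  rw [e]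
  have hr := hW.rapid_exp hs hvx
  refine Integrable.add ?_ (Integrable.bdd_mul (c := (d₁⁻¹) ^ 2)
    (hW.integrable_rho_w_sq hs hv 3) (by fun_prop) (Eventually.of_forall fun p => ?_))
  · refine ((RapidL2.moderate_mul (CarlemanWeight.moderate_k s T) hr).integrable_mul hr).congr
      (Eventually.of_forall fun p => ?_)
    ring
  · rw [Real.norm_of_nonneg (sq_nonneg _)]
    exact sq_inv_mul_exp_le x₀ p.2 hR hd₁

/-- Undoing the conjugation: `e^{kψ} v_x = w_x - kρw`, so `k (e^{kψ} v_x)² ≤ 2k w_x² + 2k³ ρ² w²`;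
the zeroth-order part contributes `d₁⁻²`. -/
lemma carlemanLHS_le (a : ℝ → ℝ) (x₀ d₂ : ℝ) (hR : 0 < R) (hd₁ : 0 < d₁) (hs : 0 < s)
    (v vx : ℝ → ℝ → ℝ) {p : ℝ × ℝ} (hp : p.1 ∈ Ioo 0 T) :
    carlemanLHS a x₀ T R d₁ d₂ s v vx p ≤ (2 + (d₁⁻¹) ^ 2) *
      (s * Theta T p.1 * cylX T s (psi a x₀ R d₁ d₂) (psiDeriv a x₀ R d₁) v vx p ^ 2 +
        (s * Theta T p.1) ^ 3 *
          (psiDeriv a x₀ R d₁ p.2 ^ 2 * cylW T s (psi a x₀ R d₁ d₂) v p ^ 2)) := by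
  rw [carlemanLHS_eq a x₀ T R d₂ s hd₁]
  have hk : 0 < s * Theta T p.1 := mul_pos hs (theta_pos hp)
  have e : Real.exp (s * Theta T p.1 * psi a x₀ R d₁ d₂ p.2) * vx p.1 p.2 =
      cylX T s (psi a x₀ R d₁ d₂) (psiDeriv a x₀ R d₁) v vx p - s * Theta T p.1 *
        (psiDeriv a x₀ R d₁ p.2 * cylW T s (psi a x₀ R d₁ d₂) v p) := by
    unfold cylX conjX cylW; ring
  rw [e, ← mul_pow (psiDeriv a x₀ R d₁ p.2)]
  have h1 := sq_inv_mul_exp_le x₀ p.2 hR hd₁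
  set k := s * Theta T p.1
  set X := cylX T s (psi a x₀ R d₁ d₂) (psiDeriv a x₀ R d₁) v vx p
  set W := psiDeriv a x₀ R d₁ p.2 * cylW T s (psi a x₀ R d₁ d₂) v p
  have h2 : k * (X - k * W) ^ 2 ≤ 2 * (k * X ^ 2) + 2 * (k ^ 3 * W ^ 2) := by
    have := mul_nonneg hk.le (sq_nonneg (X + k * W))
    linarith
  have h3 := mul_le_mul_of_nonneg_right h1 (show 0 ≤ k ^ 3 * W ^ 2 by positivity)
  have h4 : 0 ≤ (d₁⁻¹) ^ 2 * (k * X ^ 2) := by positivity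
  linarith

lemma DegenerateCoefficient.integrable_carlemanFlux (ha : DegenerateCoefficient a m m' x₀ K)
    (hR : 0 < R) (hd₁ : 0 < d₁)
    (hd₂ : max ((1 - x₀) ^ 2 * Real.exp (R * (1 - x₀) ^ 2) / ((2 - K) * a 1))
      (x₀ ^ 2 * Real.exp (R * x₀ ^ 2) / ((2 - K) * a 0)) < d₂) (hs : 0 < s)
    {y : ℝ} (hy : y ∈ Icc (0 : ℝ) 1)
    (h : IntegrableOn (fun t => drift x₀ R d₁ y * vx t y ^ 2) (Ioo 0 T)) :
    IntegrableOn (carlemanFlux a x₀ T R d₁ d₂ s vx y) (Ioo 0 T) := by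
  have hW := ha.carlemanWeight hR hd₁ hd₂
  have h2 := (hW.integrableOn_theta_exp_mul hs hy h).const_mul
    (d₁⁻¹ * Real.exp (-(R * (y - x₀) ^ 2)))
  refine h2.congr (Eventually.of_forall fun t => ?_)
  simp only [carlemanFlux, exp_two_mul_phi, drift, Real.exp_neg]
  have := Real.exp_pos (R * (y - x₀) ^ 2)
  field_simp

/-- Both boundary contributions are nonnegative, because `x - x₀` is positive at `1` and negative at
`0`. Hence the factor `e^{R(x - x₀)²}` of `aψ'` may be replaced by its upper bound `e^R`. -/
lemma drift_flux_le (hx₀ : x₀ ∈ Ioo (0 : ℝ) 1) (hR : 0 < R) (hd₁ : 0 < d₁) (hs : 0 < s) {t : ℝ}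
    (ht : t ∈ Ioo 0 T) (vx : ℝ → ℝ → ℝ) :
    -(-(s * Theta T t * drift x₀ R d₁ 1 *
        (Real.exp (s * Theta T t * psi a x₀ R d₁ d₂ 1) * vx t 1) ^ 2) +
      s * Theta T t * drift x₀ R d₁ 0 *
        (Real.exp (s * Theta T t * psi a x₀ R d₁ d₂ 0) * vx t 0) ^ 2) ≤
      s * d₁ * Real.exp R * carlemanBoundary a x₀ T R d₁ d₂ s vx t := by
  have hθ := theta_pos ht
  have hx1 : 0 < 1 - x₀ := sub_pos.2 hx₀.2
  have hx2 := hx₀.1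
  have e1 : Real.exp (R * (1 - x₀) ^ 2) ≤ Real.exp R := by
    rw [Real.exp_le_exp]; exact mul_le_of_le_one_right hR.le (by nlinarith)
  have e2 : Real.exp (R * (0 - x₀) ^ 2) ≤ Real.exp R := by
    rw [Real.exp_le_exp]; exact mul_le_of_le_one_right hR.le (by nlinarith)
  have h1 := mul_le_mul_of_nonneg_left e1 (show 0 ≤ s * d₁ * (Theta T t *
    (Real.exp (s * Theta T t * psi a x₀ R d₁ d₂ 1) * vx t 1) ^ 2 * (1 - x₀)) by positivity)
  have h2 := mul_le_mul_of_nonneg_left e2 (show 0 ≤ s * d₁ * (Theta T t *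
    (Real.exp (s * Theta T t * psi a x₀ R d₁ d₂ 0) * vx t 0) ^ 2 * x₀) by positivity)
  unfold carlemanBoundary carlemanFlux drift
  rw [exp_two_mul_phi, exp_two_mul_phi]
  linarith

end

end InteriorDegeneracy

end

/-! ### Assembly of the estimate. -/

open InteriorDegeneracy in
theorem theorem4p2 (a : ℝ → ℝ) (x₀ K : ℝ) (ha : CoefficientHypothesis a x₀ K)
    (T R d₁ d₂ : ℝ) (hT : 0 < T) (hR : 0 < R) (hd₁ : 0 < d₁)
    (hd₂ : max ((1 - x₀) ^ 2 * Real.exp (R * (1 - x₀) ^ 2) / ((2 - K) * a 1))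
      (x₀ ^ 2 * Real.exp (R * x₀ ^ 2) / ((2 - K) * a 0)) < d₂) :
    ∃ C s₀ : ℝ, 0 < C ∧ 0 < s₀ ∧
      ∀ v vx vxx vt vtx h : ℝ → ℝ → ℝ,
        MemS2 a T v vx vxx vt vtx → SolvesAdjoint a T v vxx vt h →
        ∀ s : ℝ, s₀ ≤ s →
          Integrable (carlemanLHS a x₀ T R d₁ d₂ s v vx) (volQ T) ∧
          Integrable (carlemanSource a x₀ T R d₁ d₂ s h) (volQ T) ∧
          IntegrableOn (carlemanBoundary a x₀ T R d₁ d₂ s vx) (Ioo 0 T) ∧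
          ∫ p, carlemanLHS a x₀ T R d₁ d₂ s v vx p ∂(volQ T) ≤
            C * ((∫ p, carlemanSource a x₀ T R d₁ d₂ s h p ∂(volQ T)) +
              s * d₁ * ∫ t in Ioo 0 T, carlemanBoundary a x₀ T R d₁ d₂ s vx t) := by
  obtain ⟨m, m', hm⟩ := ha.exists_data
  have hW := hm.carlemanWeight hR hd₁ hd₂
  obtain ⟨C, hC, hI⟩ := hm.exists_interpolation_conj hR hd₁ hd₂
  obtain ⟨c, s₀, hc, hs₀, hcoer⟩ := hW.exists_integral_bulkTerm_coercive hT hC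
  have hD : 0 < (2 + (d₁⁻¹) ^ 2) / c := by positivity
  refine ⟨(2 + (d₁⁻¹) ^ 2) / c * Real.exp R, s₀, by positivity, hs₀,
    fun v vx vxx vt vtx h hv hsol s hss => ?_⟩
  have hs : 0 < s := hs₀.trans_le hss
  have hv₁ := hv.1.1.2
  have hvt := hv.1.2.1.2.1
  have hvxx := hv.2.2.2
  have iL := hm.integrable_carlemanLHS hR hd₁ hd₂ hs hv₁.1 hv₁.2
  have iE := hW.integrable_energy hs hv₁.1 hv₁.2
  have eS : (fun p => (vt p.1 p.2 + a p.2 * vxx p.1 p.2) ^ 2 *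
      (Real.exp (s * Theta T p.1 * psi a x₀ R d₁ d₂ p.2) ^ 2 / a p.2)) =ᵐ[volQ T]
      carlemanSource a x₀ T R d₁ d₂ s h := by
    filter_upwards [hsol.1] with p hp
    rw [hp, carlemanSource, exp_two_mul_phi]
  have iS := (hW.integrable_source hs hvt hvxx).congr eS
  have hb := hW.integrableOn_boundary hv.2
  have iB : IntegrableOn (carlemanBoundary a x₀ T R d₁ d₂ s vx) (Ioo 0 T) :=
    (hm.integrable_carlemanFlux hR hd₁ hd₂ hs (by simp) hb.1).sub
      (hm.integrable_carlemanFlux hR hd₁ hd₂ hs (by simp) hb.2)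
  refine ⟨iL, iS, iB, ?_⟩
  have hcross := hW.two_mul_integral_crossTerm_le hs hv₁.1 hv₁.2 hvt hvxx
  rw [integral_congr_ae eS, hW.integral_crossTerm hT hs hv (by
    filter_upwards [hv.2.1] with t ht using hm.tendsto_psiDeriv_mul R d₁ ht)] at hcross
  have hbulk := hcoer s hss v vx hv₁.1 hv₁.2 (by
    filter_upwards [hv.2.1, ae_restrict_mem measurableSet_Ioo] with t ht ht2
    exact hI (s * Theta T t) (mul_pos hs (theta_pos ht2)).le (v t) (vx t) (vxx t)
      (fun x => cylW T s (psi a x₀ R d₁ d₂) v (t, x))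
      (fun x => cylX T s (psi a x₀ R d₁ d₂) (psiDeriv a x₀ R d₁) v vx (t, x)) ht rfl rfl)
  have hbdry : -(∫ t in Ioo 0 T, (-(s * Theta T t * drift x₀ R d₁ 1 *
        (Real.exp (s * Theta T t * psi a x₀ R d₁ d₂ 1) * vx t 1) ^ 2) +
      s * Theta T t * drift x₀ R d₁ 0 *
        (Real.exp (s * Theta T t * psi a x₀ R d₁ d₂ 0) * vx t 0) ^ 2)) ≤
      s * d₁ * Real.exp R * ∫ t in Ioo 0 T, carlemanBoundary a x₀ T R d₁ d₂ s vx t := by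
    rw [← integral_neg, ← integral_const_mul]
    have j1 := ((hW.integrableOn_theta_exp_mul hs (y := 1) (by simp) hb.1).const_mul s).neg
    have j0 := (hW.integrableOn_theta_exp_mul hs (y := 0) (by simp) hb.2).const_mul s
    refine integral_mono_ae (((j1.add j0).congr (Filter.Eventually.of_forall fun t => ?_)).neg)
      (iB.const_mul _) ?_
    · simp only [Pi.add_apply, Pi.neg_apply]; ring
    · filter_upwards [ae_restrict_mem measurableSet_Ioo] with t ht
      exact drift_flux_le hm.mem hR hd₁ hs ht vx
  have hLHS : ∫ p, carlemanLHS a x₀ T R d₁ d₂ s v vx p ∂(volQ T) ≤ (2 + (d₁⁻¹) ^ 2) *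
      ∫ p, (s * Theta T p.1 *
        cylX T s (psi a x₀ R d₁ d₂) (psiDeriv a x₀ R d₁) v vx p ^ 2 +
        (s * Theta T p.1) ^ 3 * (psiDeriv a x₀ R d₁ p.2 ^ 2 *
          cylW T s (psi a x₀ R d₁ d₂) v p ^ 2)) ∂(volQ T) := by
    rw [← integral_const_mul]
    refine integral_mono_ae iL (iE.const_mul _) ?_
    filter_upwards [ae_volQ_mem T] with p hp
    exact carlemanLHS_le a x₀ d₂ hR hd₁ hs v vx hp.1
  have hS0 : 0 ≤ ∫ p, carlemanSource a x₀ T R d₁ d₂ s h p ∂(volQ T) := by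
    refine integral_nonneg_of_ae ?_
    filter_upwards [hW.ae_volQ_pos T] with p hp
    unfold carlemanSource
    have := Real.exp_pos (2 * s * phi a x₀ T R d₁ d₂ p.1 p.2)
    simp only [Pi.zero_apply]
    positivity
  have hexp : 1 ≤ Real.exp R := Real.one_le_exp hR.le
  have hS1 := mul_le_mul_of_nonneg_right hexp hS0
  set J := ∫ p, (s * Theta T p.1 *
        cylX T s (psi a x₀ R d₁ d₂) (psiDeriv a x₀ R d₁) v vx p ^ 2 +
        (s * Theta T p.1) ^ 3 * (psiDeriv a x₀ R d₁ p.2 ^ 2 *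
          cylW T s (psi a x₀ R d₁ d₂) v p ^ 2)) ∂(volQ T)
  set S := ∫ p, carlemanSource a x₀ T R d₁ d₂ s h p ∂(volQ T)
  set B := ∫ t in Ioo 0 T, carlemanBoundary a x₀ T R d₁ d₂ s vx t
  -- The cross term gives `c J ≤ S/2 + e^R s d₁ B`; as `S ≥ 0` and `e^R ≥ 1`, the source is enlarged
  -- so that `e^R` factors out of both terms.
  have hJ : c * J ≤ Real.exp R * (S + s * d₁ * B) := by linarith
  calc _ ≤ (2 + (d₁⁻¹) ^ 2) * J := hLHS
    _ = (2 + (d₁⁻¹) ^ 2) / c * (c * J) := by field_simp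
    _ ≤ (2 + (d₁⁻¹) ^ 2) / c * (Real.exp R * (S + s * d₁ * B)) := by gcongr
    _ = _ := by ring
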